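/- Let $(M,g)$ be a connected smooth Riemannian manifold of dimension $n\ge 3$ and of constant curvature $\kappa$, that is $R_{ijkl}=\kappa(g_{ik}g_{jl}-g_{il}g_{jk})$, so that the scalar curvature is $R=n(n-1)\kappa$. A comma denotes covariant derivatives for the Levi-Civita connection, and $R_{ij}=R^a{}_{iaj}$ is the Ricci tensor. A (second order, maximally) superintegrable system on $M$ is a Hamiltonian $H=g^{ij}p_ip_j+V$ together with $2n-1$ constants of motion $F^{(\alpha)}=K^{(\alpha)ij}p_ip_j+V^{(\alpha)}$, $F^{(0)}=H$, $\{F^{(\alpha)},H\}=0$, with smooth symmetric tensors $K^{(\alpha)}$ and smooth functions $V^{(\alpha)}$, whose differentials are linearly independent almost everywhere on phase space. A structure tensor of the system is a smooth tensor $T_{ijk}$, symmetric and trace-free in its first two indices, such that $$V_{,ij}=T_{ij}{}^mV_{,m}+\tfrac1n g_{ij}\Delta V. \qquad (*)$$ The system with the structure tensor $T$ is non-degenerate if $(*)$ admits an $(n+2)$-dimensional space of smooth solutions $V$ on $M$. Write $\mathrm{Sym}$ for the sum over all permutations of the free indices (no normalising factor), and put $$t_k=T_{ak}{}^a,\qquad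 \bar t_i=\frac{n}{(n+2)(n-1)}T_{ij}{}^j,\qquad \mathring T_{ijk}=\text{the trace-free part of }\tfrac16\mathrm{Sym}(T_{ijk}),$$ $$Z_{ij}=\mathring T_i{}^{ab}\mathring T_{jab}-(n-2)\bigl(\mathring T_{ij}{}^a\bar t_a+\bar t_i\bar t_j\bigr)-R_{ij}.$$ A symmetric tensor $A_{ij}$ is a (second order) Codazzi tensor if $A_{ij,k}=A_{ik,j}$; a totally symmetric tensor $A_{ijk}$ is a third order Codazzi tensor if $A_{ijk,l}=A_{ijl,k}$. For every non-degenerate superintegrable system on $M$ with structure tensor $T$ the following hold. 1. On every simply connected open set $U\subseteq M$ there are a smooth function $t$ with $t_{,k}=t_k$ and a smooth function $\Phi$ such that $C_{ij}=Z_{ij}+\Phi g_{ij}$ is a Codazzi tensor on $U$. 2. Let $\Phi$ be a smooth function on an open set $U\subseteq M$ such that $C_{ij}=Z_{ij}+\Phi g_{ij}$ is a Codazzi tensor on $U$. Then every point of $U$ has an open neighbourhood in $U$ on which there is a smooth function $C$ (the structure function $C$) with $$C_{ij}=C_{,ij}+\frac{R}{n(n-1)}\,C\,g_{ij}.$$ 3.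 For all smooth functions $\Phi$ and $C$ on an open set $U\subseteq M$ such that $C_{ij}=Z_{ij}+\Phi g_{ij}$ is a Codazzi tensor on $U$ and $C_{ij}=C_{,ij}+\frac{R}{n(n-1)}Cg_{ij}$ there, the tensor $$B_{ijk}=T_{ijk}+\frac1{n-1}g_{ij}t_k+\frac1{2(n-2)}\mathrm{Sym}(g_{ij}C_{,k})$$ (with $t_k=t_{,k}$ for $t$ as in 1) is a third order Codazzi tensor on $U$, and every point of $U$ has an open neighbourhood in $U$ on which there is a smooth function $B$ (the structure function $B$) with $$B_{ijk}=\tfrac16\mathrm{Sym}\Bigl(\bigl(B_{,ij}+\tfrac{4R}{n(n-1)}g_{ij}B\bigr)_{,k}\Bigr).$$ -/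

import Mathlib

open scoped Manifold ContDiff

noncomputable section

namespace SuperInt

/-! ### Tensor calculus in a coordinate chart -/

/-- The model space `ℝⁿ`. -/
abbrev Coord (n : ℕ) : Type := EuclideanSpace ℝ (Fin n)

/-- Components `A_{i₁ … i_k}`, as functions of the coordinates, of a covariant tensor field of
rank `k` in a chart. -/
abbrev Comp (n k : ℕ) : Type := Coord n → (Fin k → Fin n) → ℝ

/-- Components `g_{ij}` of a metric in a chart. -/
abbrev MetricComp (n : ℕ) : Type := Coord n → Matrix (Fin n) (Fin n) ℝ

variable {n : ℕ}

/-- The partial derivative `∂_l f`. -/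
def pd (f : Coord n → ℝ) (l : Fin n) (y : Coord n) : ℝ :=
  fderiv ℝ f y (EuclideanSpace.single l 1)

/-- The Christoffel symbol `Γ^a_{ij}` of the Levi-Civita connection of `g`. -/
def christoffel (g : MetricComp n) (a i j : Fin n) (y : Coord n) : ℝ :=
  (1 / 2) * ∑ l, (g y)⁻¹ a l *
    (pd (fun z => g z j l) i y + pd (fun z => g z i l) j y - pd (fun z => g z i j) l y)

/-- `R^a_{jkl} = ∂_k Γ^a_{lj} - ∂_l Γ^a_{kj} + Γ^a_{kb} Γ^b_{lj} - Γ^a_{lb} Γ^b_{kj}`. -/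
def riemannUp (g : MetricComp n) (a j k l : Fin n) (y : Coord n) : ℝ :=
  pd (christoffel g a l j) k y - pd (christoffel g a k j) l y +
    ∑ b, (christoffel g a k b y * christoffel g b l j y -
      christoffel g a l b y * christoffel g b k j y)

/-- `R_{ijkl} = g_{ia} R^a_{jkl}`. -/
def riemann (g : MetricComp n) (i j k l : Fin n) (y : Coord n) : ℝ :=
  ∑ a, g y i a * riemannUp g a j k l y

/-- The Ricci tensor `R_{ij} = R^a_{iaj}`. -/
def ricci (g : MetricComp n) (i j : Fin n) (y : Coord n) : ℝ :=
  ∑ a, riemannUp g a i a j y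

/-- The covariant derivative; the index of differentiation is the last one,
`(∇A)_{i₁ … i_k l} = A_{i₁ … i_k , l}`. -/
def covD {k : ℕ} (g : MetricComp n) (A : Comp n k) : Comp n (k + 1) := fun y idx =>
  pd (fun z => A z (Fin.init idx)) (idx (Fin.last k)) y -
    ∑ r : Fin k, ∑ a : Fin n, christoffel g a (idx (Fin.last k)) (idx r.castSucc) y *
      A y (Function.update (Fin.init idx) r a)

/-- A function, as a tensor field of rank `0`. -/
def scalar (f : Coord n → ℝ) : Comp n 0 := fun y _ => f y

/-- `f_{,i}`. -/
def grad (g : MetricComp n) (f : Coord n → ℝ) : Comp n 1 := covD g (scalar f)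

/-- `f_{,ij}`. -/
def hess (g : MetricComp n) (f : Coord n → ℝ) : Comp n 2 := covD g (grad g f)

/-- The Laplacian `Δf = g^{ij} f_{,ij}`. -/
def laplacian (g : MetricComp n) (f : Coord n → ℝ) (y : Coord n) : ℝ :=
  ∑ i, ∑ j, (g y)⁻¹ i j * hess g f y ![i, j]

/-- The complete symmetriser (the sum over all permutations of the indices, without a
normalising factor). -/
def young {k : ℕ} (A : Comp n k) : Comp n k := fun y idx =>
  ∑ σ : Equiv.Perm (Fin k), A y (idx ∘ σ)

/-- The contraction `g^{ab} A_{abk}` of the first two indices. -/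
def trace12 (g : MetricComp n) (A : Comp n 3) (k : Fin n) (y : Coord n) : ℝ :=
  ∑ a, ∑ b, (g y)⁻¹ a b * A y ![a, b, k]

/-- The contraction `t_k = g^{ab} T_{akb}` of the first and the last index. -/
def traceForm (g : MetricComp n) (T : Comp n 3) (k : Fin n) (y : Coord n) : ℝ :=
  ∑ a, ∑ b, (g y)⁻¹ a b * T y ![a, k, b]

/-- The totally trace-free part of a totally symmetric tensor of rank `3`. -/
def traceFree3 (g : MetricComp n) (A : Comp n 3) : Comp n 3 := fun y idx =>
  A y idx - (1 / ((n : ℝ) + 2)) *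
    (g y (idx 0) (idx 1) * trace12 g A (idx 2) y +
      g y (idx 1) (idx 2) * trace12 g A (idx 0) y +
      g y (idx 2) (idx 0) * trace12 g A (idx 1) y)

/-- `T°_{ijk}`: the trace-free part of the symmetrisation of `T_{ijk}`. -/
def ringT (g : MetricComp n) (T : Comp n 3) : Comp n 3 :=
  traceFree3 g (fun y idx => (1 / 6) * young T y idx)

/-- `t̄_i = n / ((n + 2) (n - 1)) T_{ij}^j`. -/
def barT (g : MetricComp n) (T : Comp n 3) (i : Fin n) (y : Coord n) : ℝ :=
  (n : ℝ) / (((n : ℝ) + 2) * ((n : ℝ) - 1)) * ∑ a, ∑ b, (g y)⁻¹ a b * T y ![i, a, b]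

/-- `Z_{ij} = T°_i^{ab} T°_{jab} - (n - 2) (T°_{ij}^a t̄_a + t̄_i t̄_j) - R_{ij}`. -/
def zTensor (g : MetricComp n) (T : Comp n 3) : Comp n 2 := fun y idx =>
  (∑ a, ∑ b, ∑ c, ∑ d, (g y)⁻¹ a c * (g y)⁻¹ b d *
      ringT g T y ![idx 0, a, b] * ringT g T y ![idx 1, c, d]) -
    ((n : ℝ) - 2) *
      ((∑ a, ∑ b, (g y)⁻¹ a b * ringT g T y ![idx 0, idx 1, a] * barT g T b y) +
        barT g T (idx 0) y * barT g T (idx 1) y) -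
    ricci g (idx 0) (idx 1) y

/-- `C_{ij} = Z_{ij} + Φ g_{ij}`. -/
def cTensor (g : MetricComp n) (T : Comp n 3) (Φ : Coord n → ℝ) : Comp n 2 := fun y idx =>
  zTensor g T y idx + Φ y * g y (idx 0) (idx 1)

/-- `B_{ijk} = T_{ijk} + 1/(n-1) g_{ij} t_k + 1/(2(n-2)) young(g_{ij} C_{,k})`. -/
def bTensor (g : MetricComp n) (T : Comp n 3) (C : Coord n → ℝ) : Comp n 3 := fun y idx =>
  T y idx + 1 / ((n : ℝ) - 1) * (g y (idx 0) (idx 1) * traceForm g T (idx 2) y) +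
    1 / (2 * ((n : ℝ) - 2)) *
      young (fun z (s : Fin 3 → Fin n) => g z (s 0) (s 1) * grad g C z ![s 2]) y idx

/-- Second order Codazzi tensors on a set `s`: `A_{ij} = A_{ji}` and `A_{ij,k} = A_{ik,j}`. -/
def IsCodazziTwo (g : MetricComp n) (A : Comp n 2) (s : Set (Coord n)) : Prop :=
  ∀ y ∈ s, (∀ i j, A y ![i, j] = A y ![j, i]) ∧
    ∀ i j k, covD g A y ![i, j, k] - covD g A y ![i, k, j] = 0

/-- Third order Codazzi tensors on a set `s`: `A_{ijk}` is totally symmetric and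
`A_{ijk,l} = A_{ijl,k}`. -/
def IsCodazziThree (g : MetricComp n) (A : Comp n 3) (s : Set (Coord n)) : Prop :=
  ∀ y ∈ s, (∀ (σ : Equiv.Perm (Fin 3)) (idx : Fin 3 → Fin n), A y (idx ∘ σ) = A y idx) ∧
    ∀ i j k l, covD g A y ![i, j, k, l] - covD g A y ![i, j, l, k] = 0

/-- `A_{ij} = C_{,ij} + κ C g_{ij}` on `s`. -/
def HasPotentialTwo (g : MetricComp n) (κ : ℝ) (A : Comp n 2) (C : Coord n → ℝ)
    (s : Set (Coord n)) : Prop :=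
  ∀ y ∈ s, ∀ i j, A y ![i, j] = hess g C y ![i, j] + κ * C y * g y i j

/-- `A_{ijk} = 1/6 young((B_{,ij} + 4 κ g_{ij} B)_{,k})` on `s`. -/
def HasPotentialThree (g : MetricComp n) (κ : ℝ) (A : Comp n 3) (B : Coord n → ℝ)
    (s : Set (Coord n)) : Prop :=
  ∀ y ∈ s, ∀ i j k, A y ![i, j, k] =
    (1 / 6) * young
      (covD g (fun z (r : Fin 2 → Fin n) => hess g B z r + 4 * κ * g z (r 0) (r 1) * B z))
      y ![i, j, k]

/-- The canonical Poisson bracket of functions of `(q, p)`. -/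
def poisson (F G : Coord n × Coord n → ℝ) (z : Coord n × Coord n) : ℝ :=
  ∑ i, (fderiv ℝ F z (EuclideanSpace.single i 1, 0) * fderiv ℝ G z (0, EuclideanSpace.single i 1) -
    fderiv ℝ G z (EuclideanSpace.single i 1, 0) * fderiv ℝ F z (0, EuclideanSpace.single i 1))

/-- The function `K^{ij}(q) p_i p_j + W(q)` on phase space. -/
def quadFun (g : MetricComp n) (K : Comp n 2) (W : Coord n → ℝ) (z : Coord n × Coord n) : ℝ :=
  (∑ i, ∑ j, ∑ a, ∑ b,
    (g z.1)⁻¹ i a * (g z.1)⁻¹ j b * K z.1 ![a, b] * z.2 i * z.2 j) + W z.1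

/-! ### Tensor fields on a Riemannian manifold -/

variable {M : Type*} [TopologicalSpace M] [ChartedSpace (Coord n) M] [IsManifold (𝓡 n) ∞ M]

/-- A Riemannian metric on `M`. -/
abbrev Metric (n : ℕ) (M : Type*) [TopologicalSpace M] [ChartedSpace (Coord n) M]
    [IsManifold (𝓡 n) ∞ M] : Type _ :=
  Bundle.ContMDiffRiemannianMetric (𝓡 n) ∞ (Coord n) (fun x : M => TangentSpace (𝓡 n) x)

/-- Covariant tensor fields of rank `k` on `M`. -/
abbrev TensorField (n k : ℕ) (M : Type*) [TopologicalSpace M] [ChartedSpace (Coord n) M] : Type _ :=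
  ∀ x : M, MultilinearMap ℝ (fun _ : Fin k => TangentSpace (𝓡 n) x) ℝ

/-- The smooth charts of `M`. -/
abbrev charts (n : ℕ) (M : Type*) [TopologicalSpace M] [ChartedSpace (Coord n) M] :
    Set (OpenPartialHomeomorph M (Coord n)) :=
  IsManifold.maximalAtlas (𝓡 n) ∞ M

/-- The coordinate vector `∂_i` of the chart `φ` at the point with coordinates `y`. -/
def coordVec (φ : OpenPartialHomeomorph M (Coord n)) (y : Coord n) (i : Fin n) :
    TangentSpace (𝓡 n) (φ.symm y) :=
  mfderiv (𝓡 n) (𝓡 n) φ.symm y (EuclideanSpace.single i (1 : ℝ) : Coord n)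

/-- The components `g_{ij} = g(∂_i, ∂_j)` of the metric in a chart. -/
def Metric.comp (g : Metric n M) (φ : OpenPartialHomeomorph M (Coord n)) : MetricComp n :=
  fun y => Matrix.of fun i j => g.inner (φ.symm y) (coordVec φ y i) (coordVec φ y j)

/-- The components `A_{i₁ … i_k} = A(∂_{i₁}, …, ∂_{i_k})` of a tensor field in a chart. -/
def TensorField.comp {k : ℕ} (A : TensorField n k M) (φ : OpenPartialHomeomorph M (Coord n)) :
    Comp n k :=
  fun y idx => A (φ.symm y) fun r => coordVec φ y (idx r)

/-- A tensor field is smooth if its components in all charts are smooth. -/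
def TensorField.IsSmooth {k : ℕ} (A : TensorField n k M) : Prop :=
  ∀ φ ∈ charts n M, ∀ idx, ContDiffOn ℝ ∞ (fun y => TensorField.comp A φ y idx) φ.target

/-- The part of the coordinate domain of `φ` that represents points of `U`. -/
def chartDomain (φ : OpenPartialHomeomorph M (Coord n)) (U : Set M) : Set (Coord n) :=
  {y | y ∈ φ.target ∧ φ.symm y ∈ U}

/-- `M` has constant curvature `κ`: `R_{ijkl} = κ (g_{ik} g_{jl} - g_{il} g_{jk})`.  The scalar
curvature is then `R = n (n - 1) κ`. -/
def HasConstantCurvature (g : Metric n M) (κ : ℝ) : Prop :=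
  ∀ φ ∈ charts n M, ∀ y ∈ φ.target, ∀ i j k l,
    riemann (Metric.comp g φ) i j k l y =
      κ * (Metric.comp g φ y i k * Metric.comp g φ y j l -
        Metric.comp g φ y i l * Metric.comp g φ y j k)

/-! ### Superintegrable systems -/

/-- A second order maximally superintegrable system on the Riemannian manifold `(M, g)`: the
Hamiltonian `H = g + V` with `2n - 1` constants of motion `F^α = K^α + W^α`, the first of which
is `H`, whose differentials are linearly independent almost everywhere on the phase space. -/
structure System (g : Metric n M) where
  V : M → ℝ
  smooth_V : ContMDiff (𝓡 n) 𝓘(ℝ, ℝ) ∞ V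
  K : Fin (2 * n - 1) → TensorField n 2 M
  smooth_K : ∀ α, TensorField.IsSmooth (K α)
  symm_K : ∀ α x (u v : TangentSpace (𝓡 n) x), K α x ![u, v] = K α x ![v, u]
  W : Fin (2 * n - 1) → M → ℝ
  smooth_W : ∀ α, ContMDiff (𝓡 n) 𝓘(ℝ, ℝ) ∞ (W α)
  hamiltonian : ∀ α : Fin (2 * n - 1), α.val = 0 →
    (∀ x (u v : TangentSpace (𝓡 n) x), K α x ![u, v] = g.inner x u v) ∧ W α = V
  integral : ∀ φ ∈ charts n M, ∀ α β : Fin (2 * n - 1), β.val = 0 →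
    ∀ y ∈ φ.target, ∀ p : Coord n,
    poisson (quadFun (Metric.comp g φ) (TensorField.comp (K α) φ) (W α ∘ φ.symm))
      (quadFun (Metric.comp g φ) (TensorField.comp (K β) φ) (W β ∘ φ.symm)) (y, p) = 0
  independent : ∀ φ ∈ charts n M,
    ∀ᵐ z ∂(MeasureTheory.volume : MeasureTheory.Measure (Coord n × Coord n)), z.1 ∈ φ.target →
      LinearIndependent ℝ fun α =>
        fderiv ℝ (quadFun (Metric.comp g φ) (TensorField.comp (K α) φ) (W α ∘ φ.symm)) z

/-- The equation `V_{,ij} = T_{ij}^m V_{,m} + (1/n) g_{ij} ΔV`. -/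
def SolvesWilczynski (g : Metric n M) (T : TensorField n 3 M) (V : M → ℝ) : Prop :=
  ∀ φ ∈ charts n M, ∀ y ∈ φ.target, ∀ i j,
    hess (Metric.comp g φ) (V ∘ φ.symm) y ![i, j] =
      (∑ m, ∑ a, (Metric.comp g φ y)⁻¹ m a * TensorField.comp T φ y ![i, j, a] *
        grad (Metric.comp g φ) (V ∘ φ.symm) y ![m]) +
      1 / (n : ℝ) * Metric.comp g φ y i j * laplacian (Metric.comp g φ) (V ∘ φ.symm) y

/-- `T` is a structure tensor of the system `S`: a smooth tensor, symmetric and trace-free in its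
first two indices, such that the potential satisfies the equation above. -/
structure IsStructureTensor {g : Metric n M} (S : System g) (T : TensorField n 3 M) : Prop where
  smooth : TensorField.IsSmooth T
  symm : ∀ x (u v w : TangentSpace (𝓡 n) x), T x ![u, v, w] = T x ![v, u, w]
  traceFree : ∀ φ ∈ charts n M, ∀ y ∈ φ.target, ∀ k,
    trace12 (Metric.comp g φ) (TensorField.comp T φ) k y = 0
  wilczynski : SolvesWilczynski g T S.V

/-- The system `S` with structure tensor `T` is non-degenerate: the equation above admits an
`(n + 2)`-dimensional space of solutions. -/
structure IsNondegenerate {g : Metric n M} (S : System g) (T : TensorField n 3 M) : Prop where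
  isStructureTensor : IsStructureTensor S T
  solutions : ∃ L : Submodule ℝ (M → ℝ), Module.finrank ℝ L = n + 2 ∧
    ∀ V ∈ L, ContMDiff (𝓡 n) 𝓘(ℝ, ℝ) ∞ V ∧ SolvesWilczynski g T V

/-- A smooth function on the open set `U`. -/
def SmoothOn (n : ℕ) {M : Type*} [TopologicalSpace M] [ChartedSpace (Coord n) M]
    (f : M → ℝ) (U : Set M) : Prop :=
  ContMDiffOn (𝓡 n) 𝓘(ℝ, ℝ) ∞ f U

/-- `t_{,k} = T_{ak}^a` on `U`. -/
def IsTracePotential (g : Metric n M) (T : TensorField n 3 M) (t : M → ℝ) (U : Set M) : Prop :=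
  ∀ φ ∈ charts n M, ∀ y ∈ chartDomain φ U, ∀ k,
    grad (Metric.comp g φ) (t ∘ φ.symm) y ![k] =
      traceForm (Metric.comp g φ) (TensorField.comp T φ) k y

/-- `C_{ij} = Z_{ij} + Φ g_{ij}` is a Codazzi tensor on `U`. -/
def CIsCodazzi (g : Metric n M) (T : TensorField n 3 M) (Φ : M → ℝ) (U : Set M) : Prop :=
  ∀ φ ∈ charts n M, IsCodazziTwo (Metric.comp g φ)
    (cTensor (Metric.comp g φ) (TensorField.comp T φ) (Φ ∘ φ.symm)) (chartDomain φ U)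

/-- `Z_{ij} + Φ g_{ij} = C_{,ij} + κ C g_{ij}` on `U`. -/
def IsCPotential (g : Metric n M) (κ : ℝ) (T : TensorField n 3 M) (Φ C : M → ℝ)
    (U : Set M) : Prop :=
  ∀ φ ∈ charts n M, HasPotentialTwo (Metric.comp g φ) κ
    (cTensor (Metric.comp g φ) (TensorField.comp T φ) (Φ ∘ φ.symm)) (C ∘ φ.symm)
    (chartDomain φ U)

/-- `B_{ijk}`, formed with the function `C`, is a Codazzi tensor on `U`. -/
def BIsCodazzi (g : Metric n M) (T : TensorField n 3 M) (C : M → ℝ) (U : Set M) : Prop :=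
  ∀ φ ∈ charts n M, IsCodazziThree (Metric.comp g φ)
    (bTensor (Metric.comp g φ) (TensorField.comp T φ) (C ∘ φ.symm)) (chartDomain φ U)

/-- `B_{ijk} = 1/6 young((B_{,ij} + 4 κ g_{ij} B)_{,k})` on `U`. -/
def IsBPotential (g : Metric n M) (κ : ℝ) (T : TensorField n 3 M) (C B : M → ℝ)
    (U : Set M) : Prop :=
  ∀ φ ∈ charts n M, HasPotentialThree (Metric.comp g φ) κ
    (bTensor (Metric.comp g φ) (TensorField.comp T φ) (C ∘ φ.symm)) (B ∘ φ.symm)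
    (chartDomain φ U)

end SuperInt

end

noncomputable section

namespace SuperInt

/-! ### A linear Frobenius theorem -/

section Frobenius

open Set _root_.Metric

variable {E F G : Type*} [NormedAddCommGroup E] [NormedSpace ℝ E]
  [NormedAddCommGroup F] [NormedSpace ℝ F] [NormedAddCommGroup G] [NormedSpace ℝ G]

/-! Put S_{ijk} = T_{ijk} + g_{ij} t_k/(n-1) and U = ΔV/n - t^m V_{,m}/(n-1). The equation for the
potential becomes V_{,ij} = S_{ij}^m V_{,m} + U g_{ij}: up to the term U g, the form dV is parallel
for the connection Γ + S. Symmetry of the third derivatives of V, contracted with the metric, gives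
dU = dV ∘ X with an endomorphism X built from the curvature of Γ + S (`fderiv_auxPotential`). Hence
the jet (V, dV, U) of a solution is parallel for a connection on a bundle of rank n + 2. As M is
connected, a solution is determined by its jet at one point, so an (n+2)-dimensional solution space
realises every jet at every point (`IsNondegenerate.jetsSurjective`). The integrability conditions
are linear in (dV, U), so their coefficients vanish separately: S is totally symmetric, the
curvature of Γ + S is a product of g and X, and X is self-adjoint and Codazzi for Γ + S.

In constant curvature κ the curvature of Γ is absorbed by replacing X by X + κ, and what remains
(`CurvatureEq`) relates the alternated covariant derivative of S, the commutators of the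
endomorphisms S_u, and the product of g with X + κ. Interchanging two arguments separates the
derivatives (`CurvatureEq.sym`) from the commutators (`CurvatureEq.anti`). The Jacobi identity for
the S_u, contracted once, shows that X + κ is Codazzi for Γ itself up to a one-form η
(`CurvatureEq.deviation`, `xHat_deviation`); the Ricci identity then forces dη = 0, because n ≥ 3
(`closed_of_deviation`). Tracing the commutator relation gives Z = (n-2)/2 (X + κ) + (function) g
(`zForm_eq`). Thus Z + Φ g is Codazzi exactly when dΦ is a prescribed closed form, which yields Φ.
The form t_k is closed because it is a multiple of the difference of the traces of the connections Γ
+ S and Γ, whose curvatures are both trace-free.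

For C, the Codazzi condition is exactly the Frobenius integrability of the system dC = β, ∇β =
C_{ij} - κ C g (`flatTwo`). For B, the derivative relation expresses the alternated derivative of S
by X + κ, while the Hessian of C is (n-2)/2 (X + κ) plus a multiple of g; the correction term in
B_{ijk} is the one that cancels it (`bCLM_codazzi`). The potential of B_{ijk} solves a closed linear
system for (B, dB, Hessian of B), again integrable by the Codazzi and Ricci identities
(`flatThree`).

The analysis takes place in charts and rests on a linear Frobenius theorem, proved by integrating
along rays. To return to M, tensoriality under changes of charts is checked, and on a simply
connected set the local primitives are glued by a section of a covering whose fibre is ℝ with the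
discrete topology. -/

theorem norm_le_gronwallBound_unitInterval {α α' : ℝ → F} {δ K ε : ℝ}
    (h : ∀ t ∈ Icc (0 : ℝ) 1, HasDerivWithinAt α (α' t) (Icc 0 1) t) (h0 : ‖α 0‖ ≤ δ)
    (hb : ∀ t ∈ Icc (0 : ℝ) 1, ‖α' t‖ ≤ K * ‖α t‖ + ε) :
    ∀ t ∈ Icc (0 : ℝ) 1, ‖α t‖ ≤ gronwallBound δ K ε t := by
  intro t ht
  have := norm_le_gronwallBound_of_norm_deriv_right_le (f := α) (f' := α') (δ := δ) (K := K)
    (ε := ε) (a := 0) (b := 1) (fun t ht => (h t ht).continuousWithinAt)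
    (fun t ht => (h t ⟨ht.1, ht.2.le⟩).mono_of_mem_nhdsWithin (Icc_mem_nhdsGE_of_mem ht))
    h0 (fun t ht => hb t ⟨ht.1, ht.2.le⟩) t ht
  simpa using this

/-- Uniform first and second order Taylor estimates near a point. -/
theorem exists_taylor_bounds {f : E → G} {x₀ : E} (hf : ContDiffAt ℝ ∞ f x₀) :
    ∃ r > 0, ∃ C ≥ 0, ∀ p ∈ ball x₀ r, DifferentiableAt ℝ f p ∧ ‖f p‖ ≤ C ∧
      ‖fderiv ℝ f p‖ ≤ C ∧ ∀ q ∈ ball x₀ r, ‖f q - f p‖ ≤ C * ‖q - p‖ ∧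
      ‖f q - f p - fderiv ℝ f p (q - p)‖ ≤ C * ‖q - p‖ ^ 2 := by
  have hf' : ContDiffAt ℝ 1 (fderiv ℝ f) x₀ := hf.fderiv_right (m := 1) (by norm_cast)
  obtain ⟨K, s, hs, hK⟩ := hf'.exists_lipschitzOnWith
  have h1 : ∀ᶠ p in nhds x₀, ‖f p‖ < ‖f x₀‖ + 1 :=
    hf.continuousAt.norm.eventually_lt continuousAt_const (by simp)
  have h2 : ∀ᶠ p in nhds x₀, ‖fderiv ℝ f p‖ < ‖fderiv ℝ f x₀‖ + 1 :=
    hf'.continuousAt.norm.eventually_lt continuousAt_const (by simp)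
  have h3 : ∀ᶠ p in nhds x₀, ContDiffAt ℝ 1 f p :=
    (hf.of_le (by exact_mod_cast le_top)).eventually (by simp)
  obtain ⟨r, hr, hball⟩ := Metric.eventually_nhds_iff_ball.1 (h1.and (h2.and (h3.and hs)))
  have hd : ∀ p ∈ ball x₀ r, DifferentiableAt ℝ f p := fun p hp =>
    (hball p hp).2.2.1.differentiableAt (by simp)
  set C : ℝ := ‖f x₀‖ + 1 + (‖fderiv ℝ f x₀‖ + 1) + K with hC
  have hKC : (K : ℝ) ≤ C := by have := norm_nonneg (f x₀); have := norm_nonneg (fderiv ℝ f x₀)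
                               linarith
  refine ⟨r, hr, C, by positivity, fun p hp => ⟨hd p hp, ?_, ?_, fun q hq => ⟨?_, ?_⟩⟩⟩
  · have := (hball p hp).1; have := norm_nonneg (fderiv ℝ f x₀); have := K.2; simp only [hC]; linarith
  · have := (hball p hp).2.1; have := norm_nonneg (f x₀); have := K.2; simp only [hC]; linarith
  · refine (convex_ball x₀ r).norm_image_sub_le_of_norm_fderiv_le (𝕜 := ℝ) hd (fun z hz => ?_) hp hq
    have := (hball z hz).2.1; have := norm_nonneg (f x₀); have := K.2; simp only [hC]; linarith
  · have hseg : segment ℝ p q ⊆ ball x₀ r := (convex_ball x₀ r).segment_subset hp hq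
    -- Mean value inequality for f minus its linear part at p: on the segment the derivative of that
    -- difference is at most K‖q - p‖.
    have := (convex_segment p q).norm_image_sub_le_of_norm_hasFDerivWithin_le' (𝕜 := ℝ) (f := f)
      (f' := fderiv ℝ f) (φ := fderiv ℝ f p) (C := K * ‖q - p‖)
      (fun z hz => (hd z (hseg hz)).hasFDerivAt.hasFDerivWithinAt) (fun z hz => by
        refine (hK.norm_sub_le (hball z (hseg hz)).2.2.2 (hball p hp).2.2.2).trans ?_
        gcongr
        simpa [norm_sub_rev] using norm_sub_le_of_mem_segment hz)
      (left_mem_segment ℝ p q) (right_mem_segment ℝ p q)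
    refine this.trans ?_
    nlinarith [sq_nonneg ‖q - p‖]

/-- Two-parameter remainder estimate for a smooth family of linear maps. -/
theorem norm_remainder_le {f : E → E →L[ℝ] G} {C t : ℝ} {p x k : E} (hC : 0 ≤ C)
    (ht : t ∈ Icc (0 : ℝ) 1) (hx : ‖x + k‖ ≤ 1) (hd : ‖fderiv ℝ f p‖ ≤ C)
    (h2 : ‖f (p + t • k) - f p - fderiv ℝ f p (t • k)‖ ≤ C * ‖t • k‖ ^ 2) :
    ‖f (p + t • k) (x + k) - f p (x + k) - t • fderiv ℝ f p k x‖ ≤ 2 * C * ‖k‖ ^ 2 := by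
  -- Replacing x by x + k in the first order term costs only the last summand, which is quadratic in
  -- k.
  have e : f (p + t • k) (x + k) - f p (x + k) - t • fderiv ℝ f p k x =
      (f (p + t • k) - f p - fderiv ℝ f p (t • k)) (x + k) + t • fderiv ℝ f p k k := by
    simp only [map_smul, sub_apply, smul_apply, map_add]
    abel
  have ht' : ‖t‖ ≤ 1 := by rw [Real.norm_eq_abs, abs_of_nonneg ht.1]; exact ht.2
  have htk : ‖t • k‖ ≤ ‖k‖ := by
    rw [norm_smul]; exact mul_le_of_le_one_left (norm_nonneg _) ht'
  rw [e]
  have a1 : ‖(f (p + t • k) - f p - fderiv ℝ f p (t • k)) (x + k)‖ ≤ C * ‖k‖ ^ 2 := by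
    refine (ContinuousLinearMap.le_opNorm _ _).trans ?_
    calc _ ≤ (C * ‖t • k‖ ^ 2) * 1 := by gcongr
      _ ≤ C * ‖k‖ ^ 2 := by rw [mul_one]; gcongr
  have a2 : ‖t • fderiv ℝ f p k k‖ ≤ C * ‖k‖ ^ 2 := by
    rw [norm_smul]
    calc _ ≤ 1 * (C * ‖k‖ * ‖k‖) := by
          gcongr
          refine (ContinuousLinearMap.le_opNorm₂ _ _ _).trans ?_
          gcongr
      _ = C * ‖k‖ ^ 2 := by ring
  exact (norm_add_le _ _).trans (by linarith)

/-- Picard–Lindelöf along the ray t ↦ x₀ + t x. The right-hand side is proportional to ‖x‖, so for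
short x its norm is at most 1 on the unit ball around u₀, and the solution lives on all of [0, 1].
-/
theorem exists_radial_solution [CompleteSpace F] {θ : E → E →L[ℝ] F →L[ℝ] F} {b : E → E →L[ℝ] F}
    {x₀ x : E} {C r : ℝ} (hC : 0 ≤ C) (hθ : ContinuousOn θ (ball x₀ r))
    (hb : ContinuousOn b (ball x₀ r)) (hθC : ∀ p ∈ ball x₀ r, ‖θ p‖ ≤ C)
    (hbC : ∀ p ∈ ball x₀ r, ‖b p‖ ≤ C) (u₀ : F) (hxr : ‖x‖ < r)
    (hx : C * ‖x‖ * (‖u₀‖ + 2) ≤ 1) :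
    ∃ α : ℝ → F, α 0 = u₀ ∧ ∀ t ∈ Icc (0 : ℝ) 1,
      HasDerivWithinAt α (θ (x₀ + t • x) x (α t) + b (x₀ + t • x) x) (Icc 0 1) t := by
  have hmem : ∀ t ∈ Icc (0 : ℝ) 1, x₀ + t • x ∈ ball x₀ r := by
    intro t ht
    rw [mem_ball_iff_norm, add_sub_cancel_left, norm_smul, Real.norm_eq_abs, abs_of_nonneg ht.1]
    exact (mul_le_of_le_one_left (norm_nonneg _) ht.2).trans_lt hxr
  have hc : ContinuousOn (fun t : ℝ => x₀ + t • x) (Icc 0 1) := by fun_prop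
  have hPL : IsPicardLindelof (fun t u => θ (x₀ + t • x) x u + b (x₀ + t • x) x)
      (tmin := 0) (tmax := 1) ⟨0, by simp⟩ u₀ 1 0 1 ⟨C * ‖x‖, by positivity⟩ := by
    refine ⟨fun t ht => ?_, fun u _ => ?_, fun t ht u hu => ?_, by simp⟩
    · refine LipschitzOnWith.of_dist_le_mul fun u _ v _ => ?_
      rw [dist_eq_norm, dist_eq_norm, add_sub_add_right_eq_sub, ← map_sub]
      refine (ContinuousLinearMap.le_opNorm₂ _ _ _).trans ?_
      have := hθC _ (hmem t ht)
      change _ ≤ C * ‖x‖ * ‖u - v‖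
      gcongr
    · exact (((hθ.comp hc hmem).clm_apply continuousOn_const).clm_apply continuousOn_const).add
        ((hb.comp hc hmem).clm_apply continuousOn_const)
    · have h1 := hθC _ (hmem t ht)
      have h2 := hbC _ (hmem t ht)
      have hu' : ‖u‖ ≤ ‖u₀‖ + 1 := by
        have := norm_sub_norm_le u u₀
        have := mem_closedBall_iff_norm.1 hu
        simp at this
        linarith
      calc _ ≤ C * ‖x‖ * (‖u₀‖ + 1) + C * ‖x‖ := by
            refine (norm_add_le _ _).trans (add_le_add ?_ ?_)
            · refine (ContinuousLinearMap.le_opNorm₂ _ _ _).trans ?_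
              gcongr
            · refine (ContinuousLinearMap.le_opNorm _ _).trans ?_
              gcongr
        _ = C * ‖x‖ * (‖u₀‖ + 2) := by ring
        _ ≤ _ := hx
  obtain ⟨α, h0, h1⟩ := hPL.exists_eq_forall_mem_Icc_hasDerivWithinAt₀
  exact ⟨α, h0, h1⟩

/-- Solutions of a first order system `du = θ u + b` with smooth coefficients are smooth. -/
theorem contDiffOn_of_hasFDerivAt {θ : E → E →L[ℝ] F →L[ℝ] F} {b : E → E →L[ℝ] F} {u : E → F}
    {B : Set E} (hB : IsOpen B) (hθ : ContDiffOn ℝ ∞ θ B) (hb : ContDiffOn ℝ ∞ b B)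
    (hu : ∀ x ∈ B, HasFDerivAt u ((θ x).flip (u x) + b x) x) : ContDiffOn ℝ ∞ u B := by
  -- Bootstrapping: if u is of class C^m, so is the right-hand side, hence u is of class C^(m+1).
  have key : ∀ m : ℕ, ContDiffOn ℝ m u B := by
    intro m
    induction m with
    | zero =>
      exact contDiffOn_zero.2 fun x hx => (hu x hx).continuousAt.continuousWithinAt
    | succ m ih =>
      push_cast
      rw [contDiffOn_succ_iff_fderiv_of_isOpen hB]
      refine ⟨fun x hx => (hu x hx).differentiableAt.differentiableWithinAt, by simp, ?_⟩
      have hle : ((m : ℕ∞) : WithTop ℕ∞) ≤ ∞ := by exact_mod_cast le_top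
      have h1 : ContDiffOn ℝ m (fun x => (θ x).flip (u x) + b x) B := by
        refine ContDiffOn.add ?_ (hb.of_le hle)
        exact ((ContinuousLinearMap.apply ℝ F).contDiff.comp_contDiffOn ih).clm_comp (hθ.of_le hle)
      exact h1.congr fun x hx => (hu x hx).fderiv
  exact contDiffOn_infty.2 key

/-- **Linear Frobenius theorem.** The system `du = θ u + b` has local solutions with arbitrary
initial values if the integrability condition holds. -/
theorem exists_local_solution [CompleteSpace F] {θ : E → E →L[ℝ] F →L[ℝ] F} {b : E → E →L[ℝ] F}
    {D : Set E} (hD : IsOpen D) {x₀ : E} (hx₀ : x₀ ∈ D) (hθ : ContDiffOn ℝ ∞ θ D)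
    (hb : ContDiffOn ℝ ∞ b D)
    (hflat : ∀ x ∈ D, ∀ h k u,
      fderiv ℝ θ x k h u + fderiv ℝ b x k h + θ x h (θ x k u + b x k) =
        fderiv ℝ θ x h k u + fderiv ℝ b x h k + θ x k (θ x h u + b x h)) (u₀ : F) :
    ∃ B : Set E, IsOpen B ∧ x₀ ∈ B ∧ B ⊆ D ∧ ∃ u : E → F, u x₀ = u₀ ∧ ContDiffOn ℝ ∞ u B ∧
      ∀ x ∈ B, HasFDerivAt u ((θ x).flip (u x) + b x) x := by
  obtain ⟨r₁, hr₁, C₁, hC₁, H₁⟩ := exists_taylor_bounds (hθ.contDiffAt (hD.mem_nhds hx₀))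
  obtain ⟨r₂, hr₂, C₂, hC₂, H₂⟩ := exists_taylor_bounds (hb.contDiffAt (hD.mem_nhds hx₀))
  obtain ⟨r₃, hr₃, hr₃D⟩ := Metric.isOpen_iff.1 hD x₀ hx₀
  set r := min (min r₁ r₂) r₃ with hr
  have hr0 : 0 < r := lt_min (lt_min hr₁ hr₂) hr₃
  have hs₁ : ball x₀ r ⊆ ball x₀ r₁ := ball_subset_ball ((min_le_left _ _).trans (min_le_left _ _))
  have hs₂ : ball x₀ r ⊆ ball x₀ r₂ := ball_subset_ball ((min_le_left _ _).trans (min_le_right _ _))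
  have hs₃ : ball x₀ r ⊆ D := (ball_subset_ball (min_le_right _ _)).trans hr₃D
  set C := C₁ + C₂ with hCdef
  have hC : 0 ≤ C := by positivity
  have hC1 : C₁ ≤ C := by linarith
  have hC2 : C₂ ≤ C := by linarith
  -- This radius gives C‖x‖(‖u₀‖ + 2) ≤ 1: the ray solutions exist up to time 1, and every Grönwall
  -- constant below can be taken to be 1. The summand in C + 1 avoids division by zero.
  set δ := min (min r 1) (1 / ((C + 1) * (‖u₀‖ + 2))) with hδ
  have hδ0 : 0 < δ := by simp only [hδ, lt_min_iff]; exact ⟨⟨hr0, one_pos⟩, by positivity⟩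
  have hδr : δ ≤ r := (min_le_left _ _).trans (min_le_left _ _)
  have hδ1 : δ ≤ 1 := (min_le_left _ _).trans (min_le_right _ _)
  have hδC : ∀ x : E, ‖x‖ < δ → C * ‖x‖ * (‖u₀‖ + 2) ≤ 1 := by
    intro x hx
    have h1 : ‖x‖ ≤ 1 / ((C + 1) * (‖u₀‖ + 2)) := hx.le.trans (min_le_right _ _)
    rw [le_div_iff₀ (by positivity)] at h1
    have : 0 ≤ ‖x‖ * (‖u₀‖ + 2) := by positivity
    nlinarith
  have hδC' : ∀ x : E, ‖x‖ < δ → C * ‖x‖ ≤ 1 := by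
    intro x hx
    have h1 := hδC x hx
    have : 0 ≤ C * ‖x‖ := by positivity
    nlinarith [norm_nonneg u₀]
  -- The candidate solution at x₀ + x is the value at time 1 of the solution along the ray in
  -- direction x.
  have hex : ∀ x : E, ‖x‖ < δ → ∃ α : ℝ → F, α 0 = u₀ ∧ ∀ t ∈ Icc (0 : ℝ) 1,
      HasDerivWithinAt α (θ (x₀ + t • x) x (α t) + b (x₀ + t • x) x) (Icc 0 1) t := fun x hx =>
    exists_radial_solution hC (hθ.continuousOn.mono hs₃) (hb.continuousOn.mono hs₃)
      (fun p hp => (H₁ p (hs₁ hp)).2.1.trans hC1) (fun p hp => (H₂ p (hs₂ hp)).2.1.trans hC2)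
      u₀ (hx.trans_le hδr) (hδC x hx)
  choose! α hα0 hα using hex
  have hmem : ∀ x : E, ‖x‖ < δ → ∀ t ∈ Icc (0 : ℝ) 1, x₀ + t • x ∈ ball x₀ r := by
    intro x hx t ht
    rw [mem_ball_iff_norm, add_sub_cancel_left, norm_smul, Real.norm_eq_abs, abs_of_nonneg ht.1]
    exact ((mul_le_of_le_one_left (norm_nonneg _) ht.2).trans_lt hx).trans_le hδr
  set R := gronwallBound ‖u₀‖ 1 1 1 with hR
  have hαR : ∀ x : E, ‖x‖ < δ → ∀ t ∈ Icc (0 : ℝ) 1, ‖α x t‖ ≤ R := by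
    intro x hx t ht
    refine (norm_le_gronwallBound_unitInterval (hα x hx) (by rw [hα0 x hx]) (K := 1) (ε := 1)
      (fun t ht => ?_) t ht).trans
      (gronwallBound_mono (norm_nonneg _) zero_le_one zero_le_one ht.2)
    refine (norm_add_le _ _).trans (add_le_add ?_ ?_)
    · refine (ContinuousLinearMap.le_opNorm₂ _ _ _).trans ?_
      have := (H₁ _ (hs₁ (hmem x hx t ht))).2.1.trans hC1
      have h2 := hδC' x hx
      gcongr
      exact le_trans (by gcongr) h2
    · refine (ContinuousLinearMap.le_opNorm _ _).trans ?_
      have := (H₂ _ (hs₂ (hmem x hx t ht))).2.1.trans hC2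
      exact le_trans (by gcongr) (hδC' x hx)
  have hR0 : 0 ≤ R := (norm_nonneg _).trans (hαR 0 (by simpa using hδ0) 0 (by simp))
  set M := 2 * C * R + 2 * C + 2 * C * (C * R + C) with hM
  have hM0 : 0 ≤ M := by positivity
  have main : ∀ x k : E, ‖x‖ < δ → ‖x + k‖ < δ →
      ‖α (x + k) 1 - α x 1 - (θ (x₀ + x) k (α x 1) + b (x₀ + x) k)‖ ≤
        gronwallBound 0 1 M 1 * ‖k‖ ^ 2 := by
    intro x k hx hxk
    -- The error z compares the solution along the neighbouring ray with its expected first order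
    -- variation. It starts at 0 and will satisfy ‖z'‖ ≤ ‖z‖ + M‖k‖², so Grönwall makes it quadratic
    -- in k.
    set z : ℝ → F := fun t => α (x + k) t - α x t -
      t • (θ (x₀ + t • x) k (α x t) + b (x₀ + t • x) k) with hz
    have hzd : ∀ t ∈ Icc (0 : ℝ) 1, HasDerivWithinAt z
        ((θ (x₀ + t • (x + k)) (x + k) (α (x + k) t) + b (x₀ + t • (x + k)) (x + k)) -
          (θ (x₀ + t • x) x (α x t) + b (x₀ + t • x) x) -
          (t • ((fderiv ℝ θ (x₀ + t • x) x k (α x t) +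
            θ (x₀ + t • x) k (θ (x₀ + t • x) x (α x t) + b (x₀ + t • x) x)) +
            fderiv ℝ b (x₀ + t • x) x k) + (1 : ℝ) • (θ (x₀ + t • x) k (α x t) +
              b (x₀ + t • x) k))) (Icc 0 1) t := by
      intro t ht
      have hp := hmem x hx t ht
      have hline : HasDerivWithinAt (fun t : ℝ => x₀ + t • x) x (Icc 0 1) t := by
        simpa using ((hasDerivWithinAt_id t (Icc (0 : ℝ) 1)).smul_const x).const_add x₀
      have hθ' := (H₁ _ (hs₁ hp)).1.hasFDerivAt.comp_hasDerivWithinAt t hline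
      have hb' := (H₂ _ (hs₂ hp)).1.hasFDerivAt.comp_hasDerivWithinAt t hline
      have hθk := (hθ'.clm_apply (hasDerivWithinAt_const t (Icc (0 : ℝ) 1) k))
      have hbk := (hb'.clm_apply (hasDerivWithinAt_const t (Icc (0 : ℝ) 1) k))
      simp only [map_zero, add_zero] at hθk hbk
      exact ((hα _ hxk t ht).sub (hα _ hx t ht)).sub
        ((hasDerivWithinAt_id t (Icc (0 : ℝ) 1)).smul ((hθk.clm_apply (hα _ hx t ht)).add hbk))
    have hzb := norm_le_gronwallBound_unitInterval (δ := 0) (K := 1) (ε := M * ‖k‖ ^ 2) hzd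
      (by simp [hz, hα0 x hx, hα0 _ hxk]) (fun t ht => ?_) 1 (by simp)
    · have e : gronwallBound 0 1 (M * ‖k‖ ^ 2) 1 = gronwallBound 0 1 M 1 * ‖k‖ ^ 2 := by
        simp [gronwallBound_of_K_ne_0 one_ne_zero]; ring
      rw [e] at hzb
      simpa [hz] using hzb
    · have hp := hmem x hx t ht
      have hq := hmem _ hxk t ht
      have hpD := hs₃ hp
      set p := x₀ + t • x with hpdef
      have hqp : x₀ + t • (x + k) = p + t • k := by rw [hpdef, smul_add]; abel
      rw [hqp] at hq ⊢
      have hpq : p + t • k - p = t • k := by abel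
      set a := α x t with ha
      set a' := α (x + k) t with ha'
      have hz' : a' = z t + a + t • (θ p k a + b p k) := by simp only [hz]; abel
      have hfl := hflat p hpD k x a
      have T1 := (H₁ p (hs₁ hp)).2.2.2 _ (hs₁ hq)
      have T2 := (H₂ p (hs₂ hp)).2.2.2 _ (hs₂ hq)
      rw [hpq] at T1 T2
      have hxk1 : ‖x + k‖ ≤ 1 := hxk.le.trans hδ1
      have ht' : ‖t‖ ≤ 1 := by rw [Real.norm_eq_abs, abs_of_nonneg ht.1]; exact ht.2
      have r1 := norm_remainder_le (f := θ) hC₁ ht hxk1 (H₁ p (hs₁ hp)).2.2.1 T1.2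
      have r2 := norm_remainder_le (f := b) hC₂ ht hxk1 (H₂ p (hs₂ hp)).2.2.1 T2.2
      have r3 : ‖θ (p + t • k) (x + k) - θ p x‖ ≤ 2 * C * ‖k‖ := by
        have e : θ (p + t • k) (x + k) - θ p x = (θ (p + t • k) - θ p) (x + k) + θ p k := by
          simp only [sub_apply, map_add]; abel
        rw [e]
        have htk : ‖t • k‖ ≤ ‖k‖ := by
          rw [norm_smul]; exact mul_le_of_le_one_left (norm_nonneg _) ht'
        have a1 : ‖(θ (p + t • k) - θ p) (x + k)‖ ≤ C * ‖k‖ := by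
          refine (ContinuousLinearMap.le_opNorm _ _).trans ?_
          calc _ ≤ (C₁ * ‖t • k‖) * 1 := by gcongr; exact T1.1
            _ ≤ C * ‖k‖ := by rw [mul_one]; gcongr
        have a2 : ‖θ p k‖ ≤ C * ‖k‖ := by
          refine (ContinuousLinearMap.le_opNorm _ _).trans ?_
          have := (H₁ _ (hs₁ hp)).2.1.trans hC1
          gcongr
        exact (norm_add_le _ _).trans (by linarith)
      have r4 : ‖θ p k a + b p k‖ ≤ (C * R + C) * ‖k‖ := by
        have b1 := (H₁ _ (hs₁ hp)).2.1.trans hC1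
        have b2 := (H₂ _ (hs₂ hp)).2.1.trans hC2
        have b3 := hαR x hx t ht
        calc _ ≤ C * ‖k‖ * R + C * ‖k‖ := by
              refine (norm_add_le _ _).trans (add_le_add ?_ ?_)
              · refine (ContinuousLinearMap.le_opNorm₂ _ _ _).trans ?_
                gcongr
              · refine (ContinuousLinearMap.le_opNorm _ _).trans ?_
                gcongr
          _ = _ := by ring
      have hid : ((θ (p + t • k)) (x + k) a' + (b (p + t • k)) (x + k)) - (θ p x a + b p x) -
          (t • ((fderiv ℝ θ p x k a + θ p k (θ p x a + b p x)) + fderiv ℝ b p x k) +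
            (1 : ℝ) • (θ p k a + b p k)) =
          θ (p + t • k) (x + k) (z t) +
            (θ (p + t • k) (x + k) - θ p (x + k) - t • fderiv ℝ θ p k x) a +
            (b (p + t • k) (x + k) - b p (x + k) - t • fderiv ℝ b p k x) +
            t • (θ (p + t • k) (x + k) - θ p x) (θ p k a + b p k) := by
        -- The integrability condition enters here: it exchanges the roles of the directions x and
        -- k, after which all terms linear in k cancel.
        have hfl' : (fderiv ℝ θ p x k a + θ p k (θ p x a + b p x)) + fderiv ℝ b p x k =
            fderiv ℝ θ p k x a + fderiv ℝ b p k x + θ p x (θ p k a + b p k) := by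
          rw [add_right_comm, hfl]
        rw [hfl', hz']
        simp only [sub_apply, smul_apply, map_add, map_smul, add_apply]
        module
      rw [hid]
      have c1 : ‖θ (p + t • k) (x + k) (z t)‖ ≤ 1 * ‖z t‖ := by
        refine (ContinuousLinearMap.le_opNorm₂ _ _ _).trans ?_
        have := (H₁ _ (hs₁ hq)).2.1.trans hC1
        gcongr
        exact le_trans (by gcongr) (hδC' _ hxk)
      have c2 : ‖(θ (p + t • k) (x + k) - θ p (x + k) - t • fderiv ℝ θ p k x) a‖ ≤
          2 * C * ‖k‖ ^ 2 * R := by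
        refine (ContinuousLinearMap.le_opNorm _ _).trans ?_
        have := hαR x hx t ht
        gcongr
        exact r1.trans (by gcongr)
      have c3 : ‖b (p + t • k) (x + k) - b p (x + k) - t • fderiv ℝ b p k x‖ ≤
          2 * C * ‖k‖ ^ 2 := r2.trans (by gcongr)
      have c4 : ‖t • (θ (p + t • k) (x + k) - θ p x) (θ p k a + b p k)‖ ≤
          2 * C * ‖k‖ * ((C * R + C) * ‖k‖) := by
        rw [norm_smul]
        calc _ ≤ 1 * (2 * C * ‖k‖ * ((C * R + C) * ‖k‖)) := by
              gcongr
              refine (ContinuousLinearMap.le_opNorm _ _).trans ?_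
              gcongr
          _ = _ := one_mul _
      refine (norm_add_le_of_le (norm_add_le_of_le (norm_add_le_of_le c1 c2) c3) c4).trans ?_
      rw [hM]
      exact le_of_eq (by ring)
  refine ⟨ball x₀ δ, isOpen_ball, mem_ball_self hδ0, (ball_subset_ball hδr).trans hs₃,
    fun y => α (y - x₀) 1, ?_⟩
  have hder : ∀ y ∈ ball x₀ δ, HasFDerivAt (fun y => α (y - x₀) 1)
      ((θ y).flip (α (y - x₀) 1) + b y) y := by
    intro y hy
    rw [hasFDerivAt_iff_isLittleO_nhds_zero]
    have hO : (fun k => α (y + k - x₀) 1 - α (y - x₀) 1 -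
        ((θ y).flip (α (y - x₀) 1) + b y) k) =O[nhds 0] fun k => ‖k‖ ^ 2 := by
      refine Asymptotics.IsBigO.of_bound (gronwallBound 0 1 M 1) ?_
      have hev : ∀ᶠ k in nhds (0 : E), y + k ∈ ball x₀ δ :=
        (continuousAt_const.add continuousAt_id).eventually_mem
          (isOpen_ball.mem_nhds (by simpa using hy))
      filter_upwards [hev] with k hk
      have e1 : y + k - x₀ = y - x₀ + k := by abel
      have := main (y - x₀) k (mem_ball_iff_norm.1 hy) (by rw [← e1]; exact mem_ball_iff_norm.1 hk)
      simpa [e1] using this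
    refine hO.trans_isLittleO ?_
    simpa using (Asymptotics.isLittleO_norm_pow_id (E' := E) one_lt_two)
  -- The ray in direction 0 is constant, so the solution along it stays at u₀.
  have hα01 : α 0 1 = u₀ := by
    have h0 : ‖(0 : E)‖ < δ := by simpa using hδ0
    have := norm_le_gronwallBound_unitInterval (δ := 0) (K := 0) (ε := 0)
      (fun t ht => (hα 0 h0 t ht).sub_const u₀) (by simp [hα0 0 h0]) (fun t _ => by simp) 1
      (by simp)
    simpa [gronwallBound_ε0_δ0, sub_eq_zero] using this
  exact ⟨by simpa using hα01, contDiffOn_of_hasFDerivAt isOpen_ball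
    (hθ.mono ((ball_subset_ball hδr).trans hs₃)) (hb.mono ((ball_subset_ball hδr).trans hs₃)) hder,
    hder⟩

/-- Uniqueness of solutions of `du = θ u` on balls. -/
theorem eq_zero_of_hasFDerivAt {θ : E → E →L[ℝ] F →L[ℝ] F} {u : E → F} {x₀ : E} {r : ℝ}
    (hθ : ContinuousOn θ (ball x₀ r))
    (hu : ∀ x ∈ ball x₀ r, HasFDerivAt u ((θ x).flip (u x)) x) {p : E} (hp : p ∈ ball x₀ r)
    (h0 : u p = 0) : ∀ x ∈ ball x₀ r, u x = 0 := by
  intro x hx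
  have hmem : ∀ t ∈ Icc (0 : ℝ) 1, p + t • (x - p) ∈ ball x₀ r := fun t ht =>
    (convex_ball x₀ r).add_smul_sub_mem hp hx ht
  have hc : ContinuousOn (fun t : ℝ => p + t • (x - p)) (Icc 0 1) := by fun_prop
  -- On the segment from p to x the equation is a linear ODE with bounded coefficients, so Grönwall
  -- propagates the value 0.
  obtain ⟨K, hK⟩ := isCompact_Icc.exists_bound_of_continuousOn
    ((hθ.comp hc hmem).clm_apply (continuousOn_const (c := x - p)))
  have hd : ∀ t ∈ Icc (0 : ℝ) 1, HasDerivWithinAt (fun t : ℝ => u (p + t • (x - p)))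
      (θ (p + t • (x - p)) (x - p) (u (p + t • (x - p)))) (Icc 0 1) t := by
    intro t ht
    have hline : HasDerivWithinAt (fun t : ℝ => p + t • (x - p)) (x - p) (Icc 0 1) t := by
      simpa using ((hasDerivWithinAt_id t (Icc (0 : ℝ) 1)).smul_const (x - p)).const_add p
    exact (hu _ (hmem t ht)).comp_hasDerivWithinAt t hline
  have := norm_le_gronwallBound_unitInterval (δ := 0) (K := K) (ε := 0) hd (by simp [h0])
    (fun t ht => by
      rw [add_zero]
      exact (ContinuousLinearMap.le_opNorm _ _).trans
        (mul_le_mul_of_nonneg_right (hK t ht) (norm_nonneg _))) 1 (by simp)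
  simpa [gronwallBound_ε0_δ0] using this

end Frobenius

end SuperInt
end

noncomputable section

namespace SuperInt

/-! ### Gluing functions given locally up to constants -/

section Gluing

open Set Topology

/-- The real numbers with the discrete topology. -/
structure DiscreteReal where
  val : ℝ

instance : TopologicalSpace DiscreteReal := ⊥

instance : DiscreteTopology DiscreteReal := ⟨rfl⟩

variable {X ι : Type*} [TopologicalSpace X]

/-- The bundle over `X` whose sections are the functions that differ locally from the functions
`f i` by constants. -/
def primitiveBundle (V : ι → Set X) (hV : ∀ i, IsOpen (V i)) (idx : X → ι)
    (hidx : ∀ x, x ∈ V (idx x)) (f : ι → X → ℝ)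
    (hf : ∀ i j, ∀ x ∈ V i ∩ V j, ∀ᶠ y in 𝓝 x, f i y - f j y = f i x - f j x) :
    FiberBundleCore ι X DiscreteReal where
  baseSet := V
  isOpen_baseSet := hV
  indexAt := idx
  mem_baseSet_at := hidx
  coordChange i j x v := ⟨v.val + (f i x - f j x)⟩
  coordChange_self i x _ v := by simp
  continuousOn_coordChange i j := by
    rintro ⟨x, v⟩ ⟨hx, -⟩
    refine ContinuousAt.continuousWithinAt (tendsto_nhds_of_eventually_eq ?_)
    rw [nhds_prod_eq, nhds_discrete DiscreteReal, Filter.eventually_prod_iff]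
    refine ⟨_, hf i j x hx, (· = v), by simp, ?_⟩
    rintro y hy w rfl
    simp only [hy]
  coordChange_comp i j k x _ v := by
    simp only [DiscreteReal.mk.injEq]
    ring

/-- The locally constant differences f i - f j are the transition functions of a bundle with
discrete fibre ℝ, which is a covering. Over a simply connected base the identity lifts to a section,
and adding that section to the f i removes the constants of ambiguity. -/
theorem exists_global_of_local [SimplyConnectedSpace X] [LocallyPathConnectedSpace X]
    (V : ι → Set X) (hV : ∀ i, IsOpen (V i)) (hcov : ∀ x, ∃ i, x ∈ V i) (f : ι → X → ℝ)
    (hf : ∀ i j, ∀ x ∈ V i ∩ V j, ∀ᶠ y in 𝓝 x, f i y - f j y = f i x - f j x) :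
    ∃ F : X → ℝ, ∀ i, ∀ x ∈ V i, ∀ᶠ y in 𝓝 x, F y - f i y = F x - f i x := by
  choose idx hidx using hcov
  set Z := primitiveBundle V hV idx hidx f hf with hZ
  have hcovering : IsCoveringMap (Bundle.TotalSpace.proj : Z.TotalSpace → X) :=
    FiberBundle.isCoveringMap (F := DiscreteReal) (E := Z.Fiber)
  obtain ⟨x₀⟩ : Nonempty X := inferInstance
  obtain ⟨s, ⟨-, hs⟩, -⟩ := hcovering.existsUnique_continuousMap_lifts (ContinuousMap.id X) x₀
    (⟨x₀, (⟨0⟩ : DiscreteReal)⟩ : Z.TotalSpace) rfl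
  have hs' : ∀ x, (s x).1 = x := fun x => congrFun hs x
  have hval : ∀ i x, (Z.localTriv i (s x)).2 =
      ⟨DiscreteReal.val (s x).2 + (f (idx (s x).1) x - f i x)⟩ := by
    intro i x
    rw [Z.localTriv_apply]
    change (⟨DiscreteReal.val (s x).2 + (f (idx (s x).1) (s x).1 - f i (s x).1)⟩ : DiscreteReal) = _
    have h2 : f (idx (s x).1) (s x).1 = f (idx (s x).1) x := congrArg _ (hs' x)
    rw [h2, hs' x]
  refine ⟨fun x => DiscreteReal.val (s x).2 + f (idx (s x).1) x, fun i x hx => ?_⟩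
  -- In a local trivialisation the section is a continuous map to a discrete space, hence locally
  -- constant; this says that F and f i differ locally by a constant.
  have hcont : ContinuousAt (fun y => (Z.localTriv i (s y)).2) x := by
    have h1 : ContinuousAt (Z.localTriv i) (s x) :=
      (Z.localTriv i).toOpenPartialHomeomorph.continuousAt (by
        change s x ∈ (Z.localTriv i).source
        rw [Z.mem_localTriv_source]
        change (s x).1 ∈ V i
        rwa [hs' x])
    exact (ContinuousAt.comp (f := s) h1 s.continuous.continuousAt).snd
  unfold ContinuousAt at hcont
  rw [nhds_discrete DiscreteReal, Filter.tendsto_pure] at hcont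
  filter_upwards [hcont] with y hy
  rw [hval, hval, DiscreteReal.mk.injEq] at hy
  linarith

end Gluing

end SuperInt
end

noncomputable section

namespace SuperInt

/-! ### Pointwise tensor algebra -/

section Algebra

variable {E ι : Type*} [NormedAddCommGroup E] [NormedSpace ℝ E] [Fintype ι]

/-- The family `e` is a (Parseval) frame for the scalar product `g`. -/
structure IsFrame (g : E →L[ℝ] E →L[ℝ] ℝ) (e : ι → E) : Prop where
  symm : ∀ u v, g u v = g v u
  sum_smul : ∀ u, ∑ i, g u (e i) • e i = u
  sum_diag : ∑ i, g (e i) (e i) = Fintype.card ι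

variable {g : E →L[ℝ] E →L[ℝ] ℝ} {e : ι → E}

theorem IsFrame.sum_mul (he : IsFrame g e) (a : E) (β : E →L[ℝ] ℝ) :
    ∑ i, g a (e i) * β (e i) = β a := by
  conv_rhs => rw [← he.sum_smul a]
  simp

theorem IsFrame.sum_mul_mul (he : IsFrame g e) (a b : E) :
    ∑ i, g a (e i) * g b (e i) = g a b := by
  rw [he.sum_mul a (g b), he.symm]

theorem IsFrame.ext (he : IsFrame g e) {u v : E} (h : ∀ w, g u w = g v w) : u = v := by
  rw [← he.sum_smul u, ← he.sum_smul v]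
  simp [h]

/-- The curvature equation for the tensor `s` (with covariant derivative `N w u v = (∇_w s)(u,v)`),
at a point. -/
structure CurvatureEq (g : E →L[ℝ] E →L[ℝ] ℝ) (s : E →L[ℝ] E →L[ℝ] E)
    (N : E → E → E → E) (X : E →L[ℝ] E) : Prop where
  symm : ∀ u v, g u v = g v u
  s_comm : ∀ u v, s u v = s v u
  s_symm : ∀ u v w, g (s u v) w = g (s u w) v
  N_symm : ∀ z u v w, g (N z u v) w = g (N z w v) u
  X_symm : ∀ u v, g (X u) v = g (X v) u
  eq : ∀ u v w, N w u v - N v u w + s (s u v) w - s (s u w) v + g u v • X w - g u w • X v = 0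

namespace CurvatureEq

variable {s : E →L[ℝ] E →L[ℝ] E} {N : E → E → E → E} {X : E →L[ℝ] E}

theorem s_pair (H : CurvatureEq g s N X) (x w a : E) : g (s x w) a = g x (s w a) := by
  rw [H.s_comm x w, H.s_symm, H.symm]

theorem s_rot (H : CurvatureEq g s N X) (x y z : E) : g (s x y) z = g (s z y) x := by
  rw [H.s_pair, H.symm, H.s_comm]

theorem pair (H : CurvatureEq g s N X) (u v w a : E) :
    g (N w u v) a - g (N v u w) a + g (s u v) (s w a) - g (s u w) (s v a)
      + g u v * g (X w) a - g u w * g (X v) a = 0 := by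
  have := congrArg (fun z => g z a) (H.eq u v w)
  simp only [map_add, map_sub, map_smul, add_apply, sub_apply, smul_apply, map_zero, zero_apply,
    smul_eq_mul] at this
  rwa [H.s_pair (s u v) w a, H.s_pair (s u w) v a] at this

/-- The part of `pair` that is skew in u and a. The terms with N are symmetric in these arguments
and drop out, so the commutators of the endomorphisms s u are expressed by g and X alone. -/
theorem anti (H : CurvatureEq g s N X) (u v w a : E) :
    2 * (g (s u v) (s w a) - g (s u w) (s v a)) =
      -(g u v * g (X w) a - g u w * g (X v) a - g a v * g (X w) u + g a w * g (X v) u) := by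
  have h1 := H.pair u v w a
  have h2 := H.pair a v w u
  rw [H.N_symm w u v a, H.N_symm v u w a] at h1
  rw [H.symm (s a v), H.symm (s a w), H.s_comm w u, H.s_comm v u, H.s_comm a v, H.s_comm a w] at h2
  linarith

/-- The complementary part of `pair`, symmetric in u and a: here the commutators drop out and the
alternated derivative of s is expressed by g and X. -/
theorem sym (H : CurvatureEq g s N X) (u v w a : E) :
    2 * (g (N w u v) a - g (N v u w) a) =
      -(g u v * g (X w) a - g u w * g (X v) a + g a v * g (X w) u - g a w * g (X v) u) := by
  have h1 := H.pair u v w a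
  have h2 := H.anti u v w a
  linarith

/-- The Jacobi identity for the symmetric endomorphisms `s u`. -/
theorem jacobi (H : CurvatureEq g s N X) (l v w u a : E) :
    (-g a v * g (s (X w) l) u + g a w * g (s (X v) l) u - g u v * g (s (X w) l) a
      + g u w * g (s (X v) l) a) +
    (-g a w * g (s (X l) v) u + g a l * g (s (X w) v) u - g u w * g (s (X l) v) a
      + g u l * g (s (X w) v) a) +
    (-g a l * g (s (X v) w) u + g a v * g (s (X l) w) u - g u l * g (s (X v) w) a
      + g u v * g (s (X l) w) a) = 0 := by
  -- By self-adjointness of the s u, both sides are the double commutator [[s w, s v], s l], written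
  -- with triple products on the right; their cyclic sum cancels. `anti` evaluates the inner
  -- commutators.
  have key : ∀ l v w, g (s (s l u) v) (s w a) - g (s (s l u) w) (s v a)
      - (g (s u v) (s w (s l a)) - g (s u w) (s v (s l a))) =
      (g (s w (s v (s l u))) a - g (s v (s w (s l u))) a)
        - (g (s l (s w (s v u))) a - g (s l (s v (s w u))) a) := by
    intro l v w
    have p : ∀ x y z : E, g x (s y z) = g (s y x) z := fun x y z => by
      rw [H.s_comm y x, H.s_pair]
    simp only [p]
    rw [H.s_comm (s l u) v, H.s_comm (s l u) w, H.s_comm u v, H.s_comm u w]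
  have a1 := H.anti (s l u) v w a
  have a2 := H.anti u v w (s l a)
  have a3 := H.anti (s v u) w l a
  have a4 := H.anti u w l (s v a)
  have a5 := H.anti (s w u) l v a
  have a6 := H.anti u l v (s w a)
  have k1 := key l v w
  have k2 := key v w l
  have k3 := key w l v
  rw [H.s_pair (X w) l u, H.s_pair (X w) l a, H.s_pair (X w) v u, H.s_pair (X w) v a,
    H.s_pair (X v) l u, H.s_pair (X v) l a, H.s_pair (X v) w u, H.s_pair (X v) w a,
    H.s_pair (X l) v u, H.s_pair (X l) v a, H.s_pair (X l) w u, H.s_pair (X l) w a]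
  rw [H.s_rot w u l] at a5
  rw [H.s_rot v u l] at a3
  rw [H.s_rot w u v] at a5
  rw [H.s_rot w a l] at a6
  rw [H.s_rot v a l] at a4
  rw [H.s_rot w a v] at a6
  linear_combination -2 * k1 - 2 * k2 - 2 * k3 + a1 - a2 + a3 - a4 + a5 - a6

/-- The trace of the quadratic part of the deviation of `X` from a Codazzi tensor. -/
def devForm (s : E →L[ℝ] E →L[ℝ] E) (g : E →L[ℝ] E →L[ℝ] ℝ) (X : E →L[ℝ] E) (e : ι → E)
    (v : E) : ℝ :=
  ∑ i, (g (s (X v) (e i)) (e i) - g (s (X (e i)) v) (e i))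

/-- Contracting the Jacobi identity in one pair of arguments isolates s(X w) v - s(X v) w and shows
that it is pure trace, governed by a single linear form. -/
theorem deviation (H : CurvatureEq g s N X) (he : IsFrame g e) (v w a : E) :
    ((Fintype.card ι : ℝ) - 1) * (g (s (X w) v) a - g (s (X v) w) a) =
      -(g a w * devForm s g X e v - g a v * devForm s g X e w) := by
  have h := Finset.sum_eq_zero fun i (_ : i ∈ Finset.univ) => H.jacobi (e i) v w (e i) a
  simp only [Finset.sum_add_distrib, neg_mul, Finset.sum_neg_distrib, Finset.sum_sub_distrib,
    ← Finset.mul_sum, ← Finset.sum_mul, he.sum_diag] at h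
  have p1 : ∀ x y, ∑ i, g (e i) x * g (s (X y) (e i)) a = g (s (X y) x) a := fun x y => by
    have := he.sum_mul x ((g.flip a).comp (s (X y)))
    simpa [H.symm x] using this
  have p2 : ∀ x y, ∑ i, g (e i) x * g (s (X (e i)) y) a = g (s (X x) y) a := fun x y => by
    have := he.sum_mul x ((g.flip a).comp ((s.flip y).comp X))
    simpa [H.symm x] using this
  have p3 : ∀ x y, ∑ i, g a (e i) * g (s (X x) y) (e i) = g (s (X x) y) a := fun x y => by
    simpa using he.sum_mul a (g (s (X x) y))
  simp only [p1, p2, p3] at h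
  simp only [devForm, Finset.sum_sub_distrib]
  linear_combination h

/-- The contracted commutator relation. It turns the quadratic expression in s that occurs in Z into
X and its trace. -/
theorem trace_anti (H : CurvatureEq g s N X) (he : IsFrame g e) (w a : E) :
    2 * (∑ i, g (s (e i) w) (s (e i) a) - ∑ i, g (s (e i) (e i)) (s w a)) =
      ((Fintype.card ι : ℝ) - 2) * g (X w) a + g a w * ∑ i, g (X (e i)) (e i) := by
  have h := Finset.sum_congr rfl fun i (_ : i ∈ Finset.univ) => H.anti (e i) (e i) w a
  simp only [Finset.sum_add_distrib, Finset.sum_neg_distrib, Finset.sum_sub_distrib,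
    ← Finset.mul_sum, ← Finset.sum_mul, he.sum_diag] at h
  have p1 : ∑ i, g (e i) w * g (X (e i)) a = g (X w) a := by
    have := he.sum_mul w ((g.flip a).comp X)
    simpa [H.symm w] using this
  have p2 : ∑ i, g a (e i) * g (X w) (e i) = g (X w) a := by
    simpa using he.sum_mul a (g (X w))
  rw [p1, p2] at h
  linear_combination -h

end CurvatureEq

end Algebra

end SuperInt
end

noncomputable section

namespace SuperInt

/-! ### The tensor Z expressed through the totally symmetric tensor S and the endomorphism X -/

section ZForm

variable {E : Type*} [NormedAddCommGroup E] [NormedSpace ℝ E] {n : ℕ}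

/-- The symmetrisation of a trilinear form. -/
def symForm (T : E →L[ℝ] E →L[ℝ] E →L[ℝ] ℝ) (u v w : E) : ℝ :=
  1 / 6 * (T u v w + T u w v + T v u w + T v w u + T w u v + T w v u)

/-- The trace-free part of the symmetrisation of a trilinear form. -/
def ringForm (g : E →L[ℝ] E →L[ℝ] ℝ) (T : E →L[ℝ] E →L[ℝ] E →L[ℝ] ℝ) (e : Fin n → E)
    (u v w : E) : ℝ :=
  symForm T u v w - 1 / ((n : ℝ) + 2) * (g u v * ∑ i, symForm T (e i) (e i) w +
    g v w * ∑ i, symForm T (e i) (e i) u + g w u * ∑ i, symForm T (e i) (e i) v)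

/-- The contraction of the first and the last argument. -/
def tauForm (T : E →L[ℝ] E →L[ℝ] E →L[ℝ] ℝ) (e : Fin n → E) (w : E) : ℝ :=
  ∑ i, T (e i) w (e i)

/-- The normalised contraction of the last two arguments. -/
def barForm (T : E →L[ℝ] E →L[ℝ] E →L[ℝ] ℝ) (e : Fin n → E) (u : E) : ℝ :=
  (n : ℝ) / (((n : ℝ) + 2) * ((n : ℝ) - 1)) * ∑ i, T u (e i) (e i)

/-- The tensor `Z` in terms of a frame. -/
def zForm (κ : ℝ) (g : E →L[ℝ] E →L[ℝ] ℝ) (T : E →L[ℝ] E →L[ℝ] E →L[ℝ] ℝ) (e : Fin n → E)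
    (u v : E) : ℝ :=
  (∑ i, ∑ j, ringForm g T e u (e i) (e j) * ringForm g T e v (e i) (e j)) -
    ((n : ℝ) - 2) * ((∑ i, ringForm g T e u v (e i) * barForm T e (e i)) +
      barForm T e u * barForm T e v) - ((n : ℝ) - 1) * κ * g u v

variable {g : E →L[ℝ] E →L[ℝ] ℝ} {T : E →L[ℝ] E →L[ℝ] E →L[ℝ] ℝ} {e : Fin n → E}
  {s : E →L[ℝ] E →L[ℝ] E} {N : E → E → E → E} {X : E →L[ℝ] E}

/-- The vector that represents `barForm`. -/
def barVec (T : E →L[ℝ] E →L[ℝ] E →L[ℝ] ℝ) (e : Fin n → E) : E := ∑ i, barForm T e (e i) • e i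

theorem barForm_eq (he : IsFrame g e) (u : E) : barForm T e u = g (barVec T e) u := by
  set β : E →L[ℝ] ℝ := ((n : ℝ) / (((n : ℝ) + 2) * ((n : ℝ) - 1))) •
    ∑ i, ((T.flip (e i)).flip (e i)) with hβ
  have h : ∀ w, barForm T e w = β w := fun w => by
    simp [barForm, hβ, Finset.mul_sum]
  rw [h, ← he.sum_mul u β]
  simp only [barVec, map_sum, map_smul, sum_apply, smul_apply, smul_eq_mul, h]
  exact Finset.sum_congr rfl fun i _ => by rw [he.symm u, mul_comm]

/-- `T` and the totally symmetric tensor `s` agree up to a trace. -/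
structure TraceRelation (g : E →L[ℝ] E →L[ℝ] ℝ) (T : E →L[ℝ] E →L[ℝ] E →L[ℝ] ℝ)
    (s : E →L[ℝ] E →L[ℝ] E) (e : Fin n → E) : Prop where
  symm : ∀ u v w, T u v w = T v u w
  traceFree : ∀ w, ∑ i, T (e i) (e i) w = 0
  eq : ∀ u v w, g (s u v) w = T u v w + 1 / ((n : ℝ) - 1) * (g u v * tauForm T e w)

/-- By total symmetry the contraction may be moved to the first two arguments, where T is trace-free
and only the metric term survives. -/
theorem TraceRelation.trace_s (hR : TraceRelation g T s e) (he : IsFrame g e)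
    (hs : ∀ u v w, g (s u v) w = g (s u w) v) (hc : ∀ u v, s u v = s v u) (w : E) :
    ∑ i, g (s w (e i)) (e i) = (n : ℝ) / ((n : ℝ) - 1) * tauForm T e w := by
  have h1 : ∀ i, g (s w (e i)) (e i) = T (e i) (e i) w +
      1 / ((n : ℝ) - 1) * (g (e i) (e i) * tauForm T e w) := fun i => by
    rw [hc, hs, hR.eq]
  simp only [h1, Finset.sum_add_distrib, hR.traceFree, ← Finset.mul_sum, ← Finset.sum_mul,
    he.sum_diag, Fintype.card_fin]
  ring

/-- With this normalisation of t̄ the trace of s is (n + 2) t̄, which is what a trace-free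
projection of a symmetric cubic form divides by. -/
theorem TraceRelation.tauForm_eq (hR : TraceRelation g T s e) (hn : 2 ≤ n) (u : E) :
    tauForm T e u = ((n : ℝ) + 2) * ((n : ℝ) - 1) / n * barForm T e u := by
  have : (2 : ℝ) ≤ n := by exact_mod_cast hn
  have h1 : (n : ℝ) - 1 ≠ 0 := by linarith
  have h : tauForm T e u = ∑ i, T u (e i) (e i) := Finset.sum_congr rfl fun i _ => hR.symm _ _ _
  rw [barForm, ← h]
  field_simp

/-- T and s differ by a trace term, so their symmetrisations have the same trace-free part; for s,
whose trace is (n + 2) t̄, this part is found by subtracting three products of g and t̄. -/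
theorem TraceRelation.ringForm_eq (hR : TraceRelation g T s e) (he : IsFrame g e) (hn : 2 ≤ n)
    (hs : ∀ u v w, g (s u v) w = g (s u w) v) (hc : ∀ u v, s u v = s v u) (u v w : E) :
    ringForm g T e u v w = g (s u v) w - g u v * barForm T e w - g v w * barForm T e u
      - g w u * barForm T e v := by
  have hn' : (2 : ℝ) ≤ n := by exact_mod_cast hn
  have h1 : (n : ℝ) - 1 ≠ 0 := by linarith
  have h2 : (n : ℝ) + 2 ≠ 0 := by linarith
  have h0 : (n : ℝ) ≠ 0 := by linarith
  have hT : ∀ u v w, T u v w = g (s u v) w - 1 / ((n : ℝ) - 1) * (g u v * tauForm T e w) :=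
    fun u v w => by rw [hR.eq]; ring
  have hsym : ∀ u v w, symForm T u v w = g (s u v) w - 1 / (3 * ((n : ℝ) - 1)) *
      (g u v * tauForm T e w + g v w * tauForm T e u + g w u * tauForm T e v) := by
    intro u v w
    simp only [symForm, hT]
    rw [hs u w v, hc v u, hs v w u, hc v u, hs w u v, hc w v, hs v w u, hc v u, he.symm v u,
      he.symm w v, he.symm w u]
    field_simp
    ring
  have htr : ∀ w, ∑ i, symForm T (e i) (e i) w = ((n : ℝ) / ((n : ℝ) - 1) -
      1 / (3 * ((n : ℝ) - 1)) * ((n : ℝ) + 2)) * tauForm T e w := by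
    intro w
    set τ : E →L[ℝ] ℝ := ∑ i, (T (e i)).flip (e i) with hτ
    have hτ' : ∀ w, tauForm T e w = τ w := fun w => by
      simp [tauForm, hτ]
    have p1 : ∑ i, g (e i) w * tauForm T e (e i) = tauForm T e w := by
      simp only [hτ', ← he.sum_mul w τ, he.symm w]
    have p2 : ∑ i, g w (e i) * tauForm T e (e i) = tauForm T e w := by
      simp only [hτ', he.sum_mul w τ]
    have p3 : ∑ i, g (s (e i) (e i)) w = (n : ℝ) / ((n : ℝ) - 1) * tauForm T e w := by
      rw [← hR.trace_s he hs hc w]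
      exact Finset.sum_congr rfl fun i _ => by rw [hs, hc]
    simp only [hsym, Finset.sum_sub_distrib, Finset.sum_add_distrib, ← Finset.mul_sum,
      ← Finset.sum_mul, he.sum_diag, Fintype.card_fin, p1, p2, p3]
    ring
  simp only [ringForm, htr]
  simp only [hsym, hR.tauForm_eq hn]
  field_simp
  ring

/-- After substituting the trace-free part of s, the terms t̄ ⊗ t̄ cancel and s(u, v, t̄) is left
with coefficient -(n + 2). As the trace of s is (n + 2) t̄, this is exactly half of the combination
in `trace_anti`; hence Z is a multiple of X modulo g. -/
theorem zForm_eq (H : CurvatureEq g s N X) (he : IsFrame g e) (hR : TraceRelation g T s e)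
    (hn : 2 ≤ n) (κ : ℝ) (u v : E) :
    zForm κ g T e u v = ((n : ℝ) - 2) / 2 * g (X u) v + (1 / 2 * ∑ i, g (X (e i)) (e i) +
      n * g (barVec T e) (barVec T e) - ((n : ℝ) - 1) * κ) * g u v := by
  set b := barVec T e with hb
  have hn' : (2 : ℝ) ≤ n := by exact_mod_cast hn
  have h1 : (n : ℝ) - 1 ≠ 0 := by linarith
  have h0 : (n : ℝ) ≠ 0 := by linarith
  have hbar : ∀ u, barForm T e u = g b u := barForm_eq he
  have hring : ∀ u v w, ringForm g T e u v w =
      g (s u v - g u v • b - g b u • v - g b v • u) w := by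
    intro u v w
    rw [hR.ringForm_eq he hn H.s_symm H.s_comm, hbar, hbar, hbar]
    simp only [map_sub, map_smul, sub_apply, smul_apply, smul_eq_mul, H.symm w u]
    ring
  have htr : ∀ w, ∑ i, g (s w (e i)) (e i) = ((n : ℝ) + 2) * g b w := by
    intro w
    rw [hR.trace_s he H.s_symm H.s_comm, hR.tauForm_eq hn, hbar]
    field_simp
  have htr' : ∀ w, ∑ i, g (s (e i) (e i)) w = ((n : ℝ) + 2) * g b w := by
    intro w
    rw [← htr]
    exact Finset.sum_congr rfl fun i _ => by rw [H.s_symm, H.s_comm]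
  have hq : ∀ u v, ∑ i, ∑ j, ringForm g T e u (e i) (e j) * ringForm g T e v (e i) (e j) =
      ∑ i, g (s (e i) u) (s (e i) v) - 4 * g (s u v) b - ((n : ℝ) - 2) * (g b u * g b v)
        + 2 * g b b * g u v := by
    intro u v
    simp only [hring, he.sum_mul_mul]
    have hterm : ∀ i, g (s u (e i) - g u (e i) • b - g b u • e i - g b (e i) • u)
        (s v (e i) - g v (e i) • b - g b v • e i - g b (e i) • v) =
        g (s (e i) u) (s (e i) v) - g v (e i) * g (s u b) (e i) - g b v * g (s u (e i)) (e i)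
          - g b (e i) * g (s u v) (e i) - g u (e i) * g (s v b) (e i)
          - g b u * g (s v (e i)) (e i) - g b (e i) * g (s v u) (e i)
          + g b b * (g u (e i) * g v (e i)) + g b v * (g u (e i) * g b (e i))
          + g b v * (g u (e i) * g b (e i)) + g b u * (g v (e i) * g b (e i))
          + g b u * g b v * g (e i) (e i) + g b u * (g v (e i) * g b (e i))
          + g b u * (g b (e i) * g v (e i)) + g b v * (g b (e i) * g u (e i))
          + g u v * (g b (e i) * g b (e i)) := by
      intro i
      simp only [map_sub, map_smul, sub_apply, smul_apply, smul_eq_mul]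
      rw [H.symm (e i) b, H.symm (e i) v, H.symm u b, H.symm b (s v (e i)),
        H.symm (e i) (s v (e i)), H.symm u (s v (e i)), H.s_symm u (e i) b, H.s_symm u (e i) v,
        H.s_symm v (e i) b, H.s_symm v (e i) u, H.s_comm (e i) u, H.s_comm (e i) v]
      ring
    simp only [hterm, Finset.sum_add_distrib, Finset.sum_sub_distrib, ← Finset.mul_sum,
      he.sum_mul_mul, htr, he.sum_diag, Fintype.card_fin]
    rw [H.symm v (s u b), H.s_symm u b v, H.symm u (s v b), H.s_symm v b u, H.s_comm v u, H.symm b (s u v), H.symm u b, H.symm v b]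
    ring
  have ht := H.trace_anti he u v
  rw [htr', Fintype.card_fin, H.symm v u] at ht
  have hl : ∑ i, ringForm g T e u v (e i) * barForm T e (e i) =
      g (s u v) b - 2 * (g b u * g b v) - g u v * g b b := by
    simp only [hring, hbar, he.sum_mul_mul]
    simp only [map_sub, map_smul, sub_apply, smul_apply, smul_eq_mul]
    rw [H.symm v b, H.symm u b]
    ring
  rw [zForm, hq, hl, hbar, hbar]
  rw [H.symm b (s u v)] at ht
  linear_combination 1 / 2 * ht

end ZForm

end SuperInt
end

noncomputable section
set_option maxSynthPendingDepth 3

namespace SuperInt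

/-! ### Calculus of smooth fields of multilinear maps -/

section Calculus

open Topology

variable {E F G : Type*} [NormedAddCommGroup E] [NormedSpace ℝ E]
  [NormedAddCommGroup F] [NormedSpace ℝ F] [NormedAddCommGroup G] [NormedSpace ℝ G]

theorem ContDiffOn.differentiableAt_of_mem {f : E → F} {D : Set E} (hf : ContDiffOn ℝ ∞ f D)
    (hD : IsOpen D) {y : E} (hy : y ∈ D) : DifferentiableAt ℝ f y :=
  (hf.contDiffAt (hD.mem_nhds hy)).differentiableAt (by simp)

theorem ContDiffOn.fderiv_infty {f : E → F} {D : Set E} (hf : ContDiffOn ℝ ∞ f D)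
    (hD : IsOpen D) : ContDiffOn ℝ ∞ (fderiv ℝ f) D :=
  hf.fderiv_of_isOpen hD (by simp)

theorem fderiv_clm_apply_const {A : E → F →L[ℝ] G} {y : E} (hA : DifferentiableAt ℝ A y) (u : F)
    (w : E) : fderiv ℝ (fun z => A z u) y w = fderiv ℝ A y w u := by
  rw [fderiv_clm_apply hA (differentiableAt_const u)]
  simp

theorem fderiv_clm_apply_const₂ {A : E → F →L[ℝ] F →L[ℝ] G} {y : E} (hA : DifferentiableAt ℝ A y)
    (u v : F) (w : E) : fderiv ℝ (fun z => A z u v) y w = fderiv ℝ A y w u v := by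
  rw [fderiv_clm_apply_const (hA.clm_apply (differentiableAt_const u)), fderiv_clm_apply_const hA]

theorem fderiv_symm_of_hasFDerivAt {f : E → F} {p : E → E →L[ℝ] F} {D : Set E} (hD : IsOpen D)
    (hf : ∀ y ∈ D, HasFDerivAt f (p y) y) {y : E} (hy : y ∈ D) (hp : DifferentiableAt ℝ p y)
    (v w : E) : fderiv ℝ p y v w = fderiv ℝ p y w v :=
  second_derivative_symmetric_of_eventually
    (by filter_upwards [hD.mem_nhds hy] with z hz using hf z hz) hp.hasFDerivAt v w

theorem fderiv_fderiv_symm {f : E → F} {D : Set E} (hD : IsOpen D) (hf : ContDiffOn ℝ ∞ f D)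
    {y : E} (hy : y ∈ D) (v w : E) :
    fderiv ℝ (fderiv ℝ f) y v w = fderiv ℝ (fderiv ℝ f) y w v :=
  fderiv_symm_of_hasFDerivAt hD
    (fun _ hz => (ContDiffOn.differentiableAt_of_mem hf hD hz).hasFDerivAt) hy
    (ContDiffOn.differentiableAt_of_mem (ContDiffOn.fderiv_infty hf hD) hD hy) v w

/-- The trace of a continuous endomorphism. -/
def traceCLM (E : Type*) [NormedAddCommGroup E] [NormedSpace ℝ E] [FiniteDimensional ℝ E] :
    (E →L[ℝ] E) →L[ℝ] ℝ :=
  ((LinearMap.trace ℝ E) ∘ₗ (ContinuousLinearMap.coeLM ℝ)).toContinuousLinearMap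

variable [FiniteDimensional ℝ E]

theorem traceCLM_apply (L : E →L[ℝ] E) :
    traceCLM E L = LinearMap.trace ℝ E (L : E →ₗ[ℝ] E) := rfl

theorem traceCLM_comp_comm (A B : E →L[ℝ] E) : traceCLM E (A.comp B) = traceCLM E (B.comp A) := by
  rw [traceCLM_apply, traceCLM_apply]
  exact LinearMap.trace_mul_comm ℝ (A : E →ₗ[ℝ] E) (B : E →ₗ[ℝ] E)

theorem traceCLM_smulRight (β : E →L[ℝ] ℝ) (x : E) : traceCLM E (β.smulRight x) = β x := by
  rw [traceCLM_apply]
  exact LinearMap.trace_smulRight (β : E →ₗ[ℝ] ℝ) x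

theorem IsFrame.traceCLM_eq {ι : Type*} [Fintype ι] {g : E →L[ℝ] E →L[ℝ] ℝ} {e : ι → E}
    (he : IsFrame g e) (L : E →L[ℝ] E) : traceCLM E L = ∑ i, g (L (e i)) (e i) := by
  have : L = ∑ i, (g (e i)).smulRight (L (e i)) := by
    ext u
    conv_lhs => rw [← he.sum_smul u]
    simp [he.symm u, sum_apply]
  rw [this, map_sum]
  simp only [traceCLM_smulRight]
  rw [← this]
  exact Finset.sum_congr rfl fun i _ => he.symm _ _

end Calculus

/-! ### Metric, connection and frame on an open set -/

section LocalGeometry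

variable {n : ℕ}

/-- A metric with its Levi-Civita connection and a frame, on an open set of `ℝⁿ`. -/
structure LocalGeometry (D : Set (Coord n)) (g : Coord n → Coord n →L[ℝ] Coord n →L[ℝ] ℝ) (Γ : Coord n → Coord n →L[ℝ] Coord n →L[ℝ] Coord n)
    (e : Coord n → Fin n → Coord n) : Prop where
  isOpen : IsOpen D
  smooth_g : ContDiffOn ℝ ∞ g D
  smooth_Γ : ContDiffOn ℝ ∞ Γ D
  Γ_comm : ∀ y ∈ D, ∀ u v, Γ y u v = Γ y v u
  compat : ∀ y ∈ D, ∀ u v w, fderiv ℝ g y w u v = g y (Γ y w u) v + g y u (Γ y w v)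
  frame : ∀ y ∈ D, IsFrame (g y) (e y)
  smooth_frame : ∀ a b, ContDiffOn ℝ ∞ (fun y => ∑ i, e y i a * e y i b) D

variable {F : Type*} [NormedAddCommGroup F] [NormedSpace ℝ F]

theorem coord_eq_sum (u : Coord n) : u = ∑ a, u a • EuclideanSpace.single a (1 : ℝ) := by
  ext k
  simp [Pi.single_apply]

theorem bilin_eq_sum (B : Coord n →L[ℝ] Coord n →L[ℝ] F) (u v : Coord n) :
    B u v = ∑ a, ∑ b, (u a * v b) • B (EuclideanSpace.single a 1) (EuclideanSpace.single b 1) := by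
  conv_lhs => rw [coord_eq_sum u, coord_eq_sum v]
  simp only [map_sum, map_smul, sum_apply, smul_apply, Finset.smul_sum, smul_smul]
  rw [Finset.sum_comm]
  simp only [mul_comm]

/-- The frame is chosen pointwise and need not even be continuous. A contraction sees it only
through ∑ e_i ⊗ e_i, the inverse metric, which is smooth. -/
theorem contDiffOn_contr_of_frame {D : Set (Coord n)} {e : Coord n → Fin n → Coord n}
    (he : ∀ a b, ContDiffOn ℝ ∞ (fun y => ∑ i, e y i a * e y i b) D)
    {B : Coord n → Coord n →L[ℝ] Coord n →L[ℝ] F}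
    (hB : ContDiffOn ℝ ∞ B D) : ContDiffOn ℝ ∞ (fun y => ∑ i, B y (e y i) (e y i)) D := by
  have h : (fun y => ∑ i, B y (e y i) (e y i)) = fun y => ∑ a, ∑ b, (∑ i, e y i a * e y i b) •
      B y (EuclideanSpace.single a 1) (EuclideanSpace.single b 1) := by
    funext y
    simp only [bilin_eq_sum (B y) (e y _), Finset.sum_smul]
    rw [Finset.sum_comm]
    exact Finset.sum_congr rfl fun a _ => Finset.sum_comm
  rw [h]
  refine ContDiffOn.sum fun a _ => ContDiffOn.sum fun b _ => (he a b).smul ?_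
  exact (hB.clm_apply contDiffOn_const).clm_apply contDiffOn_const

namespace LocalGeometry

variable {D : Set (Coord n)} {g : Coord n → Coord n →L[ℝ] Coord n →L[ℝ] ℝ} {Γ : Coord n → Coord n →L[ℝ] Coord n →L[ℝ] Coord n}
  {e : Coord n → Fin n → Coord n}

theorem contDiffOn_contr (hG : LocalGeometry D g Γ e) {B : Coord n → Coord n →L[ℝ] Coord n →L[ℝ] F}
    (hB : ContDiffOn ℝ ∞ B D) : ContDiffOn ℝ ∞ (fun y => ∑ i, B y (e y i) (e y i)) D :=
  contDiffOn_contr_of_frame hG.smooth_frame hB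

end LocalGeometry

/-- Raising an index. -/
def sharp (e : Fin n → Coord n) : (Coord n →L[ℝ] ℝ) →L[ℝ] Coord n :=
  ∑ i, (ContinuousLinearMap.apply ℝ ℝ (e i)).smulRight (e i)

theorem sharp_apply (e : Fin n → Coord n) (β : Coord n →L[ℝ] ℝ) : sharp e β = ∑ i, β (e i) • e i := by
  simp [sharp, sum_apply]

theorem IsFrame.apply_sharp {g : Coord n →L[ℝ] Coord n →L[ℝ] ℝ} {e : Fin n → Coord n} (he : IsFrame g e)
    (β : Coord n →L[ℝ] ℝ) (u : Coord n) : g (sharp e β) u = β u := by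
  rw [he.symm, sharp_apply, map_sum, ← he.sum_mul u β]
  exact Finset.sum_congr rfl fun i _ => by simp [mul_comm]

theorem smooth_sharp_of_frame {D : Set (Coord n)} {e : Coord n → Fin n → Coord n}
    (he : ∀ a b, ContDiffOn ℝ ∞ (fun y => ∑ i, e y i a * e y i b) D) :
    ContDiffOn ℝ ∞ (fun y => sharp (e y)) D := by
  refine contDiffOn_clm_apply.2 fun β => ?_
  have := contDiffOn_contr_of_frame he
    (B := fun _ => β.smulRight (ContinuousLinearMap.id ℝ (Coord n))) contDiffOn_const
  simpa [sharp_apply] using this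

theorem LocalGeometry.smooth_sharp {D : Set (Coord n)} {g : Coord n → Coord n →L[ℝ] Coord n →L[ℝ] ℝ}
    {Γ : Coord n → Coord n →L[ℝ] Coord n →L[ℝ] Coord n} {e : Coord n → Fin n → Coord n} (hG : LocalGeometry D g Γ e) :
    ContDiffOn ℝ ∞ (fun y => sharp (e y)) D :=
  smooth_sharp_of_frame hG.smooth_frame

/-- The form `T(e_i, ·, e_i)`. -/
def tauCLM (T : Coord n →L[ℝ] Coord n →L[ℝ] Coord n →L[ℝ] ℝ) (e : Fin n → Coord n) : Coord n →L[ℝ] ℝ :=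
  ∑ i, (T (e i)).flip (e i)

theorem tauCLM_apply (T : Coord n →L[ℝ] Coord n →L[ℝ] Coord n →L[ℝ] ℝ) (e : Fin n → Coord n) (w : Coord n) :
    tauCLM T e w = tauForm T e w := by
  simp [tauCLM, tauForm, sum_apply]

/-- The tensor `S_{ij}^k`, where `S_{ijk} = T_{ijk} + 1/(n-1) g_{ij} t_k`. -/
def sTensor (g : Coord n →L[ℝ] Coord n →L[ℝ] ℝ) (T : Coord n →L[ℝ] Coord n →L[ℝ] Coord n →L[ℝ] ℝ) (e : Fin n → Coord n) :
    Coord n →L[ℝ] Coord n →L[ℝ] Coord n :=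
  (LinearMap.mk₂ ℝ (fun u v : Coord n => sharp e (T u v) +
    ((1 / ((n : ℝ) - 1)) * g u v) • sharp e (tauCLM T e))
    (fun a b c => by simp only [map_add, add_apply]; module)
    (fun r a b => by simp only [map_smul, smul_apply, smul_eq_mul]; module)
    (fun a b c => by simp only [map_add]; module)
    (fun r a b => by simp only [map_smul, smul_eq_mul]; module)).toContinuousBilinearMap

theorem sTensor_apply (g : Coord n →L[ℝ] Coord n →L[ℝ] ℝ) (T : Coord n →L[ℝ] Coord n →L[ℝ] Coord n →L[ℝ] ℝ) (e : Fin n → Coord n)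
    (u v : Coord n) : sTensor g T e u v = sharp e (T u v) +
      ((1 / ((n : ℝ) - 1)) * g u v) • sharp e (tauCLM T e) := rfl

theorem IsFrame.sTensor_pair {g : Coord n →L[ℝ] Coord n →L[ℝ] ℝ} {T : Coord n →L[ℝ] Coord n →L[ℝ] Coord n →L[ℝ] ℝ}
    {e : Fin n → Coord n} (he : IsFrame g e) (u v w : Coord n) :
    g (sTensor g T e u v) w = T u v w + 1 / ((n : ℝ) - 1) * (g u v * tauForm T e w) := by
  rw [sTensor_apply, map_add, map_smul, add_apply, smul_apply, he.apply_sharp, he.apply_sharp,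
    tauCLM_apply, smul_eq_mul]
  ring

theorem contDiffOn_clm_apply₂ {A : Coord n → Coord n →L[ℝ] Coord n →L[ℝ] F} {D : Set (Coord n)}
    (h : ∀ u v, ContDiffOn ℝ ∞ (fun y => A y u v) D) : ContDiffOn ℝ ∞ A D :=
  contDiffOn_clm_apply.2 fun u => contDiffOn_clm_apply.2 fun v => h u v

/-- Alternation of the covariant derivative of a connection, `Ω(u, v, w) = R(w, v) u`. -/
def curvForm (A : Coord n →L[ℝ] Coord n →L[ℝ] Coord n) (A' : Coord n →L[ℝ] Coord n →L[ℝ] Coord n →L[ℝ] Coord n) (u v w : Coord n) : Coord n :=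
  A' w u v - A' v u w + A (A u v) w - A (A u w) v

/-- `curvForm` as a bilinear map of its first two arguments. -/
def curvBilin (A : Coord n →L[ℝ] Coord n →L[ℝ] Coord n) (A' : Coord n →L[ℝ] Coord n →L[ℝ] Coord n →L[ℝ] Coord n) (w : Coord n) :
    Coord n →L[ℝ] Coord n →L[ℝ] Coord n :=
  (LinearMap.mk₂ ℝ (fun u v : Coord n => curvForm A A' u v w)
    (fun a b c => by simp only [curvForm, map_add, add_apply]; abel)
    (fun r a b => by simp only [curvForm, map_smul, smul_apply]; module)
    (fun a b c => by simp only [curvForm, map_add, add_apply]; abel)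
    (fun r a b => by simp only [curvForm, map_smul, smul_apply]; module)).toContinuousBilinearMap

theorem curvBilin_apply (A : Coord n →L[ℝ] Coord n →L[ℝ] Coord n) (A' : Coord n →L[ℝ] Coord n →L[ℝ] Coord n →L[ℝ] Coord n) (u v w : Coord n) :
    curvBilin A A' w u v = curvForm A A' u v w := rfl

/-- The endomorphism `X` with `d(U) = dV ∘ X`. -/
def xTensor (A : Coord n →L[ℝ] Coord n →L[ℝ] Coord n) (A' : Coord n →L[ℝ] Coord n →L[ℝ] Coord n →L[ℝ] Coord n) (e : Fin n → Coord n) :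
    Coord n →L[ℝ] Coord n :=
  -(1 / ((n : ℝ) - 1)) • LinearMap.toContinuousLinearMap
    ({ toFun := fun w => ∑ i, curvForm A A' (e i) (e i) w
       map_add' := fun a b => by
        rw [← Finset.sum_add_distrib]
        refine Finset.sum_congr rfl fun i _ => ?_
        simp only [curvForm, map_add, add_apply]
        abel
       map_smul' := fun r a => by
        rw [Finset.smul_sum]
        refine Finset.sum_congr rfl fun i _ => ?_
        simp only [curvForm, map_smul, smul_apply, RingHom.id_apply]
        module } : Coord n →ₗ[ℝ] Coord n)

theorem xTensor_apply (A : Coord n →L[ℝ] Coord n →L[ℝ] Coord n) (A' : Coord n →L[ℝ] Coord n →L[ℝ] Coord n →L[ℝ] Coord n) (e : Fin n → Coord n)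
    (w : Coord n) : xTensor A A' e w = -(1 / ((n : ℝ) - 1)) • ∑ i, curvForm A A' (e i) (e i) w := rfl

namespace LocalGeometry

variable {D : Set (Coord n)} {g : Coord n → Coord n →L[ℝ] Coord n →L[ℝ] ℝ} {Γ : Coord n → Coord n →L[ℝ] Coord n →L[ℝ] Coord n}
  {e : Coord n → Fin n → Coord n} {T : Coord n → Coord n →L[ℝ] Coord n →L[ℝ] Coord n →L[ℝ] ℝ}

theorem smooth_tau (hG : LocalGeometry D g Γ e) (hT : ContDiffOn ℝ ∞ T D) :
    ContDiffOn ℝ ∞ (fun y => tauCLM (T y) (e y)) D := by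
  refine contDiffOn_clm_apply.2 fun w => ?_
  have h : ContDiffOn ℝ ∞ (fun y => (T y).flip w) D := contDiffOn_clm_apply₂ fun u v => by
    simpa using ((hT.clm_apply contDiffOn_const).clm_apply contDiffOn_const).clm_apply
      contDiffOn_const
  simpa [tauCLM, sum_apply] using hG.contDiffOn_contr h

theorem smooth_s (hG : LocalGeometry D g Γ e) (hT : ContDiffOn ℝ ∞ T D) :
    ContDiffOn ℝ ∞ (fun y => sTensor (g y) (T y) (e y)) D := by
  refine contDiffOn_clm_apply₂ fun u v => ?_
  simp only [sTensor_apply]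
  have h1 : ContDiffOn ℝ ∞ (fun y => T y u v) D :=
    (hT.clm_apply contDiffOn_const).clm_apply contDiffOn_const
  have h2 : ContDiffOn ℝ ∞ (fun y => g y u v) D :=
    (hG.smooth_g.clm_apply contDiffOn_const).clm_apply contDiffOn_const
  exact (hG.smooth_sharp.clm_apply h1).add ((contDiffOn_const.mul h2).smul
    (hG.smooth_sharp.clm_apply (hG.smooth_tau hT)))

theorem smooth_x (hG : LocalGeometry D g Γ e) {A : Coord n → Coord n →L[ℝ] Coord n →L[ℝ] Coord n}
    (hA : ContDiffOn ℝ ∞ A D) :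
    ContDiffOn ℝ ∞ (fun y => xTensor (A y) (fderiv ℝ A y) (e y)) D := by
  have hA' := ContDiffOn.fderiv_infty hA hG.isOpen
  have h2 : ∀ u v : Coord n, ContDiffOn ℝ ∞ (fun y => A y u v) D := fun u v =>
    (hA.clm_apply contDiffOn_const).clm_apply contDiffOn_const
  have h3 : ∀ w u v : Coord n, ContDiffOn ℝ ∞ (fun y => fderiv ℝ A y w u v) D := fun w u v =>
    ((hA'.clm_apply contDiffOn_const).clm_apply contDiffOn_const).clm_apply contDiffOn_const
  refine contDiffOn_clm_apply.2 fun w => ?_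
  have h : ContDiffOn ℝ ∞ (fun y => curvBilin (A y) (fderiv ℝ A y) w) D :=
    contDiffOn_clm_apply₂ fun u v => by
      simp only [curvBilin_apply, curvForm]
      exact (((h3 w u v).sub (h3 v u w)).add
        ((hA.clm_apply (h2 u v)).clm_apply contDiffOn_const)).sub
        ((hA.clm_apply (h2 u w)).clm_apply contDiffOn_const)
  simp only [xTensor_apply]
  exact (hG.contDiffOn_contr h).const_smul _

end LocalGeometry

end LocalGeometry

end SuperInt
end

noncomputable section
set_option maxSynthPendingDepth 3

namespace SuperInt

/-! ### Prolongation of the equation for the potential -/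

section Prolongation

variable {n : ℕ}

/-- The connection `Γ + S`. -/
def connField (g : Coord n → Coord n →L[ℝ] Coord n →L[ℝ] ℝ)
    (Γ : Coord n → Coord n →L[ℝ] Coord n →L[ℝ] Coord n)
    (T : Coord n → Coord n →L[ℝ] Coord n →L[ℝ] Coord n →L[ℝ] ℝ) (e : Coord n → Fin n → Coord n)
    (y : Coord n) : Coord n →L[ℝ] Coord n →L[ℝ] Coord n :=
  Γ y + sTensor (g y) (T y) (e y)

/-- The field of endomorphisms `X`. -/
def xField (g : Coord n → Coord n →L[ℝ] Coord n →L[ℝ] ℝ)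
    (Γ : Coord n → Coord n →L[ℝ] Coord n →L[ℝ] Coord n)
    (T : Coord n → Coord n →L[ℝ] Coord n →L[ℝ] Coord n →L[ℝ] ℝ) (e : Coord n → Fin n → Coord n)
    (y : Coord n) : Coord n →L[ℝ] Coord n :=
  xTensor (connField g Γ T e y) (fderiv ℝ (connField g Γ T e) y) (e y)

/-- The Laplacian in terms of a frame. -/
def frameLaplacian (Γ : Coord n → Coord n →L[ℝ] Coord n →L[ℝ] Coord n)
    (e : Coord n → Fin n → Coord n) (V : Coord n → ℝ) (y : Coord n) : ℝ :=
  ∑ i, (fderiv ℝ (fderiv ℝ V) y (e y i) (e y i) - fderiv ℝ V y (Γ y (e y i) (e y i)))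

/-- The function `U` with `V_{,ij} = S_{ij}^m V_{,m} + g_{ij} U`. -/
def auxPotential (Γ : Coord n → Coord n →L[ℝ] Coord n →L[ℝ] Coord n)
    (T : Coord n → Coord n →L[ℝ] Coord n →L[ℝ] Coord n →L[ℝ] ℝ) (e : Coord n → Fin n → Coord n)
    (V : Coord n → ℝ) (y : Coord n) : ℝ :=
  1 / (n : ℝ) * frameLaplacian Γ e V y -
    1 / ((n : ℝ) - 1) * fderiv ℝ V y (sharp (e y) (tauCLM (T y) (e y)))

/-- Symmetry, trace condition and smoothness of the structure tensor. -/
structure LocalStructure (D : Set (Coord n)) (T : Coord n → Coord n →L[ℝ] Coord n →L[ℝ]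
    Coord n →L[ℝ] ℝ) (e : Coord n → Fin n → Coord n) : Prop where
  smooth : ContDiffOn ℝ ∞ T D
  symm : ∀ y ∈ D, ∀ u v w, T y u v w = T y v u w
  traceFree : ∀ y ∈ D, ∀ w, ∑ i, T y (e y i) (e y i) w = 0

/-- Solutions of the equation for the potential. -/
structure LocalPotential (D : Set (Coord n)) (g : Coord n → Coord n →L[ℝ] Coord n →L[ℝ] ℝ)
    (Γ : Coord n → Coord n →L[ℝ] Coord n →L[ℝ] Coord n)
    (T : Coord n → Coord n →L[ℝ] Coord n →L[ℝ] Coord n →L[ℝ] ℝ) (e : Coord n → Fin n → Coord n)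
    (V : Coord n → ℝ) : Prop where
  smooth : ContDiffOn ℝ ∞ V D
  eq : ∀ y ∈ D, ∀ u v, fderiv ℝ (fderiv ℝ V) y u v - fderiv ℝ V y (Γ y u v) =
    fderiv ℝ V y (sharp (e y) (T y u v)) + 1 / (n : ℝ) * g y u v * frameLaplacian Γ e V y

variable {D : Set (Coord n)} {g : Coord n → Coord n →L[ℝ] Coord n →L[ℝ] ℝ}
  {Γ : Coord n → Coord n →L[ℝ] Coord n →L[ℝ] Coord n}
  {T : Coord n → Coord n →L[ℝ] Coord n →L[ℝ] Coord n →L[ℝ] ℝ} {e : Coord n → Fin n → Coord n}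
  {V : Coord n → ℝ}

theorem LocalPotential.hess_eq (hV : LocalPotential D g Γ T e V) {y : Coord n} (hy : y ∈ D)
    (u v : Coord n) : fderiv ℝ (fderiv ℝ V) y u v =
      fderiv ℝ V y (connField g Γ T e y u v) + auxPotential Γ T e V y * g y u v := by
  have h := hV.eq y hy u v
  simp only [connField, add_apply, map_add, sTensor_apply, map_smul, smul_eq_mul, auxPotential]
  linear_combination h

namespace LocalGeometry

theorem smooth_conn (hG : LocalGeometry D g Γ e) (hT : LocalStructure D T e) :
    ContDiffOn ℝ ∞ (connField g Γ T e) D :=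
  hG.smooth_Γ.add (hG.smooth_s hT.smooth)

theorem smooth_xField (hG : LocalGeometry D g Γ e) (hT : LocalStructure D T e) :
    ContDiffOn ℝ ∞ (xField g Γ T e) D :=
  hG.smooth_x (hG.smooth_conn hT)

theorem sTensor_comm (hT : LocalStructure D T e) (hG : LocalGeometry D g Γ e) {y : Coord n}
    (hy : y ∈ D) (u v : Coord n) :
    sTensor (g y) (T y) (e y) u v = sTensor (g y) (T y) (e y) v u := by
  have : T y u v = T y v u := by ext w; exact hT.symm y hy u v w
  rw [sTensor_apply, sTensor_apply, this, (hG.frame y hy).symm u v]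

theorem connField_comm (hG : LocalGeometry D g Γ e) (hT : LocalStructure D T e) {y : Coord n}
    (hy : y ∈ D) (u v : Coord n) : connField g Γ T e y u v = connField g Γ T e y v u := by
  simp only [connField, add_apply]
  rw [hG.Γ_comm y hy, sTensor_comm hT hG hy]

theorem smooth_auxPotential (hG : LocalGeometry D g Γ e) (hT : LocalStructure D T e)
    (hV : ContDiffOn ℝ ∞ V D) : ContDiffOn ℝ ∞ (auxPotential Γ T e V) D := by
  have h1 := ContDiffOn.fderiv_infty hV hG.isOpen
  have h2 := ContDiffOn.fderiv_infty h1 hG.isOpen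
  have h3 : ContDiffOn ℝ ∞ (fun y => (fderiv ℝ V y).comp (sharp (e y)) (tauCLM (T y) (e y))) D :=
    (h1.clm_comp hG.smooth_sharp).clm_apply (hG.smooth_tau hT.smooth)
  have h4 : ContDiffOn ℝ ∞ (fun y => fderiv ℝ (fderiv ℝ V) y -
      (ContinuousLinearMap.compL ℝ (Coord n) (Coord n) ℝ (fderiv ℝ V y)).comp (Γ y)) D :=
    h2.sub (((ContinuousLinearMap.compL ℝ (Coord n) (Coord n) ℝ).contDiff.comp_contDiffOn h1).clm_comp
      hG.smooth_Γ)
  have h5 := hG.contDiffOn_contr h4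
  exact (contDiffOn_const.mul (h5.congr fun y _ => by simp [frameLaplacian])).sub
    (contDiffOn_const.mul h3)

/-- The integrability condition of the equation for `V`. -/
theorem integrability (hG : LocalGeometry D g Γ e) (hT : LocalStructure D T e)
    (hV : LocalPotential D g Γ T e V) {y : Coord n} (hy : y ∈ D) (u v w : Coord n) :
    fderiv ℝ V y (curvForm (connField g Γ T e y) (fderiv ℝ (connField g Γ T e) y) u v w) +
      auxPotential Γ T e V y * (g y (sTensor (g y) (T y) (e y) u v) w -
        g y (sTensor (g y) (T y) (e y) u w) v) +
      (g y u v * fderiv ℝ (auxPotential Γ T e V) y w -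
        g y u w * fderiv ℝ (auxPotential Γ T e V) y v) = 0 := by
  set A := connField g Γ T e with hA
  set U := auxPotential Γ T e V with hU
  have hD := hG.isOpen
  have dA : DifferentiableAt ℝ A y :=
    ContDiffOn.differentiableAt_of_mem (hG.smooth_conn hT) hD hy
  have dU : DifferentiableAt ℝ U y :=
    ContDiffOn.differentiableAt_of_mem (hG.smooth_auxPotential hT hV.smooth) hD hy
  have dg := ContDiffOn.differentiableAt_of_mem hG.smooth_g hD hy
  have sV1 := ContDiffOn.fderiv_infty hV.smooth hD
  have dV1 := ContDiffOn.differentiableAt_of_mem sV1 hD hy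
  -- p is the differential of ∂_u V, rewritten by the equation for the Hessian. The symmetry of its
  -- derivative is the integrability condition.
  set p : Coord n → Coord n →L[ℝ] ℝ := fun z => (fderiv ℝ V z).comp (A z u) + U z • g z u with hp
  have hpd : DifferentiableAt ℝ p y :=
    (dV1.clm_comp (dA.clm_apply (differentiableAt_const u))).add
      (dU.smul (dg.clm_apply (differentiableAt_const u)))
  have hder : ∀ z ∈ D, HasFDerivAt (fun z => fderiv ℝ V z u) (p z) z := by
    intro z hz
    have h1 := ContDiffOn.differentiableAt_of_mem sV1 hD hz
    have h2 := (h1.clm_apply (differentiableAt_const u)).hasFDerivAt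
    convert! h2 using 1
    ext v
    rw [fderiv_clm_apply_const h1, fderiv_fderiv_symm hD hV.smooth hz, hV.hess_eq hz]
    simp [hp, hA, hU]
  have key : ∀ v w, fderiv ℝ p y w v = fderiv ℝ (fderiv ℝ V) y w (A y u v) +
      fderiv ℝ V y (fderiv ℝ A y w u v) + (fderiv ℝ U y w * g y u v +
        U y * fderiv ℝ g y w u v) := by
    intro v w
    rw [← fderiv_clm_apply_const hpd]
    have dAu : DifferentiableAt ℝ (fun z => A z u v) y :=
      (dA.clm_apply (differentiableAt_const u)).clm_apply (differentiableAt_const v)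
    have dgu : DifferentiableAt ℝ (fun z => g z u v) y :=
      (dg.clm_apply (differentiableAt_const u)).clm_apply (differentiableAt_const v)
    have e1 : (fun z => p z v) = fun z => fderiv ℝ V z (A z u v) + U z * g z u v := by
      funext z; simp [hp]
    rw [e1, fderiv_fun_add (dV1.clm_apply dAu) (dU.fun_mul dgu), fderiv_clm_apply dV1 dAu,
      fderiv_fun_mul dU dgu]
    simp only [add_apply, smul_apply, smul_eq_mul, ContinuousLinearMap.coe_comp, Function.comp_apply,
      ContinuousLinearMap.flip_apply, fderiv_clm_apply_const₂ dA, fderiv_clm_apply_const₂ dg]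
    ring
  have hsym := fderiv_symm_of_hasFDerivAt hD hder hy hpd w v
  rw [key, key, hV.hess_eq hy, hV.hess_eq hy, hG.compat y hy, hG.compat y hy] at hsym
  have c1 : ∀ a b, A y a b = A y b a := hG.connField_comm hT hy
  have c2 := (hG.frame y hy).symm
  have hAe : ∀ a b, A y a b = Γ y a b + sTensor (g y) (T y) (e y) a b := fun a b => rfl
  have g1 : g y w (A y u v) = g y (Γ y u v) w + g y (sTensor (g y) (T y) (e y) u v) w := by
    rw [c2, hAe, map_add, add_apply]
  have g2 : g y v (A y u w) = g y (Γ y u w) v + g y (sTensor (g y) (T y) (e y) u w) v := by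
    rw [c2, hAe, map_add, add_apply]
  simp only [curvForm, map_add, map_sub]
  rw [c1 (A y u v) w, c1 (A y u w) v]
  rw [g1, g2, hG.Γ_comm y hy w u, hG.Γ_comm y hy v u, hG.Γ_comm y hy w v] at hsym
  linear_combination hsym

/-- This is the reason for the factor 1/(n-1) in S: the two contractions are n/(n-1) t and t +
1/(n-1) t, which agree. -/
theorem traceForm_s_eq (hG : LocalGeometry D g Γ e) (hT : LocalStructure D T e) (hn : 2 ≤ n)
    {y : Coord n} (hy : y ∈ D) (w : Coord n) :
    ∑ i, (g y (sTensor (g y) (T y) (e y) (e y i) (e y i)) w -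
      g y (sTensor (g y) (T y) (e y) (e y i) w) (e y i)) = 0 := by
  have hf := hG.frame y hy
  have hn' : (2 : ℝ) ≤ n := by exact_mod_cast hn
  have h1 : (n : ℝ) - 1 ≠ 0 := by linarith
  simp only [hf.sTensor_pair, ← tauCLM_apply]
  simp only [Finset.sum_sub_distrib, Finset.sum_add_distrib, ← Finset.mul_sum, ← Finset.sum_mul,
    hT.traceFree y hy, hf.sum_diag, hf.symm _ w, hf.sum_mul w, Fintype.card_fin]
  have : ∑ i, T y (e y i) w (e y i) = tauCLM (T y) (e y) w := (tauCLM_apply _ _ _).symm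
  rw [this]
  field_simp
  ring

/-- The derivative of `U`. -/
theorem fderiv_auxPotential (hG : LocalGeometry D g Γ e) (hT : LocalStructure D T e) (hn : 2 ≤ n)
    (hV : LocalPotential D g Γ T e V) {y : Coord n} (hy : y ∈ D) (w : Coord n) :
    fderiv ℝ (auxPotential Γ T e V) y w = fderiv ℝ V y (xField g Γ T e y w) := by
  have hf := hG.frame y hy
  have hn' : (2 : ℝ) ≤ n := by exact_mod_cast hn
  have h1 : (n : ℝ) - 1 ≠ 0 := by linarith
  -- In the trace over u = v the coefficient of U vanishes by `traceForm_s_eq`, and the metric terms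
  -- add up to (n-1) dU(w).
  have h := Finset.sum_eq_zero fun i (_ : i ∈ Finset.univ) =>
    hG.integrability hT hV hy (e y i) (e y i) w
  rw [Finset.sum_add_distrib, Finset.sum_add_distrib, ← Finset.mul_sum,
    hG.traceForm_s_eq hT hn hy, Finset.sum_sub_distrib, ← Finset.sum_mul, hf.sum_diag] at h
  simp only [hf.symm _ w, hf.sum_mul w, Fintype.card_fin] at h
  rw [xField, xTensor_apply, map_smul, map_sum, smul_eq_mul]
  field_simp
  linear_combination h

end LocalGeometry

/-- Every first order jet of a potential, together with the value of `U`, is realised. -/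
def JetsSurjective (D : Set (Coord n)) (g : Coord n → Coord n →L[ℝ] Coord n →L[ℝ] ℝ)
    (Γ : Coord n → Coord n →L[ℝ] Coord n →L[ℝ] Coord n)
    (T : Coord n → Coord n →L[ℝ] Coord n →L[ℝ] Coord n →L[ℝ] ℝ)
    (e : Coord n → Fin n → Coord n) : Prop :=
  ∀ y ∈ D, ∀ (β : Coord n →L[ℝ] ℝ) (μ : ℝ), ∃ V, LocalPotential D g Γ T e V ∧
    fderiv ℝ V y = β ∧ auxPotential Γ T e V y = μ

namespace LocalGeometry

/-- At a point where dV = 0 and U = 1 also dU = dV ∘ X vanishes, so the integrability condition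
reduces to the coefficient of U. -/
theorem sTensor_symm (hG : LocalGeometry D g Γ e) (hT : LocalStructure D T e) (hn : 2 ≤ n)
    (hL : JetsSurjective D g Γ T e) {y : Coord n} (hy : y ∈ D) (u v w : Coord n) :
    g y (sTensor (g y) (T y) (e y) u v) w = g y (sTensor (g y) (T y) (e y) u w) v := by
  obtain ⟨V, hV, h1, h2⟩ := hL y hy 0 1
  have h := hG.integrability hT hV hy u v w
  rw [hG.fderiv_auxPotential hT hn hV hy, hG.fderiv_auxPotential hT hn hV hy, h1, h2] at h
  simp only [zero_apply] at h
  linear_combination h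

/-- The companion choice U = 0 with arbitrary dV isolates the coefficient of dV. -/
theorem flat (hG : LocalGeometry D g Γ e) (hT : LocalStructure D T e) (hn : 2 ≤ n)
    (hL : JetsSurjective D g Γ T e) {y : Coord n} (hy : y ∈ D) (u v w : Coord n) :
    curvForm (connField g Γ T e y) (fderiv ℝ (connField g Γ T e) y) u v w +
      g y u v • xField g Γ T e y w - g y u w • xField g Γ T e y v = 0 := by
  refine (hG.frame y hy).ext fun z => ?_
  obtain ⟨V, hV, h1, h2⟩ := hL y hy ((g y).flip z) 0
  have h := hG.integrability hT hV hy u v w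
  rw [hG.fderiv_auxPotential hT hn hV hy, hG.fderiv_auxPotential hT hn hV hy, h1, h2] at h
  simp only [ContinuousLinearMap.flip_apply] at h
  simp only [map_sub, map_add, map_smul, sub_apply, add_apply, smul_apply, smul_eq_mul, map_zero,
    zero_apply]
  linear_combination h

/-- Symmetry of the second derivatives of U, where dU = dV ∘ X and the Hessian of V is again
eliminated. The next two lemmas read off its coefficients: that of U makes X self-adjoint, that of
dV makes X Codazzi for Γ + S. -/
theorem xField_integrability (hG : LocalGeometry D g Γ e) (hT : LocalStructure D T e) (hn : 2 ≤ n)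
    (hV : LocalPotential D g Γ T e V) {y : Coord n} (hy : y ∈ D) (v w : Coord n) :
    fderiv ℝ V y (fderiv ℝ (xField g Γ T e) y w v + connField g Γ T e y w (xField g Γ T e y v)) +
      auxPotential Γ T e V y * g y w (xField g Γ T e y v) =
    fderiv ℝ V y (fderiv ℝ (xField g Γ T e) y v w + connField g Γ T e y v (xField g Γ T e y w)) +
      auxPotential Γ T e V y * g y v (xField g Γ T e y w) := by
  have hD := hG.isOpen
  have dX := ContDiffOn.differentiableAt_of_mem (hG.smooth_xField hT) hD hy
  have sU := hG.smooth_auxPotential hT hV.smooth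
  have dV1 := ContDiffOn.differentiableAt_of_mem (ContDiffOn.fderiv_infty hV.smooth hD) hD hy
  have hpd : DifferentiableAt ℝ (fun z => (fderiv ℝ V z).comp (xField g Γ T e z)) y :=
    dV1.clm_comp dX
  have hsym := fderiv_symm_of_hasFDerivAt (f := auxPotential Γ T e V) hD (fun z hz => by
    have h1 := (ContDiffOn.differentiableAt_of_mem sU hD hz).hasFDerivAt
    convert! h1 using 1
    ext v
    exact (hG.fderiv_auxPotential hT hn hV hz v).symm) hy hpd w v
  have key : ∀ v w, fderiv ℝ (fun z => (fderiv ℝ V z).comp (xField g Γ T e z)) y w v =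
      fderiv ℝ (fderiv ℝ V) y w (xField g Γ T e y v) +
        fderiv ℝ V y (fderiv ℝ (xField g Γ T e) y w v) := by
    intro v w
    rw [fderiv_clm_comp dV1 dX]
    simp [add_comm]
  rw [key, key, hV.hess_eq hy, hV.hess_eq hy] at hsym
  simp only [map_add]
  linear_combination hsym

theorem xField_symm (hG : LocalGeometry D g Γ e) (hT : LocalStructure D T e) (hn : 2 ≤ n)
    (hL : JetsSurjective D g Γ T e) {y : Coord n} (hy : y ∈ D) (u v : Coord n) :
    g y (xField g Γ T e y u) v = g y (xField g Γ T e y v) u := by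
  obtain ⟨V, hV, h1, h2⟩ := hL y hy 0 1
  have h := hG.xField_integrability hT hn hV hy u v
  rw [h1, h2] at h
  rw [(hG.frame y hy).symm _ v, (hG.frame y hy).symm _ u]
  simpa using h

theorem xField_codazzi (hG : LocalGeometry D g Γ e) (hT : LocalStructure D T e) (hn : 2 ≤ n)
    (hL : JetsSurjective D g Γ T e) {y : Coord n} (hy : y ∈ D) (v w : Coord n) :
    fderiv ℝ (xField g Γ T e) y w v + connField g Γ T e y w (xField g Γ T e y v) =
      fderiv ℝ (xField g Γ T e) y v w + connField g Γ T e y v (xField g Γ T e y w) := by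
  refine (hG.frame y hy).ext fun z => ?_
  obtain ⟨V, hV, h1, h2⟩ := hL y hy ((g y).flip z) 0
  have h := hG.xField_integrability hT hn hV hy v w
  rw [h1, h2] at h
  simpa using h

end LocalGeometry

end Prolongation

end SuperInt
end

noncomputable section
set_option maxSynthPendingDepth 3

namespace SuperInt

/-! ### Consequences for spaces of constant curvature -/

section ConstantCurvature

variable {n : ℕ}

/-- The connection has constant curvature `κ`. -/
def IsConstCurv (D : Set (Coord n)) (g : Coord n → Coord n →L[ℝ] Coord n →L[ℝ] ℝ)
    (Γ : Coord n → Coord n →L[ℝ] Coord n →L[ℝ] Coord n) (κ : ℝ) : Prop :=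
  ∀ y ∈ D, ∀ u v w, curvForm (Γ y) (fderiv ℝ Γ y) u v w = κ • (g y u v • w - g y u w • v)

/-- The field `S`. -/
def sField (g : Coord n → Coord n →L[ℝ] Coord n →L[ℝ] ℝ)
    (T : Coord n → Coord n →L[ℝ] Coord n →L[ℝ] Coord n →L[ℝ] ℝ) (e : Coord n → Fin n → Coord n)
    (y : Coord n) : Coord n →L[ℝ] Coord n →L[ℝ] Coord n :=
  sTensor (g y) (T y) (e y)

/-- The covariant derivative of a field of bilinear maps with vector values. -/
def covS (Γ : Coord n → Coord n →L[ℝ] Coord n →L[ℝ] Coord n)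
    (s : Coord n → Coord n →L[ℝ] Coord n →L[ℝ] Coord n) (y w u v : Coord n) : Coord n :=
  fderiv ℝ s y w u v + Γ y w (s y u v) - s y (Γ y w u) v - s y u (Γ y w v)

/-- The endomorphism `X + κ`. -/
def xHat (g : Coord n → Coord n →L[ℝ] Coord n →L[ℝ] ℝ)
    (Γ : Coord n → Coord n →L[ℝ] Coord n →L[ℝ] Coord n)
    (T : Coord n → Coord n →L[ℝ] Coord n →L[ℝ] Coord n →L[ℝ] ℝ) (e : Coord n → Fin n → Coord n)
    (κ : ℝ) (y : Coord n) : Coord n →L[ℝ] Coord n :=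
  xField g Γ T e y + κ • ContinuousLinearMap.id ℝ (Coord n)

/-- The form that measures the deviation of `X` from a Codazzi tensor. -/
def devCLM (s : Coord n →L[ℝ] Coord n →L[ℝ] Coord n) (X : Coord n →L[ℝ] Coord n) :
    Coord n →L[ℝ] ℝ :=
  (traceCLM (Coord n)).comp (s.comp X) - (traceCLM (Coord n)).comp
    (((ContinuousLinearMap.compL ℝ (Coord n) (Coord n) (Coord n)).flip X).comp s)

theorem IsFrame.devCLM_apply {s : Coord n →L[ℝ] Coord n →L[ℝ] Coord n}
    {X : Coord n →L[ℝ] Coord n} {g : Coord n →L[ℝ] Coord n →L[ℝ] ℝ} {e : Fin n → Coord n}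
    (he : IsFrame g e) (hs : ∀ u v, s u v = s v u) (v : Coord n) :
    devCLM s X v = CurvatureEq.devForm s g X e v := by
  simp [devCLM, CurvatureEq.devForm, he.traceCLM_eq, Finset.sum_sub_distrib, hs v]

variable {D : Set (Coord n)} {g : Coord n → Coord n →L[ℝ] Coord n →L[ℝ] ℝ}
  {Γ : Coord n → Coord n →L[ℝ] Coord n →L[ℝ] Coord n}
  {T : Coord n → Coord n →L[ℝ] Coord n →L[ℝ] Coord n →L[ℝ] ℝ} {e : Coord n → Fin n → Coord n}
  {κ : ℝ}

theorem fderiv_eq_of_eqOn {F : Type*} [NormedAddCommGroup F] [NormedSpace ℝ F] {D : Set (Coord n)}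
    (hD : IsOpen D) {f h : Coord n → F} (heq : ∀ y ∈ D, f y = h y) {y : Coord n} (hy : y ∈ D) :
    fderiv ℝ f y = fderiv ℝ h y :=
  Filter.EventuallyEq.fderiv_eq (by filter_upwards [hD.mem_nhds hy] with z hz using heq z hz)

namespace LocalGeometry

/-- The product rule for the metric. -/
theorem fderiv_pair (hG : LocalGeometry D g Γ e) {f h : Coord n → Coord n} {y : Coord n}
    (hy : y ∈ D) (hf : DifferentiableAt ℝ f y) (hh : DifferentiableAt ℝ h y) (w : Coord n) :
    fderiv ℝ (fun z => g z (f z) (h z)) y w =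
      g y (fderiv ℝ f y w + Γ y w (f y)) (h y) + g y (f y) (fderiv ℝ h y w + Γ y w (h y)) := by
  have dg := ContDiffOn.differentiableAt_of_mem hG.smooth_g hG.isOpen hy
  rw [fderiv_clm_apply (dg.clm_apply hf) hh, fderiv_clm_apply dg hf]
  simp only [add_apply, ContinuousLinearMap.comp_apply, ContinuousLinearMap.flip_apply, map_add,
    hG.compat y hy]
  ring

theorem smooth_sField (hG : LocalGeometry D g Γ e) (hT : LocalStructure D T e) :
    ContDiffOn ℝ ∞ (sField g T e) D :=
  hG.smooth_s hT.smooth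

theorem smooth_xHat (hG : LocalGeometry D g Γ e) (hT : LocalStructure D T e) :
    ContDiffOn ℝ ∞ (xHat g Γ T e κ) D :=
  (hG.smooth_xField hT).add contDiffOn_const

theorem fderiv_xHat (hG : LocalGeometry D g Γ e) (hT : LocalStructure D T e) {y : Coord n}
    (hy : y ∈ D) : fderiv ℝ (xHat g Γ T e κ) y = fderiv ℝ (xField g Γ T e) y := by
  have dX := ContDiffOn.differentiableAt_of_mem (hG.smooth_xField hT) hG.isOpen hy
  change fderiv ℝ (fun y => xField g Γ T e y + κ • ContinuousLinearMap.id ℝ (Coord n)) y = _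
  rw [fderiv_add_const]

/-- The curvature of Γ + S is that of Γ plus the alternated ∇S plus the commutator of S with itself.
Constant curvature is of the same algebraic type as the term with X, with X a multiple of the
identity, so it is absorbed in X + κ. -/
theorem curvatureEq (hG : LocalGeometry D g Γ e) (hT : LocalStructure D T e) (hn : 2 ≤ n)
    (hL : JetsSurjective D g Γ T e) (hK : IsConstCurv D g Γ κ) {y : Coord n} (hy : y ∈ D) :
    CurvatureEq (g y) (sField g T e y) (covS Γ (sField g T e) y) (xHat g Γ T e κ y) where
  symm := (hG.frame y hy).symm
  s_comm := sTensor_comm hT hG hy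
  s_symm := hG.sTensor_symm hT hn hL hy
  N_symm z u v w := by
    have ds := ContDiffOn.differentiableAt_of_mem (hG.smooth_sField hT) hG.isOpen hy
    -- ∇S inherits the symmetries of S because the metric is parallel: the symmetry is
    -- differentiated and the connection terms are collected.
    have rot : ∀ x ∈ D, ∀ a b c, g x (sField g T e x a b) c = g x (sField g T e x c b) a :=
      fun x hx a b c => by
        have hc : ∀ a b, sField g T e x a b = sField g T e x b a := sTensor_comm hT hG hx
        rw [hc a b, hc c b]
        exact hG.sTensor_symm hT hn hL hx b a c
    have h := fderiv_eq_of_eqOn hG.isOpen (fun x hx => rot x hx u v w) hy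
    have hd : ∀ a b, DifferentiableAt ℝ (fun x => sField g T e x a b) y := fun a b =>
      (ds.clm_apply (differentiableAt_const a)).clm_apply (differentiableAt_const b)
    have h' := DFunLike.congr_fun h z
    rw [hG.fderiv_pair hy (hd u v) (differentiableAt_const w),
      hG.fderiv_pair hy (hd w v) (differentiableAt_const u), fderiv_clm_apply_const₂ ds,
      fderiv_clm_apply_const₂ ds] at h'
    simp only [fderiv_fun_const, Pi.zero_apply, zero_apply, zero_add, map_add, add_apply] at h'
    simp only [covS, map_add, map_sub, add_apply, sub_apply]
    rw [rot y hy (Γ y z u) v w, rot y hy (Γ y z w) v u, rot y hy u (Γ y z v) w]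
    linear_combination h'
  X_symm u v := by
    simp only [xHat, add_apply, smul_apply, map_add, map_smul, smul_eq_mul,
      ContinuousLinearMap.id_apply]
    rw [hG.xField_symm hT hn hL hy, (hG.frame y hy).symm u v]
  eq u v w := by
    have h := hG.flat hT hn hL hy u v w
    have hk := hK y hy u v w
    have ds := ContDiffOn.differentiableAt_of_mem (hG.smooth_sField hT) hG.isOpen hy
    have dΓ := ContDiffOn.differentiableAt_of_mem hG.smooth_Γ hG.isOpen hy
    have hc := sTensor_comm hT hG hy
    have hder : fderiv ℝ (connField g Γ T e) y = fderiv ℝ Γ y + fderiv ℝ (sField g T e) y :=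
      fderiv_add dΓ ds
    rw [hder] at h
    simp only [connField, curvForm, add_apply, map_add] at h hk
    simp only [covS, xHat, add_apply, smul_apply, ContinuousLinearMap.id_apply, sField] at h ⊢
    rw [hc u (Γ y w v), hc u (Γ y v w), hG.Γ_comm y hy w u, hG.Γ_comm y hy v u,
      hG.Γ_comm y hy w v, hG.Γ_comm y hy w, hG.Γ_comm y hy v (sTensor _ _ _ _ _)]
    linear_combination (norm := module) h - hk

theorem traceRelation (hG : LocalGeometry D g Γ e) (hT : LocalStructure D T e) {y : Coord n}
    (hy : y ∈ D) : TraceRelation (g y) (T y) (sField g T e y) (e y) where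
  symm := hT.symm y hy
  traceFree := hT.traceFree y hy
  eq := (hG.frame y hy).sTensor_pair

/-- The deviation form of `X`. -/
def _root_.SuperInt.devField (g : Coord n → Coord n →L[ℝ] Coord n →L[ℝ] ℝ)
    (Γ : Coord n → Coord n →L[ℝ] Coord n →L[ℝ] Coord n)
    (T : Coord n → Coord n →L[ℝ] Coord n →L[ℝ] Coord n →L[ℝ] ℝ) (e : Coord n → Fin n → Coord n)
    (κ : ℝ) (y : Coord n) : Coord n →L[ℝ] ℝ :=
  (1 / ((n : ℝ) - 1)) • devCLM (sField g T e y) (xHat g Γ T e κ y)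

theorem smooth_devField (hG : LocalGeometry D g Γ e) (hT : LocalStructure D T e) :
    ContDiffOn ℝ ∞ (devField g Γ T e κ) D := by
  have h1 := hG.smooth_sField hT
  have h2 : ContDiffOn ℝ ∞ (xHat g Γ T e κ) D := hG.smooth_xHat hT
  exact ((contDiffOn_const.clm_comp (h1.clm_comp h2)).sub (contDiffOn_const.clm_comp
    ((((ContinuousLinearMap.compL ℝ (Coord n) (Coord n)
      (Coord n)).flip).contDiff.comp_contDiffOn h2).clm_comp h1))).const_smul _

/-- X is Codazzi for Γ + S, so for Γ alone the defect is S(v, X w) - S(w, X v), the κ-terms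
cancelling. `CurvatureEq.deviation` shows that this defect is pure trace. -/
theorem xHat_deviation (hG : LocalGeometry D g Γ e) (hT : LocalStructure D T e) (hn : 2 ≤ n)
    (hL : JetsSurjective D g Γ T e) (hK : IsConstCurv D g Γ κ) {y : Coord n} (hy : y ∈ D)
    (v w : Coord n) :
    fderiv ℝ (xHat g Γ T e κ) y w v + Γ y w (xHat g Γ T e κ y v) -
      (fderiv ℝ (xHat g Γ T e κ) y v w + Γ y v (xHat g Γ T e κ y w)) =
    devField g Γ T e κ y w • v - devField g Γ T e κ y v • w := by
  have hn' : (2 : ℝ) ≤ n := by exact_mod_cast hn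
  have h1 : (n : ℝ) - 1 ≠ 0 := by linarith
  have H := hG.curvatureEq hT hn hL hK hy
  have he := hG.frame y hy
  have h := hG.xField_codazzi hT hn hL hy v w
  have hd : sField g T e y v (xHat g Γ T e κ y w) - sField g T e y w (xHat g Γ T e κ y v) =
      devField g Γ T e κ y w • v - devField g Γ T e κ y v • w := by
    refine he.ext fun a => ?_
    have := H.deviation he v w a
    have hdv := he.devCLM_apply (X := xHat g Γ T e κ y) H.s_comm
    rw [H.s_comm _ v, H.s_comm _ w, Fintype.card_fin] at this
    simp only [map_sub, map_smul, sub_apply, smul_apply, smul_eq_mul, devField]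
    rw [he.symm a w, he.symm a v] at this
    simp only [← hdv] at this
    field_simp
    linear_combination this
  rw [← hd, hG.fderiv_xHat hT hy]
  have hc := H.s_comm v w
  simp only [xHat, add_apply, smul_apply, ContinuousLinearMap.id_apply, map_add, map_smul,
    connField, sField] at h hc ⊢
  rw [hG.Γ_comm y hy w v, hc]
  linear_combination (norm := module) h

end LocalGeometry
end ConstantCurvature

end SuperInt
end

noncomputable section
set_option maxSynthPendingDepth 3

namespace SuperInt

/-! ### Closed forms and the Codazzi condition -/

section Closed

variable {n : ℕ}
variable {D : Set (Coord n)} {g : Coord n → Coord n →L[ℝ] Coord n →L[ℝ] ℝ}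
  {Γ : Coord n → Coord n →L[ℝ] Coord n →L[ℝ] Coord n}
  {T : Coord n → Coord n →L[ℝ] Coord n →L[ℝ] Coord n →L[ℝ] ℝ} {e : Coord n → Fin n → Coord n}
  {κ : ℝ}

namespace LocalGeometry

/-- A form that measures the deviation of a symmetric tensor from a Codazzi tensor is closed. -/
theorem closed_of_deviation (hG : LocalGeometry D g Γ e) (hn : 3 ≤ n) (hK : IsConstCurv D g Γ κ)
    {X : Coord n → Coord n →L[ℝ] Coord n} {η : Coord n → Coord n →L[ℝ] ℝ}
    (hX : ContDiffOn ℝ ∞ X D) (hη : ContDiffOn ℝ ∞ η D)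
    (hXs : ∀ y ∈ D, ∀ u v, g y (X y u) v = g y (X y v) u)
    (hdev : ∀ y ∈ D, ∀ v w, fderiv ℝ X y w v + Γ y w (X y v) -
      (fderiv ℝ X y v w + Γ y v (X y w)) = η y w • v - η y v • w) {y : Coord n} (hy : y ∈ D)
    (v w : Coord n) : fderiv ℝ η y v w = fderiv ℝ η y w v := by
  have hD := hG.isOpen
  have he := hG.frame y hy
  have dX := ContDiffOn.differentiableAt_of_mem hX hD hy
  have sX' := ContDiffOn.fderiv_infty hX hD
  have dX' := ContDiffOn.differentiableAt_of_mem sX' hD hy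
  have dΓ := ContDiffOn.differentiableAt_of_mem hG.smooth_Γ hD hy
  have dη := ContDiffOn.differentiableAt_of_mem hη hD hy
  have hc := hG.Γ_comm y hy
  have key : ∀ v w z, fderiv ℝ (fun x => fderiv ℝ X x w v + Γ x w (X x v)) y z =
      fderiv ℝ (fderiv ℝ X) y z w v + (fderiv ℝ Γ y z w (X y v) + Γ y w (fderiv ℝ X y z v)) := by
    intro v w z
    have d1 : DifferentiableAt ℝ (fun x => X x v) y := dX.clm_apply (differentiableAt_const v)
    have d2 : DifferentiableAt ℝ (fun x => Γ x w) y := dΓ.clm_apply (differentiableAt_const w)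
    rw [fderiv_fun_add ((dX'.clm_apply (differentiableAt_const w)).clm_apply
      (differentiableAt_const v)) (d2.clm_apply d1), add_apply, fderiv_clm_apply_const₂ dX',
      fderiv_clm_apply d2 d1]
    simp only [add_apply, ContinuousLinearMap.comp_apply, ContinuousLinearMap.flip_apply,
      fderiv_clm_apply_const dΓ, fderiv_clm_apply_const dX]
    abel
  have dP : ∀ v w, DifferentiableAt ℝ (fun x => fderiv ℝ X x w v + Γ x w (X x v)) y := fun v w =>
    ((dX'.clm_apply (differentiableAt_const w)).clm_apply (differentiableAt_const v)).add
      ((dΓ.clm_apply (differentiableAt_const w)).clm_apply (dX.clm_apply (differentiableAt_const v)))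
  have hder : ∀ v w z, fderiv ℝ (fderiv ℝ X) y z w v + (fderiv ℝ Γ y z w (X y v) +
      Γ y w (fderiv ℝ X y z v)) - (fderiv ℝ (fderiv ℝ X) y z v w + (fderiv ℝ Γ y z v (X y w) +
      Γ y v (fderiv ℝ X y z w))) = fderiv ℝ η y z w • v - fderiv ℝ η y z v • w := by
    intro v w z
    have h := DFunLike.congr_fun (fderiv_eq_of_eqOn hD (fun x hx => hdev x hx v w) hy) z
    have dw : ∀ w, DifferentiableAt ℝ (fun x => η x w) y := fun w =>
      dη.clm_apply (differentiableAt_const w)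
    rw [fderiv_fun_sub (dP v w) (dP w v), sub_apply, key, key, fderiv_fun_sub
      ((dw w).smul_const v) ((dw v).smul_const w), fderiv_smul_const (dw w),
      fderiv_smul_const (dw v), sub_apply] at h
    simpa [fderiv_clm_apply_const dη] using h
  -- The deviation equation is differentiated and summed cyclically. Second derivatives of X cancel,
  -- derivatives of Γ combine to curvature, and the curvature terms cancel since X is self-adjoint;
  -- only dη survives.
  have hcyc : ∀ v w z, (fderiv ℝ η y z w - fderiv ℝ η y w z) • v +
      (fderiv ℝ η y w v - fderiv ℝ η y v w) • z + (fderiv ℝ η y v z - fderiv ℝ η y z v) • w = 0 := by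
    intro v w z
    have hs : ∀ a b c, fderiv ℝ (fderiv ℝ X) y a b c = fderiv ℝ (fderiv ℝ X) y b a c :=
      fun a b c => by rw [fderiv_fderiv_symm hD hX hy]
    have hdΓ : ∀ a b c, fderiv ℝ Γ y a b c = fderiv ℝ Γ y a c b := by
      intro a b c
      have h := DFunLike.congr_fun (fderiv_eq_of_eqOn hD (fun x hx => hG.Γ_comm x hx b c) hy) a
      rwa [fderiv_clm_apply_const₂ dΓ, fderiv_clm_apply_const₂ dΓ] at h
    have K : ∀ a b c, fderiv ℝ Γ y b c a - fderiv ℝ Γ y c b a + Γ y b (Γ y c a) -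
        Γ y c (Γ y b a) = κ • (g y a c • b - g y a b • c) := by
      intro a b c
      have := hK y hy a c b
      rw [curvForm, hc (Γ y a c) b, hc (Γ y a b) c, hc a c, hc a b, hdΓ b a c, hdΓ c a b] at this
      exact this
    have k1 := K (X y v) z w
    have k2 := K (X y w) v z
    have k3 := K (X y z) w v
    have d1 := congrArg (Γ y z) (hdev y hy v w)
    have d2 := congrArg (Γ y w) (hdev y hy z v)
    have d3 := congrArg (Γ y v) (hdev y hy w z)
    simp only [map_sub, map_add, map_smul] at d1 d2 d3
    rw [hXs y hy w v] at k2
    rw [hXs y hy z v, hXs y hy z w] at k3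
    simp only [hc z v, hc z w, hc v w] at d1 d2 d3
    have h1 := hder v w z
    have h2 := hder z v w
    have h3 := hder w z v
    rw [hs z w v] at h1
    rw [hs z v w] at h1
    rw [hs w v z] at h2
    linear_combination (norm := module) -h1 - h2 - h3 + k1 + k2 + k3 - d1 - d2 - d3
  have hn' : (3 : ℝ) ≤ n := by exact_mod_cast hn
  -- The trace of the cyclic identity leaves n - 2 times dη, which is why dimension at least 3 is
  -- needed.
  have hsum := Finset.sum_eq_zero fun i (_ : i ∈ Finset.univ) =>
    (congrArg (fun a => g y (e y i) a) (hcyc (e y i) w v)).trans (map_zero _)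
  have q : ∀ a b, ∑ i, fderiv ℝ η y (e y i) a * g y (e y i) b = fderiv ℝ η y b a := fun a b => by
    have := he.sum_mul b ((fderiv ℝ η y).flip a)
    rw [ContinuousLinearMap.flip_apply] at this
    rw [← this]
    exact Finset.sum_congr rfl fun i _ => by rw [he.symm b, mul_comm]; rfl
  have p' : ∀ a b, ∑ i, fderiv ℝ η y a (e y i) * g y (e y i) b = fderiv ℝ η y a b := fun a b => by
    rw [← he.sum_mul b]
    exact Finset.sum_congr rfl fun i _ => by rw [he.symm b, mul_comm]
  simp only [map_add, map_smul, smul_eq_mul, Finset.sum_add_distrib, sub_mul,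
    Finset.sum_sub_distrib, p', q, ← Finset.mul_sum, he.sum_diag, Fintype.card_fin] at hsum
  have : ((n : ℝ) - 2) * (fderiv ℝ η y v w - fderiv ℝ η y w v) = 0 := by
    linear_combination hsum
  rcases mul_eq_zero.1 this with h | h <;> linarith

/-- The trace of a connection whose curvature is a Kulkarni–Nomizu product is closed. -/
theorem closed_trace (hG : LocalGeometry D g Γ e) {A : Coord n → Coord n →L[ℝ] Coord n →L[ℝ] Coord n}
    (hA : ContDiffOn ℝ ∞ A D) (hAc : ∀ y ∈ D, ∀ u v, A y u v = A y v u) {y : Coord n} (hy : y ∈ D)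
    {X : Coord n →L[ℝ] Coord n} (hX : ∀ u v, g y (X u) v = g y (X v) u)
    (hcurv : ∀ u v w, curvForm (A y) (fderiv ℝ A y) u v w + g y u v • X w - g y u w • X v = 0)
    (v w : Coord n) : fderiv ℝ (fun x => (traceCLM (Coord n)).comp (A x)) y v w =
      fderiv ℝ (fun x => (traceCLM (Coord n)).comp (A x)) y w v := by
  have dA := ContDiffOn.differentiableAt_of_mem hA hG.isOpen hy
  have hd : ∀ a b c, fderiv ℝ A y a b c = fderiv ℝ A y a c b := by
    intro a b c
    have h := DFunLike.congr_fun (fderiv_eq_of_eqOn hG.isOpen (fun x hx => hAc x hx b c) hy) a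
    rwa [fderiv_clm_apply_const₂ dA, fderiv_clm_apply_const₂ dA] at h
  have hc := hAc y hy
  -- The curvature equation read as an identity of endomorphisms in u. Under the trace the
  -- commutator disappears, and so does the X-term by self-adjointness.
  have h : fderiv ℝ A y w v - fderiv ℝ A y v w + ((A y w).comp (A y v) - (A y v).comp (A y w)) +
      (((g y).flip v).smulRight (X w) - ((g y).flip w).smulRight (X v)) = 0 := by
    ext1 u
    have := hcurv u v w
    rw [curvForm, hc (A y u v) w, hc (A y u w) v, hc u v, hc u w, hd w u v, hd v u w] at this
    simp only [add_apply, sub_apply, ContinuousLinearMap.comp_apply,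
      ContinuousLinearMap.smulRight_apply, ContinuousLinearMap.flip_apply, zero_apply]
    linear_combination (norm := module) this
  have h' := congrArg (traceCLM (Coord n)) h
  simp only [map_add, map_sub, traceCLM_smulRight, traceCLM_comp_comm (A y w), map_zero,
    ContinuousLinearMap.flip_apply, hX w v] at h'
  have e1 : ∀ a b, fderiv ℝ (fun x => (traceCLM (Coord n)).comp (A x)) y a b =
      traceCLM (Coord n) (fderiv ℝ A y a b) := by
    intro a b
    rw [fderiv_clm_comp (differentiableAt_const _) dA]
    simp
  rw [e1, e1]
  linear_combination -h'

/-- t is (n-1)/n times the difference of the traces of the connections Γ + S and Γ. `closed_trace`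
applies to both: to the first with X, to the second with -κ times the identity. -/
theorem closed_tau (hG : LocalGeometry D g Γ e) (hT : LocalStructure D T e) (hn : 2 ≤ n)
    (hL : JetsSurjective D g Γ T e) (hK : IsConstCurv D g Γ κ) {y : Coord n} (hy : y ∈ D)
    (v w : Coord n) : fderiv ℝ (fun x => tauCLM (T x) (e x)) y v w =
      fderiv ℝ (fun x => tauCLM (T x) (e x)) y w v := by
  have hn' : (2 : ℝ) ≤ n := by exact_mod_cast hn
  have h0 : (n : ℝ) ≠ 0 := by linarith
  have h1 : (n : ℝ) - 1 ≠ 0 := by linarith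
  have sA := hG.smooth_conn hT
  have c1 := hG.closed_trace sA (fun y hy => hG.connField_comm hT hy) hy
    (hG.xField_symm hT hn hL hy) (hG.flat hT hn hL hy) v w
  have c2 := hG.closed_trace hG.smooth_Γ hG.Γ_comm hy (X := -κ • ContinuousLinearMap.id ℝ (Coord n))
    (fun u v => by simp [(hG.frame y hy).symm u v]) (fun u v w => by
      rw [hK y hy]; simp only [smul_apply, ContinuousLinearMap.id_apply]; module) v w
  have dA : DifferentiableAt ℝ (fun x => (traceCLM (Coord n)).comp (connField g Γ T e x)) y :=
    (differentiableAt_const _).clm_comp (ContDiffOn.differentiableAt_of_mem sA hG.isOpen hy)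
  have dΓ : DifferentiableAt ℝ (fun x => (traceCLM (Coord n)).comp (Γ x)) y :=
    (differentiableAt_const _).clm_comp
      (ContDiffOn.differentiableAt_of_mem hG.smooth_Γ hG.isOpen hy)
  have heq : ∀ x ∈ D, tauCLM (T x) (e x) = (((n : ℝ) - 1) / n) •
      ((traceCLM (Coord n)).comp (connField g Γ T e x) - (traceCLM (Coord n)).comp (Γ x)) := by
    intro x hx
    ext u
    have h := (hG.traceRelation hT hx).trace_s (hG.frame x hx) (hG.sTensor_symm hT hn hL hx)
      (sTensor_comm hT hG hx) u
    rw [← (hG.frame x hx).traceCLM_eq, ← tauCLM_apply] at h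
    simp only [smul_apply, sub_apply, ContinuousLinearMap.comp_apply, connField, add_apply,
      map_add, smul_eq_mul]
    change traceCLM (Coord n) (sTensor (g x) (T x) (e x) u) = _ at h
    rw [h]
    field_simp
    ring
  rw [fderiv_eq_of_eqOn hG.isOpen heq hy, fderiv_fun_const_smul (dA.fun_sub dΓ), fderiv_fun_sub dA dΓ]
  simp only [smul_apply, sub_apply, c1, c2]

theorem closed_devField (hG : LocalGeometry D g Γ e) (hT : LocalStructure D T e) (hn : 3 ≤ n)
    (hL : JetsSurjective D g Γ T e) (hK : IsConstCurv D g Γ κ) {y : Coord n} (hy : y ∈ D)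
    (v w : Coord n) :
    fderiv ℝ (devField g Γ T e κ) y v w = fderiv ℝ (devField g Γ T e κ) y w v :=
  have hn' : 2 ≤ n := by omega
  hG.closed_of_deviation hn hK (hG.smooth_xHat hT) (hG.smooth_devField hT)
    (fun y hy => (hG.curvatureEq hT hn' hL hK hy).X_symm)
    (fun y hy => hG.xHat_deviation hT hn' hL hK hy) hy v w

/-- The covariant derivative `(∇_w A)(u, v)` of a field of bilinear forms. -/
def _root_.SuperInt.covB (Γ : Coord n → Coord n →L[ℝ] Coord n →L[ℝ] Coord n)
    (A : Coord n → Coord n →L[ℝ] Coord n →L[ℝ] ℝ) (y w u v : Coord n) : ℝ :=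
  fderiv ℝ A y w u v - A y (Γ y w u) v - A y u (Γ y w v)

/-- The tensor `a X + ψ g`. -/
def _root_.SuperInt.qField (g : Coord n → Coord n →L[ℝ] Coord n →L[ℝ] ℝ)
    (X : Coord n → Coord n →L[ℝ] Coord n) (a : ℝ) (ψ : Coord n → ℝ) (y : Coord n) :
    Coord n →L[ℝ] Coord n →L[ℝ] ℝ :=
  a • (g y).comp (X y) + ψ y • g y

theorem covB_qField (hG : LocalGeometry D g Γ e) {X : Coord n → Coord n →L[ℝ] Coord n}
    {ψ : Coord n → ℝ} (hX : ContDiffOn ℝ ∞ X D) (hψ : ContDiffOn ℝ ∞ ψ D) (a : ℝ) {y : Coord n}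
    (hy : y ∈ D) (w u v : Coord n) : covB Γ (qField g X a ψ) y w u v =
      a * g y (fderiv ℝ X y w u + Γ y w (X y u) - X y (Γ y w u)) v + fderiv ℝ ψ y w * g y u v := by
  have hD := hG.isOpen
  have dg := ContDiffOn.differentiableAt_of_mem hG.smooth_g hD hy
  have dX := ContDiffOn.differentiableAt_of_mem hX hD hy
  have dψ := ContDiffOn.differentiableAt_of_mem hψ hD hy
  have dq : DifferentiableAt ℝ (qField g X a ψ) y :=
    ((dg.clm_comp dX).const_smul a).add (dψ.smul dg)
  have dXu : DifferentiableAt ℝ (fun z => X z u) y := dX.clm_apply (differentiableAt_const u)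
  have dgX : DifferentiableAt ℝ (fun z => g z (X z u) v) y :=
    (dg.clm_apply dXu).clm_apply (differentiableAt_const v)
  have dguv : DifferentiableAt ℝ (fun z => g z u v) y :=
    (dg.clm_apply (differentiableAt_const u)).clm_apply (differentiableAt_const v)
  rw [covB, ← fderiv_clm_apply_const₂ dq]
  have e1 : (fun z => qField g X a ψ z u v) = fun z => a * g z (X z u) v + ψ z * g z u v := by
    funext z; simp [qField]
  rw [e1, fderiv_fun_add (dgX.const_mul a) (dψ.fun_mul dguv), fderiv_const_mul dgX,
    fderiv_fun_mul dψ dguv]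
  simp only [add_apply, smul_apply, smul_eq_mul, fderiv_clm_apply_const₂ dg,
    hG.fderiv_pair hy dXu (differentiableAt_const v), fderiv_clm_apply_const dX, hG.compat y hy,
    fderiv_fun_const, Pi.zero_apply, zero_apply, zero_add, qField, ContinuousLinearMap.comp_apply,
    map_add, map_sub, sub_apply]
  ring

/-- `a X + ψ g` is a Codazzi tensor if and only if `dψ` is a multiple of the deviation form. -/
theorem qField_codazzi_iff (hG : LocalGeometry D g Γ e) (hT : LocalStructure D T e) (hn : 2 ≤ n)
    (hL : JetsSurjective D g Γ T e) (hK : IsConstCurv D g Γ κ) {ψ : Coord n → ℝ}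
    (hψ : ContDiffOn ℝ ∞ ψ D) (a : ℝ) {y : Coord n} (hy : y ∈ D) :
    (∀ u v w, covB Γ (qField g (xHat g Γ T e κ) a ψ) y w u v =
      covB Γ (qField g (xHat g Γ T e κ) a ψ) y v u w) ↔
    ∀ w, fderiv ℝ ψ y w = -(a * devField g Γ T e κ y w) := by
  have he := hG.frame y hy
  have hn' : (2 : ℝ) ≤ n := by exact_mod_cast hn
  have H := fun x (hx : x ∈ D) => hG.curvatureEq hT hn hL hK hx
  have sX : ContDiffOn ℝ ∞ (xHat g Γ T e κ) D := hG.smooth_xHat hT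
  set X := xHat g Γ T e κ with hXdef
  have dX := ContDiffOn.differentiableAt_of_mem sX hG.isOpen hy
  have hsym : ∀ w u v, g y (fderiv ℝ X y w u + Γ y w (X y u) - X y (Γ y w u)) v =
      g y (fderiv ℝ X y w v + Γ y w (X y v) - X y (Γ y w v)) u := by
    intro w u v
    have h := DFunLike.congr_fun (fderiv_eq_of_eqOn hG.isOpen (fun x hx => (H x hx).X_symm u v) hy) w
    have dXu : ∀ u, DifferentiableAt ℝ (fun z => X z u) y :=
      fun u => dX.clm_apply (differentiableAt_const u)
    rw [hG.fderiv_pair hy (dXu u) (differentiableAt_const v),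
      hG.fderiv_pair hy (dXu v) (differentiableAt_const u)] at h
    simp only [fderiv_clm_apply_const dX, fderiv_fun_const, Pi.zero_apply, zero_apply, zero_add,
      map_add, add_apply, map_sub, sub_apply] at h ⊢
    rw [(H y hy).X_symm (Γ y w u) v, (H y hy).X_symm (Γ y w v) u]
    linear_combination h
  -- The alternated derivative is the product of g with the form dψ + a η, so it vanishes with that
  -- form; conversely a trace recovers the form with the factor n - 1.
  have key : ∀ u v w, covB Γ (qField g X a ψ) y w u v - covB Γ (qField g X a ψ) y v u w =
      (fderiv ℝ ψ y w + a * devField g Γ T e κ y w) * g y u v -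
      (fderiv ℝ ψ y v + a * devField g Γ T e κ y v) * g y u w := by
    intro u v w
    have h := congrArg (fun z => g y z u) (hG.xHat_deviation hT hn hL hK hy v w)
    rw [hG.covB_qField sX hψ a hy, hG.covB_qField sX hψ a hy, hsym w u v, hsym v u w]
    simp only [map_add, map_sub, map_smul, add_apply, sub_apply, smul_apply, smul_eq_mul,
      he.symm v u, he.symm w u] at h ⊢
    rw [hG.Γ_comm y hy w v]
    linear_combination a * h
  constructor
  · intro h w
    have hsum := Finset.sum_eq_zero fun i (_ : i ∈ Finset.univ) =>
      (key (e y i) (e y i) w).symm.trans (sub_eq_zero.2 (h (e y i) (e y i) w))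
    have hs := he.sum_mul w (fderiv ℝ ψ y + a • devField g Γ T e κ y)
    simp only [add_apply, smul_apply, smul_eq_mul, he.symm w] at hs
    simp only [Finset.sum_sub_distrib, ← Finset.mul_sum, he.sum_diag, Fintype.card_fin,
      mul_comm _ (g y (e y _) w), hs] at hsum
    have : ((n : ℝ) - 1) * (fderiv ℝ ψ y w + a * devField g Γ T e κ y w) = 0 := by
      linear_combination hsum
    rcases mul_eq_zero.1 this with h | h <;> linarith
  · intro h u v w
    rw [← sub_eq_zero, key, h, h]
    ring

end LocalGeometry
end Closed

end SuperInt
end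

noncomputable section
set_option maxSynthPendingDepth 3

namespace SuperInt

/-! ### Local potentials -/

section Potentials

variable {n : ℕ}
variable {D : Set (Coord n)} {g : Coord n → Coord n →L[ℝ] Coord n →L[ℝ] ℝ}
  {Γ : Coord n → Coord n →L[ℝ] Coord n →L[ℝ] Coord n}
  {e : Coord n → Fin n → Coord n} {κ : ℝ}

/-- The Poincaré lemma for forms of degree one. -/
theorem exists_primitive {η : Coord n → Coord n →L[ℝ] ℝ} (hD : IsOpen D) (hη : ContDiffOn ℝ ∞ η D)
    (hc : ∀ y ∈ D, ∀ v w, fderiv ℝ η y v w = fderiv ℝ η y w v) {x₀ : Coord n} (hx₀ : x₀ ∈ D) :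
    ∃ B : Set (Coord n), IsOpen B ∧ x₀ ∈ B ∧ B ⊆ D ∧ ∃ f : Coord n → ℝ, ContDiffOn ℝ ∞ f B ∧
      ∀ x ∈ B, HasFDerivAt f (η x) x := by
  obtain ⟨B, hB, hx, hBD, f, -, hf, hf'⟩ := exists_local_solution (F := ℝ) (θ := fun _ => 0) hD hx₀
    contDiffOn_const hη (fun x hx h k u => by
      rw [hc x hx k h]; simp) 0
  exact ⟨B, hB, hx, hBD, f, hf, fun x hx => by convert! hf' x hx using 1; ext; simp⟩

/-- The fibre of the system for the structure function `C`. -/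
abbrev FibreTwo (n : ℕ) : Type := ℝ × (Coord n →L[ℝ] ℝ)

/-- The coefficients of the system for the structure function `C`. -/
def thetaTwo (κ : ℝ) (G : Coord n →L[ℝ] Coord n →L[ℝ] Coord n)
    (g : Coord n →L[ℝ] Coord n →L[ℝ] ℝ) : Coord n →L[ℝ] FibreTwo n →L[ℝ] FibreTwo n :=
  LinearMap.toContinuousLinearMap (LinearMap.toContinuousLinearMap.toLinearMap ∘ₗ
    LinearMap.mk₂ ℝ (fun (h : Coord n) (p : FibreTwo n) =>
      ((p.2 h, p.2.comp (G h) - (κ * p.1) • g h) : FibreTwo n))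
    (fun a b c => Prod.ext (by simp) (by ext v; simp; ring))
    (fun r a b => Prod.ext (by simp) (by ext v; simp; ring))
    (fun a b c => Prod.ext (by simp) (by ext v; simp; ring))
    (fun r a b => Prod.ext (by simp) (by ext v; simp; ring)))

theorem thetaTwo_apply (κ : ℝ) (G : Coord n →L[ℝ] Coord n →L[ℝ] Coord n)
    (g : Coord n →L[ℝ] Coord n →L[ℝ] ℝ) (h : Coord n) (p : FibreTwo n) :
    thetaTwo κ G g h p = (p.2 h, p.2.comp (G h) - (κ * p.1) • g h) := rfl

/-- The dependence of `thetaTwo` on the connection and the metric. -/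
def thetaTwoLin (κ : ℝ) (h : Coord n) (p : FibreTwo n) :
    ((Coord n →L[ℝ] Coord n →L[ℝ] Coord n) × (Coord n →L[ℝ] Coord n →L[ℝ] ℝ)) →L[ℝ]
      FibreTwo n :=
  LinearMap.toContinuousLinearMap
    { toFun := fun q => (0, p.2.comp (q.1 h) - (κ * p.1) • q.2 h)
      map_add' := fun a b => Prod.ext (by simp) (by ext v; simp; ring)
      map_smul' := fun r a => Prod.ext (by simp) (by ext v; simp; ring) }

theorem thetaTwoLin_apply (κ : ℝ) (h : Coord n) (p : FibreTwo n)
    (q : (Coord n →L[ℝ] Coord n →L[ℝ] Coord n) × (Coord n →L[ℝ] Coord n →L[ℝ] ℝ)) :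
    thetaTwoLin κ h p q = (0, p.2.comp (q.1 h) - (κ * p.1) • q.2 h) := rfl

theorem fderiv_swap {F : Type*} [NormedAddCommGroup F] [NormedSpace ℝ F] (hD : IsOpen D)
    {A : Coord n → Coord n →L[ℝ] Coord n →L[ℝ] F} (hA : ContDiffOn ℝ ∞ A D)
    (hs : ∀ y ∈ D, ∀ u v, A y u v = A y v u) {y : Coord n} (hy : y ∈ D) (a b c : Coord n) :
    fderiv ℝ A y a b c = fderiv ℝ A y a c b := by
  have dA := ContDiffOn.differentiableAt_of_mem hA hD hy
  have h := DFunLike.congr_fun (fderiv_eq_of_eqOn hD (fun x hx => hs x hx b c) hy) a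
  rwa [fderiv_clm_apply_const₂ dA, fderiv_clm_apply_const₂ dA] at h

/-- The coefficients of both linear systems below are affine in the pair (Γ, g); their derivative is
therefore the linear part applied to the derivatives of Γ and g. -/
theorem fderiv_apply_of_affine {F G : Type*} [NormedAddCommGroup F] [NormedSpace ℝ F]
    [NormedAddCommGroup G] [NormedSpace ℝ G] {θ : Coord n → Coord n →L[ℝ] F →L[ℝ] F} {y : Coord n}
    (hθ : DifferentiableAt ℝ θ y) {q : Coord n → G} (hq : DifferentiableAt ℝ q y) {h : Coord n}
    {p c : F} {L : G →L[ℝ] F} (heq : ∀ y, θ y h p = c + L (q y)) (k : Coord n) :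
    fderiv ℝ θ y k h p = L (fderiv ℝ q y k) := by
  rw [← fderiv_clm_apply_const hθ, ← fderiv_clm_apply_const
    (hθ.clm_apply (differentiableAt_const h))]
  simp only [heq]
  rw [fderiv_const_add]
  exact DFunLike.congr_fun (L.hasFDerivAt.comp y hq.hasFDerivAt).fderiv k

theorem contDiffOn_of_affine {F G : Type*} [NormedAddCommGroup F] [NormedSpace ℝ F]
    [NormedAddCommGroup G] [NormedSpace ℝ G] [FiniteDimensional ℝ F]
    {θ : Coord n → Coord n →L[ℝ] F →L[ℝ] F} {q : Coord n → G} (hq : ContDiffOn ℝ ∞ q D)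
    {c : Coord n → F → F} {L : Coord n → F → G →L[ℝ] F}
    (heq : ∀ h p y, θ y h p = c h p + L h p (q y)) : ContDiffOn ℝ ∞ θ D :=
  contDiffOn_clm_apply.2 fun h => contDiffOn_clm_apply.2 fun p => by
    simp only [heq]
    exact contDiffOn_const.add ((L h p).contDiff.comp_contDiffOn hq)

theorem thetaTwo_eq (G : Coord n →L[ℝ] Coord n →L[ℝ] Coord n)
    (g : Coord n →L[ℝ] Coord n →L[ℝ] ℝ) (h : Coord n) (p : FibreTwo n) :
    thetaTwo κ G g h p = ((p.2 h, 0) : FibreTwo n) + thetaTwoLin κ h p (G, g) := by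
  simp [thetaTwo_apply, thetaTwoLin_apply]

/-- The inhomogeneity of the system for the structure function `C`. -/
def srcTwo (Q : Coord n →L[ℝ] Coord n →L[ℝ] ℝ) : Coord n →L[ℝ] FibreTwo n :=
  (ContinuousLinearMap.inr ℝ ℝ (Coord n →L[ℝ] ℝ)).comp Q

theorem srcTwo_apply (Q : Coord n →L[ℝ] Coord n →L[ℝ] ℝ) (h : Coord n) :
    srcTwo Q h = (0, Q h) := rfl

namespace LocalGeometry

theorem fderiv_pair_apply (hG : LocalGeometry D g Γ e) {y : Coord n} (hy : y ∈ D) (k : Coord n) :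
    fderiv ℝ (fun y => (Γ y, g y)) y k = (fderiv ℝ Γ y k, fderiv ℝ g y k) := by
  have dΓ := ContDiffOn.differentiableAt_of_mem hG.smooth_Γ hG.isOpen hy
  have dg := ContDiffOn.differentiableAt_of_mem hG.smooth_g hG.isOpen hy
  rw [(dΓ.hasFDerivAt.prodMk dg.hasFDerivAt).fderiv]
  rfl

/-- The Ricci identity for a space of constant curvature. -/
theorem constCurv_apply (hG : LocalGeometry D g Γ e) (hK : IsConstCurv D g Γ κ) {y : Coord n}
    (hy : y ∈ D) (v h k : Coord n) : fderiv ℝ Γ y k h v + Γ y k (Γ y h v) -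
      (fderiv ℝ Γ y h k v + Γ y h (Γ y k v)) = κ • (g y v h • k - g y v k • h) := by
  have hc := hG.Γ_comm y hy
  have hd := fun a b c => fderiv_swap hG.isOpen hG.smooth_Γ hG.Γ_comm hy a b c
  have hR := hK y hy v h k
  rw [curvForm, hc (Γ y v h) k, hc (Γ y v k) h, hc v h, hc v k, hd k v h, hd h v k] at hR
  rw [← hR]
  abel

/-- Integrability of dC = β, ∇β = Q - κ C g. The first component is the symmetry of Γ, g and Q. In
the second the Ricci identity for β cancels the derivative of κ C g, and the source is handled by
the Codazzi equation of Q. -/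
theorem flatTwo (hG : LocalGeometry D g Γ e) (hK : IsConstCurv D g Γ κ)
    {Q : Coord n → Coord n →L[ℝ] Coord n →L[ℝ] ℝ} (hQ : ContDiffOn ℝ ∞ Q D)
    (hQs : ∀ y ∈ D, ∀ u v, Q y u v = Q y v u)
    (hQc : ∀ y ∈ D, ∀ u v w, covB Γ Q y w u v = covB Γ Q y v u w) {y : Coord n} (hy : y ∈ D)
    (h k : Coord n) (p : FibreTwo n) :
    thetaTwoLin κ h p (fderiv ℝ Γ y k, fderiv ℝ g y k) + srcTwo (fderiv ℝ Q y k) h +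
      thetaTwo κ (Γ y) (g y) h (thetaTwo κ (Γ y) (g y) k p + srcTwo (Q y) k) =
    thetaTwoLin κ k p (fderiv ℝ Γ y h, fderiv ℝ g y h) + srcTwo (fderiv ℝ Q y h) k +
      thetaTwo κ (Γ y) (g y) k (thetaTwo κ (Γ y) (g y) h p + srcTwo (Q y) h) := by
  have hc := hG.Γ_comm y hy k h
  have hs := (hG.frame y hy).symm
  simp only [thetaTwo_apply, thetaTwoLin_apply, srcTwo_apply]
  refine Prod.ext ?_ (ContinuousLinearMap.ext fun v => ?_)
  · simp [hc, hs k h, hQs y hy k h]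
  · have hcod := hQc y hy v h k
    have hR := congrArg p.2 (hG.constCurv_apply hK hy v h k)
    simp only [map_add, map_sub, map_smul, smul_eq_mul] at hR
    have hd := fun a b c => fderiv_swap hG.isOpen hQ hQs hy a b c
    rw [covB, covB, hQs y hy (Γ y k v) h, hQs y hy (Γ y h v) k, hd k v h, hd h v k, hc] at hcod
    simp only [Prod.snd_add, add_apply, sub_apply, smul_apply, smul_eq_mul,
      ContinuousLinearMap.comp_apply, Prod.fst_add, hG.compat y hy]
    rw [hc]
    rw [hs v h, hs v k] at hR
    linear_combination hR + hcod

theorem exists_potentialTwo (hG : LocalGeometry D g Γ e) (hK : IsConstCurv D g Γ κ)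
    {Q : Coord n → Coord n →L[ℝ] Coord n →L[ℝ] ℝ} (hQ : ContDiffOn ℝ ∞ Q D)
    (hQs : ∀ y ∈ D, ∀ u v, Q y u v = Q y v u)
    (hQc : ∀ y ∈ D, ∀ u v w, covB Γ Q y w u v = covB Γ Q y v u w) {x₀ : Coord n} (hx₀ : x₀ ∈ D) :
    ∃ B : Set (Coord n), IsOpen B ∧ x₀ ∈ B ∧ B ⊆ D ∧ ∃ C : Coord n → ℝ, ContDiffOn ℝ ∞ C B ∧
      ∀ y ∈ B, ∀ u v, fderiv ℝ (fderiv ℝ C) y u v - fderiv ℝ C y (Γ y u v) =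
        Q y u v - κ * C y * g y u v := by
  have hD := hG.isOpen
  have sθ : ContDiffOn ℝ ∞ (fun y => thetaTwo κ (Γ y) (g y)) D :=
    contDiffOn_of_affine (hG.smooth_Γ.prodMk hG.smooth_g) fun h p y => thetaTwo_eq _ _ h p
  have sb : ContDiffOn ℝ ∞ (fun y => srcTwo (Q y)) D := contDiffOn_const.clm_comp hQ
  have dθ : ∀ y ∈ D, ∀ k h p, fderiv ℝ (fun y => thetaTwo κ (Γ y) (g y)) y k h p =
      thetaTwoLin κ h p (fderiv ℝ Γ y k, fderiv ℝ g y k) := by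
    intro y hy k h p
    rw [← hG.fderiv_pair_apply hy]
    exact fderiv_apply_of_affine (ContDiffOn.differentiableAt_of_mem sθ hD hy)
      (ContDiffOn.differentiableAt_of_mem (hG.smooth_Γ.prodMk hG.smooth_g) hD hy)
      (fun y => thetaTwo_eq _ _ h p) k
  have db : ∀ y ∈ D, ∀ k h, fderiv ℝ (fun y => srcTwo (Q y)) y k h = srcTwo (fderiv ℝ Q y k) h := by
    intro y hy k h
    simp only [srcTwo]
    rw [fderiv_clm_comp (differentiableAt_const _)
      (ContDiffOn.differentiableAt_of_mem hQ hD hy)]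
    simp
  obtain ⟨B, hB, hx, hBD, p, -, hp, hp'⟩ := exists_local_solution (F := FibreTwo n) hD hx₀ sθ sb
    (fun y hy h k p => by
      rw [dθ y hy, dθ y hy, db y hy, db y hy]
      exact hG.flatTwo hK hQ hQs hQc hy h k p) 0
  have h1 : ∀ y ∈ B, HasFDerivAt (fun y => (p y).1) (p y).2 y := fun y hy => by
    convert! (hp' y hy).fst using 1
    ext v
    simp [srcTwo_apply, thetaTwo_apply]
  refine ⟨B, hB, hx, hBD, fun y => (p y).1, contDiff_fst.comp_contDiffOn hp, fun y hy u v => ?_⟩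
  have h2 : fderiv ℝ (fderiv ℝ fun y => (p y).1) y = fderiv ℝ (fun y => (p y).2) y :=
    fderiv_eq_of_eqOn hB (fun z hz => (h1 z hz).fderiv) hy
  rw [h2, (hp' y hy).snd.fderiv, (h1 y hy).fderiv]
  simp [srcTwo_apply, thetaTwo_apply]
  ring

end LocalGeometry
end Potentials

end SuperInt
end

noncomputable section
set_option maxSynthPendingDepth 3

namespace SuperInt

/-! ### The system for the structure function `B` -/

section PotentialThree

variable {n : ℕ}
variable {D : Set (Coord n)} {g : Coord n → Coord n →L[ℝ] Coord n →L[ℝ] ℝ}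
  {Γ : Coord n → Coord n →L[ℝ] Coord n →L[ℝ] Coord n}
  {e : Coord n → Fin n → Coord n} {κ : ℝ}

/-- The covariant derivative `(∇_z b)(u, v, w)` of a field of trilinear forms. -/
def covT (Γ : Coord n → Coord n →L[ℝ] Coord n →L[ℝ] Coord n)
    (b : Coord n → Coord n →L[ℝ] Coord n →L[ℝ] Coord n →L[ℝ] ℝ) (y z u v w : Coord n) : ℝ :=
  fderiv ℝ b y z u v w - b y (Γ y z u) v w - b y u (Γ y z v) w - b y u v (Γ y z w)

/-- The fibre of the system for the structure function `B`. -/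
abbrev FibreThree (n : ℕ) : Type :=
  ℝ × (Coord n →L[ℝ] ℝ) × (Coord n →L[ℝ] Coord n →L[ℝ] ℝ)

/-- The symmetric part of a bilinear form. -/
def symPart (γ : Coord n →L[ℝ] Coord n →L[ℝ] ℝ) : Coord n →L[ℝ] Coord n →L[ℝ] ℝ :=
  (1 / 2 : ℝ) • (γ + γ.flip)

theorem symPart_apply (γ : Coord n →L[ℝ] Coord n →L[ℝ] ℝ) (u v : Coord n) :
    symPart γ u v = 1 / 2 * (γ u v + γ v u) := by
  simp [symPart]
  ring

theorem symPart_symm (γ : Coord n →L[ℝ] Coord n →L[ℝ] ℝ) (u v : Coord n) :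
    symPart γ u v = symPart γ v u := by
  rw [symPart_apply, symPart_apply, add_comm]

theorem symPart_eq_self {γ : Coord n →L[ℝ] Coord n →L[ℝ] ℝ} (h : ∀ u v, γ u v = γ v u) :
    symPart γ = γ := by
  ext u v
  rw [symPart_apply, h v u]
  ring

/-- The last component of the system for the structure function `B`. -/
def thirdPart (κ : ℝ) (G : Coord n →L[ℝ] Coord n) (g : Coord n →L[ℝ] Coord n →L[ℝ] ℝ)
    (h : Coord n) (β : Coord n →L[ℝ] ℝ) (γ : Coord n →L[ℝ] Coord n →L[ℝ] ℝ) :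
    Coord n →L[ℝ] Coord n →L[ℝ] ℝ :=
  (symPart γ).comp G + ((symPart γ).comp G).flip -
    κ • ((2 * β h) • g + β.smulRight (g h) + (g h).smulRight β)

/-- The weights 2, 1, 1 of the κ-terms are forced. Their alternation in h and u or v reproduces the
Ricci identity for β; their sum 4 is the constant in the definition of the potential, which cancels
them after symmetrisation. -/
theorem thirdPart_apply (G : Coord n →L[ℝ] Coord n) (g : Coord n →L[ℝ] Coord n →L[ℝ] ℝ)
    (h : Coord n) (β : Coord n →L[ℝ] ℝ) (γ : Coord n →L[ℝ] Coord n →L[ℝ] ℝ) (u v : Coord n) :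
    thirdPart κ G g h β γ u v = symPart γ (G u) v + symPart γ (G v) u -
      κ * (2 * β h * g u v + β u * g h v + g h u * β v) := by
  simp [thirdPart]
  ring

/-- The coefficients of the system for the structure function `B`. -/
def thetaThree (κ : ℝ) (G : Coord n →L[ℝ] Coord n →L[ℝ] Coord n)
    (g : Coord n →L[ℝ] Coord n →L[ℝ] ℝ) : Coord n →L[ℝ] FibreThree n →L[ℝ] FibreThree n :=
  LinearMap.toContinuousLinearMap (LinearMap.toContinuousLinearMap.toLinearMap ∘ₗ
    LinearMap.mk₂ ℝ (fun (h : Coord n) (p : FibreThree n) =>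
      ((p.2.1 h, p.2.1.comp (G h) + symPart p.2.2 h,
        thirdPart κ (G h) g h p.2.1 p.2.2) : FibreThree n))
    (fun a b c => Prod.ext (by simp) (Prod.ext (by ext v; simp; abel)
      (by ext u v; simp [thirdPart_apply]; ring)))
    (fun r a b => Prod.ext (by simp) (Prod.ext (by ext v; simp)
      (by ext u v; simp [thirdPart_apply]; ring)))
    (fun a b c => Prod.ext (by simp) (Prod.ext (by ext v; simp [symPart_apply]; ring)
      (by ext u v; simp [thirdPart_apply, symPart_apply]; ring)))
    (fun r a b => Prod.ext (by simp) (Prod.ext (by ext v; simp [symPart_apply]; ring)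
      (by ext u v; simp [thirdPart_apply, symPart_apply]; ring))))

theorem thetaThree_apply (G : Coord n →L[ℝ] Coord n →L[ℝ] Coord n)
    (g : Coord n →L[ℝ] Coord n →L[ℝ] ℝ) (h : Coord n) (p : FibreThree n) :
    thetaThree κ G g h p = (p.2.1 h, p.2.1.comp (G h) + symPart p.2.2 h,
      thirdPart κ (G h) g h p.2.1 p.2.2) := rfl

/-- The dependence of `thetaThree` on the connection and the metric. -/
def thetaThreeLin (κ : ℝ) (h : Coord n) (p : FibreThree n) :
    ((Coord n →L[ℝ] Coord n →L[ℝ] Coord n) × (Coord n →L[ℝ] Coord n →L[ℝ] ℝ)) →L[ℝ]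
      FibreThree n :=
  LinearMap.toContinuousLinearMap
    { toFun := fun q => (0, p.2.1.comp (q.1 h), thirdPart κ (q.1 h) q.2 h p.2.1 p.2.2)
      map_add' := fun a b => Prod.ext (by simp) (Prod.ext (by ext v; simp)
        (by ext u v; simp [thirdPart_apply]; ring))
      map_smul' := fun r a => Prod.ext (by simp) (Prod.ext (by ext v; simp)
        (by ext u v; simp [thirdPart_apply]; ring)) }

theorem thetaThreeLin_apply (h : Coord n) (p : FibreThree n)
    (q : (Coord n →L[ℝ] Coord n →L[ℝ] Coord n) × (Coord n →L[ℝ] Coord n →L[ℝ] ℝ)) :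
    thetaThreeLin κ h p q =
      (0, p.2.1.comp (q.1 h), thirdPart κ (q.1 h) q.2 h p.2.1 p.2.2) := rfl

theorem thetaThree_eq (G : Coord n →L[ℝ] Coord n →L[ℝ] Coord n)
    (g : Coord n →L[ℝ] Coord n →L[ℝ] ℝ) (h : Coord n) (p : FibreThree n) :
    thetaThree κ G g h p =
      ((p.2.1 h, symPart p.2.2 h, 0) : FibreThree n) + thetaThreeLin κ h p (G, g) := by
  simp [thetaThree_apply, thetaThreeLin_apply, add_comm]

/-- The inhomogeneity of the system for the structure function `B`. -/
def srcThree (b : Coord n →L[ℝ] Coord n →L[ℝ] Coord n →L[ℝ] ℝ) : Coord n →L[ℝ] FibreThree n :=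
  ((ContinuousLinearMap.inr ℝ ℝ _).comp (ContinuousLinearMap.inr ℝ (Coord n →L[ℝ] ℝ) _)).comp b

theorem srcThree_apply (b : Coord n →L[ℝ] Coord n →L[ℝ] Coord n →L[ℝ] ℝ) (h : Coord n) :
    srcThree b h = (0, 0, b h) := rfl

namespace LocalGeometry

/-- The Codazzi equation in the shape in which it enters the integrability condition: the argument
of differentiation is interchanged with the first argument of b. -/
theorem codazzi_rotate (hG : LocalGeometry D g Γ e)
    {b : Coord n → Coord n →L[ℝ] Coord n →L[ℝ] Coord n →L[ℝ] ℝ} (hb : ContDiffOn ℝ ∞ b D)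
    (hb1 : ∀ y ∈ D, ∀ u v w, b y u v w = b y v u w)
    (hb2 : ∀ y ∈ D, ∀ u v w, b y u v w = b y u w v)
    (hbc : ∀ y ∈ D, ∀ u v w z, covT Γ b y z u v w = covT Γ b y w u v z) {y : Coord n} (hy : y ∈ D)
    (u v h k : Coord n) :
    fderiv ℝ b y k h u v + b y k (Γ y h u) v + b y k (Γ y h v) u =
      fderiv ℝ b y h k u v + b y h (Γ y k u) v + b y h (Γ y k v) u := by
  have hD := hG.isOpen
  have db := ContDiffOn.differentiableAt_of_mem hb hD hy
  have hd1 : ∀ a u v w, fderiv ℝ b y a u v w = fderiv ℝ b y a v u w := fun a u v w => by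
    rw [fderiv_swap hD hb (fun y hy u v => by ext w; exact hb1 y hy u v w) hy a u v]
  have hd2 : ∀ a u v w, fderiv ℝ b y a u v w = fderiv ℝ b y a u w v := fun a u v w => by
    have hbu : ContDiffOn ℝ ∞ (fun y => b y u) D := hb.clm_apply contDiffOn_const
    have := fderiv_swap hD hbu (fun y hy v w => hb2 y hy u v w) hy a v w
    rwa [fderiv_clm_apply_const db] at this
  have r : ∀ a c d, b y a c d = b y d a c := fun a c d => by rw [hb2 y hy, hb1 y hy]
  have hcod := hbc y hy u v h k
  rw [covT, covT, r _ v h, r u _ h, hb2 y hy h u, r _ v k, r u _ k, hb2 y hy k u,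
    hG.Γ_comm y hy k h, hd2 k u v h, hd1 k u h v, hd2 h u v k, hd1 h u k v] at hcod
  linear_combination hcod

set_option maxHeartbeats 1000000 in
-- The first component is the symmetry of Γ and of the Hessian. The second is the Ricci identity for
-- β, matched by the κ-terms. The third is the Ricci identity for both arguments of the Hessian
-- together with the Codazzi equation for b.
theorem flatThree (hG : LocalGeometry D g Γ e) (hK : IsConstCurv D g Γ κ)
    {b : Coord n → Coord n →L[ℝ] Coord n →L[ℝ] Coord n →L[ℝ] ℝ} (hb : ContDiffOn ℝ ∞ b D)
    (hb1 : ∀ y ∈ D, ∀ u v w, b y u v w = b y v u w)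
    (hb2 : ∀ y ∈ D, ∀ u v w, b y u v w = b y u w v)
    (hbc : ∀ y ∈ D, ∀ u v w z, covT Γ b y z u v w = covT Γ b y w u v z) {y : Coord n} (hy : y ∈ D)
    (h k : Coord n) (p : FibreThree n) :
    thetaThreeLin κ h p (fderiv ℝ Γ y k, fderiv ℝ g y k) + srcThree (fderiv ℝ b y k) h +
      thetaThree κ (Γ y) (g y) h (thetaThree κ (Γ y) (g y) k p + srcThree (b y) k) =
    thetaThreeLin κ k p (fderiv ℝ Γ y h, fderiv ℝ g y h) + srcThree (fderiv ℝ b y h) k +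
      thetaThree κ (Γ y) (g y) k (thetaThree κ (Γ y) (g y) h p + srcThree (b y) h) := by
  have hc := hG.Γ_comm y hy k h
  have hs := (hG.frame y hy).symm
  have hγ := symPart_symm p.2.2
  have hR := hG.constCurv_apply hK hy
  -- The fibre contains all bilinear forms, but the right-hand side of the last equation is
  -- symmetric, so the symmetric part may be dropped after one iteration.
  have hsym : ∀ k, symPart (thirdPart κ (Γ y k) (g y) k p.2.1 p.2.2 + b y k) =
      thirdPart κ (Γ y k) (g y) k p.2.1 p.2.2 + b y k := fun k =>
    symPart_eq_self fun u v => by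
      rw [add_apply, add_apply, add_apply, add_apply, thirdPart_apply, thirdPart_apply,
        hb2 y hy k u v, hs u v]
      ring
  simp only [thetaThree_apply, thetaThreeLin_apply, srcThree_apply, Prod.mk_add_mk, add_zero,
    zero_add, hsym, Prod.mk.injEq]
  refine ⟨?_, ContinuousLinearMap.ext fun v => ?_,
    ContinuousLinearMap.ext fun u => ContinuousLinearMap.ext fun v => ?_⟩
  · simp [hc, hγ k h]
  · have hR' := congrArg p.2.1 (hR v h k)
    simp only [map_add, map_sub, map_smul, smul_eq_mul] at hR'
    simp only [add_apply, ContinuousLinearMap.comp_apply, thirdPart_apply]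
    rw [hc, hγ (Γ y k v) h, hγ (Γ y h v) k, hb1 y hy k h v, hs k h]
    rw [hs v h, hs v k] at hR'
    linear_combination hR'
  · have hRu := congrArg (fun a => symPart p.2.2 a v) (hR u h k)
    have hRv := congrArg (fun a => symPart p.2.2 a u) (hR v h k)
    simp only [map_add, map_sub, map_smul, smul_eq_mul, add_apply, sub_apply, smul_apply]
      at hRu hRv
    have hcod := hG.codazzi_rotate hb hb1 hb2 hbc hy u v h k
    simp only [add_apply, ContinuousLinearMap.comp_apply, thirdPart_apply, hG.compat y hy, hsym]
    rw [hs u h, hs u k] at hRu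
    rw [hs v h, hs v k] at hRv
    rw [hc, hγ k h, hs (Γ y h v) u, hs (Γ y k v) u, hγ (Γ y h v) (Γ y k u),
      hγ (Γ y h u) (Γ y k v)]
    linear_combination hRu + hRv + hcod

theorem smooth_thetaThree (hG : LocalGeometry D g Γ e) :
    ContDiffOn ℝ ∞ (fun y => thetaThree κ (Γ y) (g y)) D :=
  contDiffOn_of_affine (q := fun y => (Γ y, g y)) (L := thetaThreeLin κ)
    (c := fun h p => (p.2.1 h, symPart p.2.2 h, 0)) (hG.smooth_Γ.prodMk hG.smooth_g)
    fun h p y => thetaThree_eq (Γ y) (g y) h p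

theorem fderiv_thetaThree (hG : LocalGeometry D g Γ e) {y : Coord n} (hy : y ∈ D) (k h : Coord n)
    (p : FibreThree n) : fderiv ℝ (fun y => thetaThree κ (Γ y) (g y)) y k h p =
      thetaThreeLin κ h p (fderiv ℝ Γ y k, fderiv ℝ g y k) := by
  rw [← hG.fderiv_pair_apply hy]
  exact fderiv_apply_of_affine (q := fun y => (Γ y, g y)) (L := thetaThreeLin κ h p)
    (c := (p.2.1 h, symPart p.2.2 h, 0))
    (ContDiffOn.differentiableAt_of_mem hG.smooth_thetaThree hG.isOpen hy)
    (ContDiffOn.differentiableAt_of_mem (hG.smooth_Γ.prodMk hG.smooth_g) hG.isOpen hy)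
    (fun y => thetaThree_eq (Γ y) (g y) h p) k

theorem _root_.SuperInt.smooth_srcThree {b : Coord n → Coord n →L[ℝ] Coord n →L[ℝ] Coord n →L[ℝ] ℝ}
    (hb : ContDiffOn ℝ ∞ b D) : ContDiffOn ℝ ∞ (fun y => srcThree (b y)) D :=
  contDiffOn_const.clm_comp hb

theorem _root_.SuperInt.fderiv_srcThree
    {b : Coord n → Coord n →L[ℝ] Coord n →L[ℝ] Coord n →L[ℝ] ℝ} {y : Coord n}
    (hb : DifferentiableAt ℝ b y) (k h : Coord n) :
    fderiv ℝ (fun y => srcThree (b y)) y k h = srcThree (fderiv ℝ b y k) h := by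
  simp only [srcThree]
  rw [fderiv_clm_comp (differentiableAt_const _) hb]
  simp

set_option maxHeartbeats 1000000 in
theorem exists_solutionThree (hG : LocalGeometry D g Γ e) (hK : IsConstCurv D g Γ κ)
    {b : Coord n → Coord n →L[ℝ] Coord n →L[ℝ] Coord n →L[ℝ] ℝ} (hb : ContDiffOn ℝ ∞ b D)
    (hb1 : ∀ y ∈ D, ∀ u v w, b y u v w = b y v u w)
    (hb2 : ∀ y ∈ D, ∀ u v w, b y u v w = b y u w v)
    (hbc : ∀ y ∈ D, ∀ u v w z, covT Γ b y z u v w = covT Γ b y w u v z)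
    {x₀ : Coord n} (hx₀ : x₀ ∈ D) :
    ∃ B : Set (Coord n), IsOpen B ∧ x₀ ∈ B ∧ B ⊆ D ∧ ∃ p : Coord n → FibreThree n,
      ContDiffOn ℝ ∞ p B ∧ ∀ y ∈ B,
        HasFDerivAt p ((thetaThree κ (Γ y) (g y)).flip (p y) + srcThree (b y)) y := by
  obtain ⟨B, hB, hx, hBD, p, -, hp, hp'⟩ := exists_local_solution (F := FibreThree n)
    (θ := fun y => thetaThree κ (Γ y) (g y)) (b := fun y => srcThree (b y)) hG.isOpen hx₀
    hG.smooth_thetaThree (smooth_srcThree hb)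
    (fun y hy h k p => by
      have db := ContDiffOn.differentiableAt_of_mem hb hG.isOpen hy
      exact (congrArg (· + _) (congrArg₂ (· + ·) (hG.fderiv_thetaThree hy k h p)
        (fderiv_srcThree db k h))).trans ((hG.flatThree hK hb hb1 hb2 hbc hy h k p).trans
        (congrArg (· + _) (congrArg₂ (· + ·) (hG.fderiv_thetaThree hy h k p)
          (fderiv_srcThree db h k))).symm)) 0
  exact ⟨B, hB, hx, hBD, p, hp, hp'⟩

/-- The equations see only the symmetric part of the last component, so this part is taken for the
Hessian H. Since the last right-hand side is symmetric, H satisfies the same equation. -/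
theorem exists_potentialThree (hG : LocalGeometry D g Γ e) (hK : IsConstCurv D g Γ κ)
    {b : Coord n → Coord n →L[ℝ] Coord n →L[ℝ] Coord n →L[ℝ] ℝ} (hb : ContDiffOn ℝ ∞ b D)
    (hb1 : ∀ y ∈ D, ∀ u v w, b y u v w = b y v u w)
    (hb2 : ∀ y ∈ D, ∀ u v w, b y u v w = b y u w v)
    (hbc : ∀ y ∈ D, ∀ u v w z, covT Γ b y z u v w = covT Γ b y w u v z)
    {x₀ : Coord n} (hx₀ : x₀ ∈ D) :
    ∃ B : Set (Coord n), IsOpen B ∧ x₀ ∈ B ∧ B ⊆ D ∧ ∃ f : Coord n → ℝ, ContDiffOn ℝ ∞ f B ∧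
      ∃ H : Coord n → Coord n →L[ℝ] Coord n →L[ℝ] ℝ, ContDiffOn ℝ ∞ H B ∧
      (∀ y ∈ B, ∀ u v, fderiv ℝ (fderiv ℝ f) y u v - fderiv ℝ f y (Γ y u v) = H y u v) ∧
      ∀ y ∈ B, ∀ u v w, covB Γ H y w u v = b y u v w - κ * (2 * fderiv ℝ f y w * g y u v +
        fderiv ℝ f y u * g y w v + g y w u * fderiv ℝ f y v) := by
  obtain ⟨B, hB, hx, hBD, p, hp, hp'⟩ := hG.exists_solutionThree hK hb hb1 hb2 hbc hx₀
  have h1 : ∀ y ∈ B, HasFDerivAt (fun y => (p y).1) (p y).2.1 y := fun y hy => by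
    convert! (hp' y hy).fst using 1
    ext v
    simp [srcThree_apply, thetaThree_apply]
  have hf : ∀ y ∈ B, fderiv ℝ (fun y => (p y).1) y = (p y).2.1 := fun y hy => (h1 y hy).fderiv
  have s2 : ContDiffOn ℝ ∞ (fun y => (p y).2.2) B :=
    contDiff_snd.comp_contDiffOn (contDiff_snd.comp_contDiffOn hp)
  have sH : ContDiffOn ℝ ∞ (fun y => symPart (p y).2.2) B := by
    refine contDiffOn_clm_apply₂ fun u v => ?_
    simp only [symPart_apply]
    exact contDiffOn_const.mul (((s2.clm_apply contDiffOn_const).clm_apply contDiffOn_const).add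
      ((s2.clm_apply contDiffOn_const).clm_apply contDiffOn_const))
  refine ⟨B, hB, hx, hBD, fun y => (p y).1, contDiff_fst.comp_contDiffOn hp,
    fun y => symPart (p y).2.2, sH, fun y hy u v => ?_, fun y hy u v w => ?_⟩
  · rw [fderiv_eq_of_eqOn hB hf hy, (hp' y hy).snd.fst.fderiv, hf y hy]
    simp [srcThree_apply, thetaThree_apply]
  · have dH := ContDiffOn.differentiableAt_of_mem sH hB hy
    have d2 := ContDiffOn.differentiableAt_of_mem s2 hB hy
    have hs := (hG.frame y (hBD hy)).symm
    have h2 : ∀ u v, fderiv ℝ (fun y => (p y).2.2) y w u v =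
        thirdPart κ (Γ y w) (g y) w (p y).2.1 (p y).2.2 u v + b y w u v := by
      intro u v
      rw [(hp' y hy).snd.snd.fderiv]
      simp [srcThree_apply, thetaThree_apply]
    have d3 : ∀ u v, DifferentiableAt ℝ (fun y => (p y).2.2 u v) y := fun u v =>
      (d2.clm_apply (differentiableAt_const u)).clm_apply (differentiableAt_const v)
    have h3 : fderiv ℝ (fun y => symPart (p y).2.2) y w u v =
        1 / 2 * (fderiv ℝ (fun y => (p y).2.2) y w u v + fderiv ℝ (fun y => (p y).2.2) y w v u) := by
      rw [← fderiv_clm_apply_const₂ dH]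
      simp only [symPart_apply]
      rw [fderiv_const_mul ((d3 u v).fun_add (d3 v u)), fderiv_fun_add (d3 u v) (d3 v u)]
      simp only [smul_apply, add_apply, smul_eq_mul, fderiv_clm_apply_const₂ d2]
    rw [covB, h3, h2, h2, thirdPart_apply, thirdPart_apply, hf y hy, hs v u,
      symPart_symm _ u (Γ y w v), hb2 y (hBD hy) w v u, hb1 y (hBD hy) w u v,
      hb2 y (hBD hy) u w v]
    ring

end LocalGeometry
end PotentialThree

end SuperInt
end

noncomputable section
set_option maxSynthPendingDepth 3

namespace SuperInt

/-! ### The tensors `C` and `B` in terms of a frame -/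

section StructureTensors

variable {n : ℕ}
variable {D : Set (Coord n)} {g : Coord n → Coord n →L[ℝ] Coord n →L[ℝ] ℝ}
  {Γ : Coord n → Coord n →L[ℝ] Coord n →L[ℝ] Coord n}
  {T : Coord n → Coord n →L[ℝ] Coord n →L[ℝ] Coord n →L[ℝ] ℝ} {e : Coord n → Fin n → Coord n}
  {κ : ℝ}

/-- The coefficient of the metric in the tensor `Z`. -/
def zPhi (g : Coord n → Coord n →L[ℝ] Coord n →L[ℝ] ℝ)
    (Γ : Coord n → Coord n →L[ℝ] Coord n →L[ℝ] Coord n)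
    (T : Coord n → Coord n →L[ℝ] Coord n →L[ℝ] Coord n →L[ℝ] ℝ) (e : Coord n → Fin n → Coord n)
    (κ : ℝ) (y : Coord n) : ℝ :=
  1 / 2 * traceCLM (Coord n) (xHat g Γ T e κ y) +
    n * (((n : ℝ) / (((n : ℝ) + 2) * ((n : ℝ) - 1))) ^ 2 *
      tauCLM (T y) (e y) (sharp (e y) (tauCLM (T y) (e y)))) - ((n : ℝ) - 1) * κ

/-- The tensor `B` in terms of the form `β = dC`. -/
def bCLM (g : Coord n →L[ℝ] Coord n →L[ℝ] ℝ) (s : Coord n →L[ℝ] Coord n →L[ℝ] Coord n)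
    (β : Coord n →L[ℝ] ℝ) : Coord n →L[ℝ] Coord n →L[ℝ] Coord n →L[ℝ] ℝ :=
  (LinearMap.mk₂ ℝ (fun u v : Coord n => g (s u v) +
    (1 / ((n : ℝ) - 2)) • (g u v • β + β u • g v + β v • g u))
    (fun a b c => by simp only [map_add, add_apply]; module)
    (fun r a b => by simp only [map_smul, smul_apply, smul_eq_mul]; module)
    (fun a b c => by simp only [map_add]; module)
    (fun r a b => by simp only [map_smul, smul_eq_mul]; module)).toContinuousBilinearMap

theorem bCLM_apply (g : Coord n →L[ℝ] Coord n →L[ℝ] ℝ) (s : Coord n →L[ℝ] Coord n →L[ℝ] Coord n)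
    (β : Coord n →L[ℝ] ℝ) (u v w : Coord n) : bCLM g s β u v w = g (s u v) w +
      1 / ((n : ℝ) - 2) * (g u v * β w + β u * g v w + β v * g u w) := rfl

namespace LocalGeometry

theorem smooth_zPhi (hG : LocalGeometry D g Γ e) (hT : LocalStructure D T e) :
    ContDiffOn ℝ ∞ (zPhi g Γ T e κ) D := by
  have h1 := hG.smooth_tau hT.smooth
  exact ((contDiffOn_const.mul ((traceCLM (Coord n)).contDiff.comp_contDiffOn
    (hG.smooth_xHat hT))).add (contDiffOn_const.mul (contDiffOn_const.mul
      (h1.clm_apply (hG.smooth_sharp.clm_apply h1))))).sub contDiffOn_const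

/-- Here t̄ is rewritten through the smooth form t, so that the coefficient of g in Z becomes a
smooth function of the point. -/
theorem zForm_eq_qField (hG : LocalGeometry D g Γ e) (hT : LocalStructure D T e) (hn : 2 ≤ n)
    (hL : JetsSurjective D g Γ T e) (hK : IsConstCurv D g Γ κ) (Φ : Coord n → ℝ) {y : Coord n}
    (hy : y ∈ D) (u v : Coord n) : zForm κ (g y) (T y) (e y) u v + Φ y * g y u v =
      qField g (xHat g Γ T e κ) (((n : ℝ) - 2) / 2) (fun y => zPhi g Γ T e κ y + Φ y) y u v := by
  have hn' : (2 : ℝ) ≤ n := by exact_mod_cast hn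
  have h0 : (n : ℝ) ≠ 0 := by linarith
  have h1 : (n : ℝ) - 1 ≠ 0 := by linarith
  have h2 : (n : ℝ) + 2 ≠ 0 := by linarith
  have he := hG.frame y hy
  have hR := hG.traceRelation hT hy
  have hbar : ∀ u, barForm (T y) (e y) u = (n : ℝ) / (((n : ℝ) + 2) * ((n : ℝ) - 1)) *
      tauCLM (T y) (e y) u := fun u => by
    rw [tauCLM_apply, hR.tauForm_eq hn]
    field_simp
  have hvec : barVec (T y) (e y) = ((n : ℝ) / (((n : ℝ) + 2) * ((n : ℝ) - 1))) •
      sharp (e y) (tauCLM (T y) (e y)) := by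
    rw [barVec, sharp_apply, Finset.smul_sum]
    exact Finset.sum_congr rfl fun i _ => by rw [hbar, smul_smul]
  rw [zForm_eq (hG.curvatureEq hT hn hL hK hy) he hR hn, ← he.traceCLM_eq, hvec]
  simp only [map_smul, smul_apply, smul_eq_mul, he.apply_sharp, qField, add_apply,
    ContinuousLinearMap.comp_apply, zPhi]
  ring

theorem bCLM_symm (hG : LocalGeometry D g Γ e) (hT : LocalStructure D T e) (hn : 2 ≤ n)
    (hL : JetsSurjective D g Γ T e) {y : Coord n} (hy : y ∈ D) (β : Coord n →L[ℝ] ℝ)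
    (u v w : Coord n) : bCLM (g y) (sField g T e y) β u v w = bCLM (g y) (sField g T e y) β v u w ∧
      bCLM (g y) (sField g T e y) β u v w = bCLM (g y) (sField g T e y) β u w v := by
  have hs := (hG.frame y hy).symm
  have h1 := hG.sTensor_symm hT hn hL hy u v w
  have h2 := sTensor_comm hT hG hy u v
  simp only [bCLM_apply, sField]
  exact ⟨by linear_combination congrArg (fun a => g y a w) h2 + 1 / ((n : ℝ) - 2) * β w * hs u v,
    by linear_combination h1 + 1 / ((n : ℝ) - 2) * β u * hs v w⟩

theorem smooth_bCLM (hG : LocalGeometry D g Γ e) (hT : LocalStructure D T e)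
    {β : Coord n → Coord n →L[ℝ] ℝ} (hβ : ContDiffOn ℝ ∞ β D) :
    ContDiffOn ℝ ∞ (fun y => bCLM (g y) (sField g T e y) (β y)) D := by
  refine contDiffOn_clm_apply₂ fun u v => contDiffOn_clm_apply.2 fun w => ?_
  simp only [bCLM_apply]
  have hg := hG.smooth_g
  have hguv : ∀ u v : Coord n, ContDiffOn ℝ ∞ (fun y => g y u v) D := fun u v =>
    (hg.clm_apply contDiffOn_const).clm_apply contDiffOn_const
  have hβu : ∀ u, ContDiffOn ℝ ∞ (fun y => β y u) D := fun u => hβ.clm_apply contDiffOn_const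
  have hs := hG.smooth_sField hT
  exact ((hg.clm_apply ((hs.clm_apply contDiffOn_const).clm_apply contDiffOn_const)).clm_apply
    contDiffOn_const).add (contDiffOn_const.mul ((((hguv u v).mul (hβu w)).add
      ((hβu u).mul (hguv v w))).add ((hβu v).mul (hguv u w))))

theorem covT_bCLM (hG : LocalGeometry D g Γ e) (hT : LocalStructure D T e)
    {β : Coord n → Coord n →L[ℝ] ℝ} (hβ : ContDiffOn ℝ ∞ β D) {y : Coord n} (hy : y ∈ D)
    (z u v w : Coord n) : covT Γ (fun y => bCLM (g y) (sField g T e y) (β y)) y z u v w =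
      g y (covS Γ (sField g T e) y z u v) w + 1 / ((n : ℝ) - 2) *
        (g y u v * (fderiv ℝ β y z w - β y (Γ y z w)) +
          g y v w * (fderiv ℝ β y z u - β y (Γ y z u)) +
          g y u w * (fderiv ℝ β y z v - β y (Γ y z v))) := by
  have hD := hG.isOpen
  have hb := hG.smooth_bCLM hT hβ
  have db := ContDiffOn.differentiableAt_of_mem hb hD hy
  have dg := ContDiffOn.differentiableAt_of_mem hG.smooth_g hD hy
  have dβ := ContDiffOn.differentiableAt_of_mem hβ hD hy
  have ds := ContDiffOn.differentiableAt_of_mem (hG.smooth_sField hT) hD hy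
  have dsu : DifferentiableAt ℝ (fun y => sField g T e y u v) y :=
    (ds.clm_apply (differentiableAt_const u)).clm_apply (differentiableAt_const v)
  have dgu : ∀ u v : Coord n, DifferentiableAt ℝ (fun y => g y u v) y := fun u v =>
    (dg.clm_apply (differentiableAt_const u)).clm_apply (differentiableAt_const v)
  have dβu : ∀ u, DifferentiableAt ℝ (fun y => β y u) y := fun u =>
    dβ.clm_apply (differentiableAt_const u)
  have hsu : DifferentiableAt ℝ (fun y => g y (sField g T e y u v) w) y :=
    (dg.clm_apply dsu).clm_apply (differentiableAt_const w)
  have e1 : fderiv ℝ (fun y => bCLM (g y) (sField g T e y) (β y)) y z u v w =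
      fderiv ℝ (fun y => bCLM (g y) (sField g T e y) (β y) u v w) y z := by
    rw [fderiv_clm_apply_const ((db.clm_apply (differentiableAt_const u)).clm_apply
      (differentiableAt_const v)), fderiv_clm_apply_const₂ db]
  rw [covT, e1]
  simp only [bCLM_apply]
  rw [fderiv_fun_add hsu ((((dgu u v).fun_mul (dβu w)).fun_add ((dβu u).fun_mul
      (dgu v w))).fun_add ((dβu v).fun_mul (dgu u w)) |>.const_mul _),
    fderiv_const_mul ((((dgu u v).fun_mul (dβu w)).fun_add ((dβu u).fun_mul
      (dgu v w))).fun_add ((dβu v).fun_mul (dgu u w))),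
    fderiv_fun_add (((dgu u v).fun_mul (dβu w)).fun_add ((dβu u).fun_mul (dgu v w)))
      ((dβu v).fun_mul (dgu u w)),
    fderiv_fun_add ((dgu u v).fun_mul (dβu w)) ((dβu u).fun_mul (dgu v w)),
    fderiv_fun_mul (dgu u v) (dβu w), fderiv_fun_mul (dβu u) (dgu v w),
    fderiv_fun_mul (dβu v) (dgu u w)]
  simp only [add_apply, smul_apply, smul_eq_mul, fderiv_clm_apply_const₂ dg,
    fderiv_clm_apply_const dβ, hG.fderiv_pair hy dsu (differentiableAt_const w),
    fderiv_clm_apply_const₂ ds, hG.compat y hy, fderiv_fun_const, Pi.zero_apply, zero_apply,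
    zero_add, covS, map_add, map_sub, sub_apply]
  ring

/-- The tensor `B` is a Codazzi tensor. -/
theorem bCLM_codazzi (hG : LocalGeometry D g Γ e) (hT : LocalStructure D T e) (hn : 3 ≤ n)
    (hL : JetsSurjective D g Γ T e) (hK : IsConstCurv D g Γ κ)
    {β : Coord n → Coord n →L[ℝ] ℝ} (hβ : ContDiffOn ℝ ∞ β D) {ψ : Coord n → ℝ} {y : Coord n}
    (hy : y ∈ D) (hH : ∀ z w, fderiv ℝ β y z w - β y (Γ y z w) =
      ((n : ℝ) - 2) / 2 * g y (xHat g Γ T e κ y z) w + ψ y * g y z w) (u v w z : Coord n) :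
    covT Γ (fun y => bCLM (g y) (sField g T e y) (β y)) y z u v w =
      covT Γ (fun y => bCLM (g y) (sField g T e y) (β y)) y w u v z := by
  have hn' : (3 : ℝ) ≤ n := by exact_mod_cast hn
  have h2 : (n : ℝ) - 2 ≠ 0 := by linarith
  have H := hG.curvatureEq hT (by omega) hL hK hy
  have hs := H.symm
  have hc : ∀ z u v, covS Γ (sField g T e) y z u v = covS Γ (sField g T e) y z v u := by
    intro z u v
    have := fderiv_swap hG.isOpen (hG.smooth_sField hT) (fun y hy => sTensor_comm hT hG hy) hy z u v
    rw [covS, covS, this, H.s_comm u v, H.s_comm _ v, H.s_comm u]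
    abel
  have hN : ∀ z u v w, g y (covS Γ (sField g T e) y z u v) w =
      g y (covS Γ (sField g T e) y z u w) v := by
    intro z u v w
    rw [hc z u v, H.N_symm, hc z w u]
  have hsym := H.sym u z w v
  rw [hN w u z v, hN z u w v] at hsym
  rw [hG.covT_bCLM hT hβ hy, hG.covT_bCLM hT hβ hy]
  simp only [hH]
  -- The coefficient 1/(n-2) of the correction term in B meets the factor (n-2)/2 of X in the
  -- Hessian of C. The product 1/2 is what `CurvatureEq.sym` requires.
  have hck : 1 / ((n : ℝ) - 2) * (((n : ℝ) - 2) / 2) = 1 / 2 := by field_simp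
  linear_combination (-1 / 2) * hsym + (g y v w * g y (xHat g Γ T e κ y z) u +
    g y u w * g y (xHat g Γ T e κ y z) v - g y v z * g y (xHat g Γ T e κ y w) u -
    g y u z * g y (xHat g Γ T e κ y w) v) * hck + 1 / ((n : ℝ) - 2) * (((n : ℝ) - 2) / 2) *
    g y u v * H.X_symm z w + 1 / ((n : ℝ) - 2) * ψ y * (g y u v * hs z w + g y v w * hs z u +
      g y u w * hs z v - g y v z * hs w u - g y u z * hs w v)

end LocalGeometry
end StructureTensors

end SuperInt
end

noncomputable section
set_option maxSynthPendingDepth 3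

namespace SuperInt

/-! ### Frames, the Levi-Civita connection and tensor components -/

section Components

variable {n : ℕ}

/-- A scalar product admits a frame. -/
theorem exists_isFrame (g : Coord n →L[ℝ] Coord n →L[ℝ] ℝ) (hs : ∀ u v, g u v = g v u)
    (hp : ∀ u, u ≠ 0 → 0 < g u u) : ∃ e : Fin n → Coord n, IsFrame g e := by
  let B : LinearMap.BilinForm ℝ (Coord n) :=
    LinearMap.mk₂ ℝ (fun u v => g u v) (by simp) (by simp) (by simp) (by simp)
  have hB : LinearMap.IsSymm B := ⟨fun u v => hs u v⟩
  obtain ⟨v, hv⟩ := LinearMap.BilinForm.exists_orthogonal_basis hB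
  have hcard : Module.finrank ℝ (Coord n) = n := by simp
  set w : Module.Basis (Fin n) ℝ (Coord n) := v.reindex (finCongr hcard) with hw
  have ho : ∀ i j, i ≠ j → g (w i) (w j) = 0 := fun i j hij => by
    have := LinearMap.isOrthoᵢ_def.1 hv ((finCongr hcard).symm i) ((finCongr hcard).symm j)
      (by simpa using hij)
    simpa [hw, B] using this
  have hpos : ∀ i, 0 < g (w i) (w i) := fun i => hp _ (w.ne_zero i)
  have hg : ∀ u i, g u (w i) = w.repr u i * g (w i) (w i) := by
    intro u i
    conv_lhs => rw [← w.sum_repr u]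
    simp only [map_sum, map_smul, sum_apply, smul_apply, smul_eq_mul]
    rw [Finset.sum_eq_single i (fun j _ hj => by rw [ho j i hj, mul_zero]) (by simp)]
  have hsq : ∀ i, (√(g (w i) (w i)))⁻¹ * (√(g (w i) (w i)))⁻¹ = (g (w i) (w i))⁻¹ := fun i => by
    rw [← mul_inv, Real.mul_self_sqrt (hpos i).le]
  refine ⟨fun i => (√(g (w i) (w i)))⁻¹ • w i, hs, fun u => ?_, ?_⟩
  · conv_rhs => rw [← w.sum_repr u]
    refine Finset.sum_congr rfl fun i _ => ?_
    rw [map_smul, smul_smul, smul_eq_mul]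
    congr 1
    rw [mul_right_comm, hsq, hg u i]
    field_simp [(hpos i).ne']
  · simp only [map_smul, smul_apply, smul_eq_mul, ← mul_assoc, hsq]
    simp [inv_mul_cancel₀ (hpos _).ne']

/-- The Christoffel symbols of the first kind. -/
def koszul (d : Coord n →L[ℝ] Coord n →L[ℝ] Coord n →L[ℝ] ℝ) :
    Coord n →L[ℝ] Coord n →L[ℝ] Coord n →L[ℝ] ℝ :=
  (LinearMap.mk₂ ℝ (fun u v : Coord n => (1 / 2 : ℝ) • (d u v + d v u - (d.flip u).flip v))
    (fun a b c => by ext; simp; ring) (fun r a b => by ext; simp; ring)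
    (fun a b c => by ext; simp; ring) (fun r a b => by ext; simp; ring)).toContinuousBilinearMap

theorem koszul_apply (d : Coord n →L[ℝ] Coord n →L[ℝ] Coord n →L[ℝ] ℝ) (u v w : Coord n) :
    koszul d u v w = 1 / 2 * (d u v w + d v u w - d w u v) := rfl

/-- The Levi-Civita connection. -/
def leviCivita (g : Coord n → Coord n →L[ℝ] Coord n →L[ℝ] ℝ) (e : Coord n → Fin n → Coord n)
    (y : Coord n) : Coord n →L[ℝ] Coord n →L[ℝ] Coord n :=
  ((ContinuousLinearMap.compL ℝ (Coord n) (Coord n →L[ℝ] ℝ) (Coord n)) (sharp (e y))).comp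
    (koszul (fderiv ℝ g y))

theorem leviCivita_apply (g : Coord n → Coord n →L[ℝ] Coord n →L[ℝ] ℝ)
    (e : Coord n → Fin n → Coord n) (y u v : Coord n) :
    leviCivita g e y u v = sharp (e y) (koszul (fderiv ℝ g y) u v) := rfl

/-- The completeness relation of the frame, read in coordinates: ∑ e_i ⊗ e_i is the inverse of the
Gram matrix. -/
theorem IsFrame.mul_eq_one {g : Coord n →L[ℝ] Coord n →L[ℝ] ℝ} {e : Fin n → Coord n}
    (he : IsFrame g e) {G : Matrix (Fin n) (Fin n) ℝ}
    (hG : ∀ i j, G i j = g (EuclideanSpace.single i 1) (EuclideanSpace.single j 1)) :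
    (Matrix.of fun a b => ∑ i, e i a * e i b) * G = 1 := by
  ext a b
  have h1 : ∀ i, g (e i) (EuclideanSpace.single b 1) =
      ∑ c, e i c * g (EuclideanSpace.single c 1) (EuclideanSpace.single b 1) := fun i => by
    conv_lhs => rw [coord_eq_sum (e i)]
    simp
  have h2 := congrArg (fun u : Coord n => u a) (he.sum_smul (EuclideanSpace.single b 1))
  simp only [WithLp.ofLp_sum, Finset.sum_apply, PiLp.smul_apply, smul_eq_mul, he.symm _ (e _), h1]
    at h2
  simp only [Matrix.mul_apply, Matrix.of_apply, hG, Finset.sum_mul]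
  rw [Finset.sum_comm, Matrix.one_apply]
  simp only [Finset.sum_mul] at h2
  rw [PiLp.single_apply] at h2
  rw [← h2]
  exact Finset.sum_congr rfl fun i _ => Finset.sum_congr rfl fun c _ => by ring

theorem IsFrame.inv_eq {g : Coord n →L[ℝ] Coord n →L[ℝ] ℝ} {e : Fin n → Coord n}
    (he : IsFrame g e) {G : Matrix (Fin n) (Fin n) ℝ}
    (hG : ∀ i j, G i j = g (EuclideanSpace.single i 1) (EuclideanSpace.single j 1)) (a b : Fin n) :
    G⁻¹ a b = ∑ i, e i a * e i b := by
  rw [Matrix.inv_eq_left_inv (he.mul_eq_one hG), Matrix.of_apply]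

theorem contDiffOn_det {ι : Type*} [Fintype ι] [DecidableEq ι] {D : Set (Coord n)}
    {A : Coord n → Matrix ι ι ℝ} (hA : ∀ i j, ContDiffOn ℝ ∞ (fun y => A y i j) D) :
    ContDiffOn ℝ ∞ (fun y => (A y).det) D := by
  simp only [Matrix.det_apply]
  exact ContDiffOn.sum fun σ _ => (contDiffOn_prod fun i _ => hA _ _).const_smul _

theorem contDiffOn_inv {D : Set (Coord n)}
    {A : Coord n → Matrix (Fin n) (Fin n) ℝ} (hA : ∀ i j, ContDiffOn ℝ ∞ (fun y => A y i j) D)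
    (hdet : ∀ y ∈ D, (A y).det ≠ 0) (i j : Fin n) : ContDiffOn ℝ ∞ (fun y => (A y)⁻¹ i j) D := by
  simp only [Matrix.inv_def, Ring.inverse_eq_inv', Matrix.smul_apply, smul_eq_mul,
    Matrix.adjugate_apply]
  refine ((contDiffOn_det hA).inv hdet).mul (contDiffOn_det fun k l => ?_)
  simp only [Matrix.updateRow_apply]
  split_ifs
  · exact contDiffOn_const
  · exact hA k l

/-- No smooth frame is constructed: the inverse metric is smooth by Cramer's rule, and the Koszul
formula with the index raised by it gives the connection. -/
theorem localGeometry {D : Set (Coord n)} (hD : IsOpen D)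
    {g : Coord n → Coord n →L[ℝ] Coord n →L[ℝ] ℝ} (hg : ContDiffOn ℝ ∞ g D)
    {e : Coord n → Fin n → Coord n} (he : ∀ y ∈ D, IsFrame (g y) (e y)) :
    LocalGeometry D g (leviCivita g e) e := by
  have hsf : ∀ a b, ContDiffOn ℝ ∞ (fun y => ∑ i, e y i a * e y i b) D := by
    intro a b
    let G : Coord n → Matrix (Fin n) (Fin n) ℝ := fun y => Matrix.of fun i j =>
      g y (EuclideanSpace.single i 1) (EuclideanSpace.single j 1)
    have hG : ∀ i j, ContDiffOn ℝ ∞ (fun y => G y i j) D := fun i j =>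
      (hg.clm_apply contDiffOn_const).clm_apply contDiffOn_const
    have hinv : ∀ y ∈ D, ∀ a b, (G y)⁻¹ a b = ∑ i, e y i a * e y i b := fun y hy =>
      (he y hy).inv_eq fun i j => rfl
    refine (contDiffOn_inv hG (fun y hy h0 => ?_) a b).congr fun y hy => (hinv y hy a b).symm
    have := congrArg Matrix.det ((he y hy).mul_eq_one (G := G y) fun i j => rfl)
    rw [Matrix.det_mul, h0, mul_zero, Matrix.det_one] at this
    exact zero_ne_one this
  have hd : ∀ y ∈ D, ∀ w u v, fderiv ℝ g y w u v = fderiv ℝ g y w v u := fun y hy =>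
    fderiv_swap hD hg (fun y hy => (he y hy).symm) hy
  have hsharp : ContDiffOn ℝ ∞ (fun y => sharp (e y)) D :=
    smooth_sharp_of_frame hsf
  have hk : ContDiffOn ℝ ∞ (fun y => koszul (fderiv ℝ g y)) D := by
    have h1 := ContDiffOn.fderiv_infty hg hD
    have h2 : ∀ u v w : Coord n, ContDiffOn ℝ ∞ (fun y => fderiv ℝ g y u v w) D := fun u v w =>
      ((h1.clm_apply contDiffOn_const).clm_apply contDiffOn_const).clm_apply contDiffOn_const
    refine contDiffOn_clm_apply₂ fun u v => contDiffOn_clm_apply.2 fun w => ?_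
    simp only [koszul_apply]
    exact contDiffOn_const.mul (((h2 _ _ _).add (h2 _ _ _)).sub (h2 _ _ _))
  refine ⟨hD, hg, ?_, fun y hy u v => ?_, fun y hy u v w => ?_, he, hsf⟩
  · exact ((ContinuousLinearMap.compL ℝ (Coord n) (Coord n →L[ℝ] ℝ)
      (Coord n)).contDiff.comp_contDiffOn hsharp).clm_comp hk
  · rw [leviCivita_apply, leviCivita_apply]
    congr 1
    ext w
    rw [koszul_apply, koszul_apply, hd y hy w u v]
    ring
  · rw [leviCivita_apply, leviCivita_apply, (he y hy).apply_sharp, (he y hy).symm u,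
      (he y hy).apply_sharp, koszul_apply, koszul_apply, hd y hy w v u, hd y hy u w v,
      hd y hy v w u]
    ring

end Components

end SuperInt
end

noncomputable section
set_option maxSynthPendingDepth 3

namespace SuperInt

/-! ### Components with respect to the coordinate vectors -/

section Bridge

variable {n : ℕ}

local notation "ε" i:max => EuclideanSpace.single i (1 : ℝ)

theorem sum_coord_smul {F : Type*} [NormedAddCommGroup F] [NormedSpace ℝ F] (L : Coord n →L[ℝ] F)
    (u : Coord n) : ∑ a, u a • L (ε a) = L u := by
  conv_rhs => rw [coord_eq_sum u]
  simp

theorem sum_coord_mul (L : Coord n →L[ℝ] ℝ) (u : Coord n) : ∑ a, u a * L (ε a) = L u :=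
  sum_coord_smul L u

theorem bilin_ext {F : Type*} [NormedAddCommGroup F] [NormedSpace ℝ F]
    {A B : Coord n →L[ℝ] Coord n →L[ℝ] F} (h : ∀ i j, A (ε i) (ε j) = B (ε i) (ε j)) : A = B := by
  ext1 u
  ext1 v
  rw [bilin_eq_sum A, bilin_eq_sum B]
  simp only [h]

theorem sharp_coord (e : Fin n → Coord n) (β : Coord n →L[ℝ] ℝ) (a : Fin n) :
    sharp e β a = ∑ l, (∑ i, e i a * e i l) * β (ε l) := by
  rw [sharp_apply]
  simp only [WithLp.ofLp_sum, Finset.sum_apply, PiLp.smul_apply, smul_eq_mul, Finset.sum_mul]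
  rw [Finset.sum_comm]
  refine Finset.sum_congr rfl fun i _ => ?_
  rw [← sum_coord_mul β (e i), Finset.sum_mul]
  exact Finset.sum_congr rfl fun l _ => by ring

/-- The components of a metric. -/
def IsMetricComp (D : Set (Coord n)) (g : Coord n → Coord n →L[ℝ] Coord n →L[ℝ] ℝ)
    (G : MetricComp n) : Prop :=
  ∀ y ∈ D, ∀ i j, G y i j = g y (ε i) (ε j)

/-- The components of a tensor field of rank `2`. -/
def IsTwoComp (D : Set (Coord n)) (A : Coord n → Coord n →L[ℝ] Coord n →L[ℝ] ℝ)
    (c : Comp n 2) : Prop :=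
  ∀ y ∈ D, ∀ idx, c y idx = A y (ε (idx 0)) (ε (idx 1))

/-- The components of a tensor field of rank `3`. -/
def IsThreeComp (D : Set (Coord n)) (A : Coord n → Coord n →L[ℝ] Coord n →L[ℝ] Coord n →L[ℝ] ℝ)
    (c : Comp n 3) : Prop :=
  ∀ y ∈ D, ∀ idx, c y idx = A y (ε (idx 0)) (ε (idx 1)) (ε (idx 2))

variable {D : Set (Coord n)} {g : Coord n → Coord n →L[ℝ] Coord n →L[ℝ] ℝ}
  {T : Coord n → Coord n →L[ℝ] Coord n →L[ℝ] Coord n →L[ℝ] ℝ} {e : Coord n → Fin n → Coord n}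
  {G : MetricComp n} {κ : ℝ} {y : Coord n}

theorem grad_eq (f : Coord n → ℝ) (y : Coord n) (idx : Fin 1 → Fin n) :
    grad G f y idx = fderiv ℝ f y (ε (idx 0)) := by
  simp only [grad, covD, scalar, pd, Finset.univ_eq_empty, Finset.sum_empty, sub_zero]
  rfl

theorem IsMetricComp.inv_eq (hGg : IsMetricComp D g G) (hy : y ∈ D) (he : IsFrame (g y) (e y))
    (a b : Fin n) : (G y)⁻¹ a b = ∑ i, e y i a * e y i b :=
  he.inv_eq (hGg y hy) a b

/-- Contraction with the inverse metric. -/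
theorem IsMetricComp.contr (hGg : IsMetricComp D g G) (hy : y ∈ D) (he : IsFrame (g y) (e y))
    (B : Coord n →L[ℝ] Coord n →L[ℝ] ℝ) :
    ∑ a, ∑ b, (G y)⁻¹ a b * B (ε a) (ε b) = ∑ i, B (e y i) (e y i) := by
  simp only [hGg.inv_eq hy he, bilin_eq_sum B (e y _), smul_eq_mul, Finset.sum_mul]
  symm
  rw [Finset.sum_comm]
  exact Finset.sum_congr rfl fun a _ => Finset.sum_comm

namespace LocalGeometry

variable (hG : LocalGeometry D g (leviCivita g e) e) (hGg : IsMetricComp D g G) (hy : y ∈ D)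
include hG hGg hy

theorem christoffel_eq (a i j : Fin n) :
    christoffel G a i j y = leviCivita g e y (ε i) (ε j) a := by
  have dg := ContDiffOn.differentiableAt_of_mem hG.smooth_g hG.isOpen hy
  have hpd : ∀ i j k, pd (fun z => G z i j) k y = fderiv ℝ g y (ε k) (ε i) (ε j) := by
    intro i j k
    rw [pd, fderiv_eq_of_eqOn hG.isOpen (fun z hz => hGg z hz i j) hy, fderiv_clm_apply_const₂ dg]
  rw [leviCivita_apply, sharp_coord, christoffel, Finset.mul_sum]
  refine Finset.sum_congr rfl fun l _ => ?_
  rw [hGg.inv_eq hy (hG.frame y hy), hpd, hpd, hpd, koszul_apply]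
  ring

theorem hess_eq {f : Coord n → ℝ} (hf : DifferentiableAt ℝ (fderiv ℝ f) y) (idx : Fin 2 → Fin n) :
    hess G f y idx = fderiv ℝ (fderiv ℝ f) y (ε (idx 1)) (ε (idx 0)) -
      fderiv ℝ f y (leviCivita g e y (ε (idx 1)) (ε (idx 0))) := by
  simp only [hess, covD, grad_eq, pd, Fin.sum_univ_one, hG.christoffel_eq hGg hy]
  rw [fderiv_clm_apply_const hf, ← sum_coord_mul (fderiv ℝ f y)]
  rfl

theorem covD_two {A : Coord n → Coord n →L[ℝ] Coord n →L[ℝ] ℝ} {c : Comp n 2}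
    (hc : IsTwoComp D A c) (hA : DifferentiableAt ℝ A y) (idx : Fin 3 → Fin n) :
    covD G c y idx =
      covB (leviCivita g e) A y (ε (idx 2)) (ε (idx 0)) (ε (idx 1)) := by
  have h1 := fderiv_eq_of_eqOn hG.isOpen (fun z hz => hc z hz (Fin.init idx)) hy
  simp only [covD, pd, Fin.sum_univ_two, hG.christoffel_eq hGg hy, hc y hy]
  have s1 := sum_coord_mul ((A y).flip (ε (idx 1)))
  simp only [ContinuousLinearMap.flip_apply] at s1
  rw [h1, fderiv_clm_apply_const₂ hA, covB, ← s1, ← sum_coord_mul (A y (ε (idx 0))), sub_sub]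
  rfl

theorem covD_three {A : Coord n → Coord n →L[ℝ] Coord n →L[ℝ] Coord n →L[ℝ] ℝ} {c : Comp n 3}
    (hc : IsThreeComp D A c) (hA : DifferentiableAt ℝ A y) (idx : Fin 4 → Fin n) :
    covD G c y idx =
      covT (leviCivita g e) A y (ε (idx 3)) (ε (idx 0)) (ε (idx 1)) (ε (idx 2)) := by
  have h1 := fderiv_eq_of_eqOn hG.isOpen (fun z hz => hc z hz (Fin.init idx)) hy
  simp only [covD, pd, Fin.sum_univ_three, hG.christoffel_eq hGg hy, hc y hy]
  have s1 := sum_coord_mul (((A y).flip (ε (idx 1))).flip (ε (idx 2)))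
  have s2 := sum_coord_mul ((A y (ε (idx 0))).flip (ε (idx 2)))
  simp only [ContinuousLinearMap.flip_apply] at s1 s2
  rw [h1, fderiv_clm_apply_const ((hA.clm_apply (differentiableAt_const _)).clm_apply
    (differentiableAt_const _)), fderiv_clm_apply_const₂ hA, covT, ← s1, ← s2,
    ← sum_coord_mul (A y (ε (idx 0)) (ε (idx 1))), sub_sub, sub_sub, ← add_assoc]
  rfl

theorem riemannUp_eq (a j k l : Fin n) : riemannUp G a j k l y =
    curvForm (leviCivita g e y) (fderiv ℝ (leviCivita g e) y) (ε j) (ε l) (ε k) a := by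
  have dΓ := ContDiffOn.differentiableAt_of_mem hG.smooth_Γ hG.isOpen hy
  have hc := hG.Γ_comm y hy
  have hd := fderiv_swap hG.isOpen hG.smooth_Γ hG.Γ_comm hy
  have hpd : ∀ i j k, pd (christoffel G a i j) k y =
      fderiv ℝ (leviCivita g e) y (ε k) (ε i) (ε j) a := by
    intro i j k
    have d1 : DifferentiableAt ℝ (fun z => leviCivita g e z (ε i) (ε j)) y :=
      (dΓ.clm_apply (differentiableAt_const _)).clm_apply (differentiableAt_const _)
    rw [pd, fderiv_eq_of_eqOn hG.isOpen (fun z hz => hG.christoffel_eq hGg hz a i j) hy,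
      ← fderiv_clm_apply_const₂ dΓ]
    exact DFunLike.congr_fun ((EuclideanSpace.proj (𝕜 := ℝ) a).hasFDerivAt.comp y
      d1.hasFDerivAt).fderiv _
  rw [riemannUp, hpd, hpd, curvForm, hd _ (ε j), hd _ (ε j), hc (ε j), hc (ε j), hc _ (ε k),
    hc _ (ε l), Finset.sum_sub_distrib]
  simp only [hG.christoffel_eq hGg hy]
  have hs : ∀ u v w : Coord n, ∑ b, leviCivita g e y u (ε b) a * leviCivita g e y v w b =
      leviCivita g e y u (leviCivita g e y v w) a := by
    intro u v w
    rw [← sum_coord_smul (leviCivita g e y u)]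
    simp [mul_comm]
  rw [hs, hs]
  simp
  ring

end LocalGeometry

/-- The hypothesis concerns basis vectors only. It is extended by linearity in stages: the paired
index, then the first two arguments of the curvature form, then the third. -/
theorem IsMetricComp.isConstCurv (hG : LocalGeometry D g (leviCivita g e) e)
    (hGg : IsMetricComp D g G) (hR : ∀ y ∈ D, ∀ i j k l, riemann G i j k l y =
      κ * (G y i k * G y j l - G y i l * G y j k)) : IsConstCurv D g (leviCivita g e) κ := by
  intro y hy
  have he := hG.frame y hy
  set Ω := curvForm (leviCivita g e y) (fderiv ℝ (leviCivita g e) y) with hΩ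
  have h1 : ∀ j l k, Ω (ε j) (ε l) (ε k) =
      κ • (g y (ε j) (ε l) • (ε k) - g y (ε j) (ε k) • (ε l)) := by
    intro j l k
    refine he.ext fun w => ?_
    rw [he.symm, he.symm _ w]
    have : (g y).flip (Ω (ε j) (ε l) (ε k)) = (g y).flip
        (κ • (g y (ε j) (ε l) • (ε k) - g y (ε j) (ε k) • (ε l))) := by
      ext1 u
      rw [← sum_coord_mul _ u, ← sum_coord_mul _ u]
      refine Finset.sum_congr rfl fun i _ => ?_
      congr 1
      have h := hR y hy i j k l
      rw [riemann] at h
      simp only [hG.riemannUp_eq hGg hy, hGg y hy] at h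
      rw [ContinuousLinearMap.flip_apply, ContinuousLinearMap.flip_apply,
        ← sum_coord_mul (g y (ε i))]
      simp only [map_smul, map_sub, smul_eq_mul]
      exact (Finset.sum_congr rfl fun a _ => mul_comm _ _).trans (h.trans (by ring))
    exact DFunLike.congr_fun this w
  have h2 : ∀ k u v, Ω u v (ε k) = κ • (g y u v • (ε k) - g y u (ε k) • v) := by
    intro k u v
    have : curvBilin (leviCivita g e y) (fderiv ℝ (leviCivita g e) y) (ε k) = κ •
        ((ContinuousLinearMap.compL ℝ (Coord n) ℝ (Coord n)
          ((ContinuousLinearMap.id ℝ ℝ).smulRight (ε k))).comp (g y) -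
        ((g y).flip (ε k)).smulRight (ContinuousLinearMap.id ℝ (Coord n))) :=
      bilin_ext fun i j => by
        rw [curvBilin_apply, ← hΩ, h1]
        simp
    have := congrArg (fun B => B u v) this
    simpa [curvBilin_apply] using this
  intro u v w
  have : (curvBilin (leviCivita g e y) (fderiv ℝ (leviCivita g e) y) w) u =
      κ • ((g y u).smulRight w - g y u w • ContinuousLinearMap.id ℝ (Coord n)) := by
    ext1 v
    rw [← sum_coord_smul _ v, ← sum_coord_smul _ v]
    refine Finset.sum_congr rfl fun k _ => ?_
    congr 1
    have := h2 k u w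
    simp only [hΩ, curvForm] at this
    rw [curvBilin_apply, curvForm]
    simp only [smul_apply, sub_apply, ContinuousLinearMap.smulRight_apply,
      ContinuousLinearMap.id_apply]
    linear_combination (norm := module) -this
  have := DFunLike.congr_fun this v
  simpa [curvBilin_apply] using this

theorem IsMetricComp.ricci_eq (hG : LocalGeometry D g (leviCivita g e) e)
    (hGg : IsMetricComp D g G) (hK : IsConstCurv D g (leviCivita g e) κ) (hy : y ∈ D)
    (i j : Fin n) : ricci G i j y = ((n : ℝ) - 1) * κ * g y (ε i) (ε j) := by
  simp only [ricci, hG.riemannUp_eq hGg hy, hK y hy]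
  simp [PiLp.single_apply, mul_sub, Finset.sum_sub_distrib]
  ring

end Bridge

end SuperInt
end

noncomputable section
set_option maxSynthPendingDepth 3

namespace SuperInt

/-! ### Components of the tensors `Z`, `C` and `B` -/

section TensorComponents

variable {n : ℕ}

local notation "ε" i:max => EuclideanSpace.single i (1 : ℝ)

/-- The symmetrisation of a trilinear form, as a trilinear form. -/
def symCLM (T : Coord n →L[ℝ] Coord n →L[ℝ] Coord n →L[ℝ] ℝ) :
    Coord n →L[ℝ] Coord n →L[ℝ] Coord n →L[ℝ] ℝ :=
  (LinearMap.mk₂ ℝ (fun u v : Coord n => (1 / 6 : ℝ) • (T u v + (T u).flip v + T v u +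
      (T v).flip u + (T.flip u).flip v + (T.flip v).flip u))
    (fun a b c => by ext; simp; ring) (fun r a b => by ext; simp; ring)
    (fun a b c => by ext; simp; ring) (fun r a b => by ext; simp; ring)).toContinuousBilinearMap

theorem symCLM_apply (T : Coord n →L[ℝ] Coord n →L[ℝ] Coord n →L[ℝ] ℝ) (u v w : Coord n) :
    symCLM T u v w = symForm T u v w := rfl

/-- The trace-free part of the symmetrisation, as a trilinear form. -/
def ringCLM (g : Coord n →L[ℝ] Coord n →L[ℝ] ℝ)
    (T : Coord n →L[ℝ] Coord n →L[ℝ] Coord n →L[ℝ] ℝ) (e : Fin n → Coord n) :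
    Coord n →L[ℝ] Coord n →L[ℝ] Coord n →L[ℝ] ℝ :=
  (LinearMap.mk₂ ℝ (fun u v : Coord n => symCLM T u v - (1 / ((n : ℝ) + 2)) •
      (g u v • (∑ i, symCLM T (e i) (e i)) + (∑ i, symCLM T (e i) (e i)) u • g v +
        (∑ i, symCLM T (e i) (e i)) v • g.flip u))
    (fun a b c => by ext; simp only [map_add, add_apply, sub_apply, smul_apply, smul_eq_mul]; ring)
    (fun r a b => by ext; simp only [map_smul, add_apply, sub_apply, smul_apply, smul_eq_mul]; ring)
    (fun a b c => by ext; simp only [map_add, add_apply, sub_apply, smul_apply, smul_eq_mul]; ring)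
    (fun r a b => by
      ext; simp only [map_smul, add_apply, sub_apply, smul_apply, smul_eq_mul]; ring)).toContinuousBilinearMap

theorem ringCLM_apply (g : Coord n →L[ℝ] Coord n →L[ℝ] ℝ)
    (T : Coord n →L[ℝ] Coord n →L[ℝ] Coord n →L[ℝ] ℝ) (e : Fin n → Coord n) (u v w : Coord n) :
    ringCLM g T e u v w = ringForm g T e u v w := by
  have : ∀ w, (∑ i, symCLM T (e i) (e i)) w = ∑ i, symForm T (e i) (e i) w := fun w => by
    rw [sum_apply]; rfl
  change symCLM T u v w - (1 / ((n : ℝ) + 2)) * (g u v * (∑ i, symCLM T (e i) (e i)) w +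
    (∑ i, symCLM T (e i) (e i)) u * g v w + (∑ i, symCLM T (e i) (e i)) v * g w u) = _
  rw [this, this, this, symCLM_apply, ringForm]
  ring

theorem univ_perm_three : (Finset.univ : Finset (Equiv.Perm (Fin 3))) =
    {1, Equiv.swap 0 1, Equiv.swap 0 2, Equiv.swap 1 2, finRotate 3, (finRotate 3)⁻¹} := by
  decide

theorem young_three (A : Comp n 3) (y : Coord n) (i j k : Fin n) : young A y ![i, j, k] =
    A y ![i, j, k] + A y ![j, i, k] + A y ![k, j, i] + A y ![i, k, j] + A y ![j, k, i] +
      A y ![k, i, j] := by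
  rw [young, univ_perm_three]
  repeat rw [Finset.sum_insert (by decide)]
  rw [Finset.sum_singleton]
  have h : ∀ σ : Equiv.Perm (Fin 3), (![i, j, k] : Fin 3 → Fin n) ∘ σ =
      ![![i, j, k] (σ 0), ![i, j, k] (σ 1), ![i, j, k] (σ 2)] := fun σ => by
    ext r; fin_cases r <;> rfl
  simp only [h]
  have e1 : (finRotate 3) 0 = 1 ∧ (finRotate 3) 1 = 2 ∧ (finRotate 3) 2 = 0 ∧
      (finRotate 3)⁻¹ 0 = 2 ∧ (finRotate 3)⁻¹ 1 = 0 ∧ (finRotate 3)⁻¹ 2 = 1 := by decide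
  have e2 : (Equiv.swap (0 : Fin 3) 1) 2 = 2 ∧ (Equiv.swap (0 : Fin 3) 2) 1 = 1 ∧
      (Equiv.swap (1 : Fin 3) 2) 0 = 0 := by decide
  obtain ⟨a1, a2, a3, a4, a5, a6⟩ := e1
  obtain ⟨b1, b2, b3⟩ := e2
  rw [a1, a2, a3, a4, a5, a6, b1, b2, b3]
  simp only [Equiv.swap_apply_left, Equiv.swap_apply_right, Equiv.Perm.coe_one, id_eq]
  simp only [Matrix.cons_val_zero, Matrix.cons_val_one, Matrix.cons_val]
  ring

theorem eq_vec_three (idx : Fin 3 → Fin n) : idx = ![idx 0, idx 1, idx 2] := by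
  ext r; fin_cases r <;> rfl

/-- The two adjacent transpositions generate the symmetric group; each of the six permutations is
written as a word in them. -/
theorem perm_invariant {A : (Fin 3 → Fin n) → ℝ} (h1 : ∀ i j k, A ![i, j, k] = A ![j, i, k])
    (h2 : ∀ i j k, A ![i, j, k] = A ![i, k, j]) (σ : Equiv.Perm (Fin 3)) (idx : Fin 3 → Fin n) :
    A (idx ∘ σ) = A idx := by
  have hσ := Finset.mem_univ σ
  rw [univ_perm_three] at hσ
  have h : idx ∘ σ = ![idx (σ 0), idx (σ 1), idx (σ 2)] := by
    ext r; fin_cases r <;> rfl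
  rw [h, eq_vec_three idx]
  simp only [Finset.mem_insert, Finset.mem_singleton] at hσ
  rcases hσ with rfl | rfl | rfl | rfl | rfl | rfl
  · rfl
  · exact h1 _ _ _
  · exact ((h1 _ _ _).trans (h2 _ _ _)).trans (h1 _ _ _)
  · exact h2 _ _ _
  · exact (h2 _ _ _).trans (h1 _ _ _)
  · exact (h1 _ _ _).trans (h2 _ _ _)

variable {D : Set (Coord n)} {g : Coord n → Coord n →L[ℝ] Coord n →L[ℝ] ℝ}
  {T : Coord n → Coord n →L[ℝ] Coord n →L[ℝ] Coord n →L[ℝ] ℝ} {e : Coord n → Fin n → Coord n}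
  {G : MetricComp n} {κ : ℝ} {y : Coord n} {c : Comp n 3}

section Pointwise

variable (hGg : IsMetricComp D g G) (hc : IsThreeComp D T c) (hy : y ∈ D)
  (he : IsFrame (g y) (e y))
include hGg hc hy he

theorem traceForm_eq (k : Fin n) : traceForm G c k y = tauForm (T y) (e y) (ε k) := by
  have := hGg.contr hy he ((T y).flip (ε k))
  simpa [traceForm, tauForm, hc y hy] using this

theorem trace12_eq (k : Fin n) : trace12 G c k y = ∑ i, T y (e y i) (e y i) (ε k) := by
  have := hGg.contr hy he ((ContinuousLinearMap.compL ℝ (Coord n) (Coord n →L[ℝ] ℝ) ℝ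
    (ContinuousLinearMap.apply ℝ ℝ (ε k))).comp (T y))
  simpa [trace12, hc y hy] using this

theorem barT_eq (i : Fin n) : barT G c i y = barForm (T y) (e y) (ε i) := by
  have := hGg.contr hy he (T y (ε i))
  simp only [barT, barForm, hc y hy]
  rw [← this]
  rfl

theorem ringT_eq (idx : Fin 3 → Fin n) : ringT G c y idx =
    ringCLM (g y) (T y) (e y) (ε (idx 0)) (ε (idx 1)) (ε (idx 2)) := by
  have hy6 : IsThreeComp D (fun z => symCLM (T z)) (fun y idx => (1 / 6) * young c y idx) := by
    intro z hz idx
    change 1 / 6 * young c z idx = symForm (T z) (ε (idx 0)) (ε (idx 1)) (ε (idx 2))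
    rw [eq_vec_three idx, young_three, symForm]
    simp only [hc z hz]
    simp only [Matrix.cons_val_zero, Matrix.cons_val_one, Matrix.cons_val]
    ring
  have h6 : 1 / 6 * young c y idx = symCLM (T y) (ε (idx 0)) (ε (idx 1)) (ε (idx 2)) :=
    hy6 y hy idx
  rw [ringCLM_apply, ringForm, ringT, traceFree3, trace12_eq hGg hy6 hy he,
    trace12_eq hGg hy6 hy he, trace12_eq hGg hy6 hy he, h6]
  simp only [hGg y hy]
  rfl

theorem zTensor_eq (hG : LocalGeometry D g (leviCivita g e) e)
    (hK : IsConstCurv D g (leviCivita g e) κ) (idx : Fin 2 → Fin n) :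
    zTensor G c y idx = zForm κ (g y) (T y) (e y) (ε (idx 0)) (ε (idx 1)) := by
  set R := ringCLM (g y) (T y) (e y) with hR
  set i := idx 0
  set j := idx 1
  -- A double contraction with the inverse metric becomes a double sum over the frame, by
  -- contracting one pair of indices at a time.
  have h1 : ∑ a, ∑ b, ∑ k, ∑ d, (G y)⁻¹ a k * (G y)⁻¹ b d * R (ε i) (ε a) (ε b) *
      R (ε j) (ε k) (ε d) = ∑ p, ∑ q, R (ε i) (e y p) (e y q) * R (ε j) (e y p) (e y q) := by
    have inner : ∀ u v, ∑ b, ∑ d, (G y)⁻¹ b d * (R (ε i) u (ε b) * R (ε j) v (ε d)) =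
        ∑ q, R (ε i) u (e y q) * R (ε j) v (e y q) := fun u v =>
      hGg.contr hy he ((R (ε i) u).smulRight (R (ε j) v))
    have outer := hGg.contr hy he
      (∑ q, ((R (ε i)).flip (e y q)).smulRight ((R (ε j)).flip (e y q)))
    simp only [sum_apply, ContinuousLinearMap.smulRight_apply, smul_apply,
      ContinuousLinearMap.flip_apply, smul_eq_mul, ← inner] at outer
    rw [Finset.sum_congr rfl fun p _ => (inner (e y p) (e y p)).symm, ← outer]
    refine Finset.sum_congr rfl fun a _ => ?_
    rw [Finset.sum_comm]
    refine Finset.sum_congr rfl fun k _ => ?_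
    rw [Finset.mul_sum]
    refine Finset.sum_congr rfl fun b _ => ?_
    rw [Finset.mul_sum]
    exact Finset.sum_congr rfl fun d _ => by ring
  have hbar : ∀ u, barForm (T y) (e y) u = g y (barVec (T y) (e y)) u := barForm_eq he
  have h2 : ∑ a, ∑ b, (G y)⁻¹ a b * R (ε i) (ε j) (ε a) * barT G c b y =
      ∑ p, R (ε i) (ε j) (e y p) * barForm (T y) (e y) (e y p) := by
    have := hGg.contr hy he ((R (ε i) (ε j)).smulRight (g y (barVec (T y) (e y))))
    simp only [ContinuousLinearMap.smulRight_apply, smul_apply, smul_eq_mul, ← hbar,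
      ← mul_assoc] at this
    simpa only [barT_eq hGg hc hy he] using this
  simp only [zTensor, ringT_eq hGg hc hy he]
  simp only [Matrix.cons_val_zero, Matrix.cons_val_one, Matrix.cons_val]
  rw [← hR, h1, h2, barT_eq hGg hc hy he, barT_eq hGg hc hy he, hGg.ricci_eq hG hK hy, zForm]
  simp only [hR, ringCLM_apply]
  rfl

/-- The six permutations give each of the three products of g and dC twice because g is symmetric;
this turns 1/(2(n-2)) into 1/(n-2). -/
theorem bTensor_eq {f : Coord n → ℝ} (hn : 3 ≤ n) (idx : Fin 3 → Fin n) :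
    bTensor G c f y idx = bCLM (g y) (sField g T e y) (fderiv ℝ f y) (ε (idx 0)) (ε (idx 1))
      (ε (idx 2)) := by
  have hn' : (3 : ℝ) ≤ n := by exact_mod_cast hn
  have h2 : (n : ℝ) - 2 ≠ 0 := by linarith
  have hs := he.symm
  rw [bTensor, eq_vec_three idx, young_three, bCLM_apply, sField, he.sTensor_pair]
  simp only [traceForm_eq hGg hc hy he, hc y hy, hGg y hy, grad_eq]
  simp only [Matrix.cons_val_zero, Matrix.cons_val_one, Matrix.cons_val]
  rw [hs (ε (idx 1)) (ε (idx 0)), hs (ε (idx 2)) (ε (idx 0)), hs (ε (idx 2)) (ε (idx 1))]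
  field_simp
  ring

end Pointwise

/-- The equation for the potential in terms of a frame. -/
theorem localPotential_of_components (hG : LocalGeometry D g (leviCivita g e) e)
    (hGg : IsMetricComp D g G) (hc : IsThreeComp D T c)
    {f : Coord n → ℝ} (hf : ContDiffOn ℝ ∞ f D)
    (heq : ∀ y ∈ D, ∀ i j, hess G f y ![i, j] =
      (∑ m, ∑ a, (G y)⁻¹ m a * c y ![i, j, a] * grad G f y ![m]) +
      1 / (n : ℝ) * G y i j * laplacian G f y) :
    LocalPotential D g (leviCivita g e) T e f where
  smooth := hf
  eq y hy := by
    have he := hG.frame y hy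
    have df := ContDiffOn.differentiableAt_of_mem (ContDiffOn.fderiv_infty hf hG.isOpen) hG.isOpen hy
    set H : Coord n →L[ℝ] Coord n →L[ℝ] ℝ := fderiv ℝ (fderiv ℝ f) y -
      (ContinuousLinearMap.compL ℝ (Coord n) (Coord n) ℝ (fderiv ℝ f y)).comp (leviCivita g e y)
      with hH
    have hHe : ∀ idx, hess G f y idx = H (ε (idx 1)) (ε (idx 0)) := fun idx => by
      rw [hG.hess_eq hGg hy df]; rfl
    have hHs : ∀ u v, H u v = H v u := fun u v => by
      simp only [hH, sub_apply, ContinuousLinearMap.comp_apply, ContinuousLinearMap.compL_apply]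
      rw [fderiv_fderiv_symm hG.isOpen hf hy, hG.Γ_comm y hy]
    have hlap : laplacian G f y = frameLaplacian (leviCivita g e) e f y := by
      have := hGg.contr hy he H
      simp only [laplacian, hHe]
      simp only [Matrix.cons_val_zero, Matrix.cons_val_one]
      simp only [hHs (ε _) (ε _)]
      rw [this]
      rfl
    have key : H = (ContinuousLinearMap.compL ℝ (Coord n) (Coord n →L[ℝ] ℝ) ℝ
        ((fderiv ℝ f y).comp (sharp (e y)))).comp (T y) +
        (1 / (n : ℝ) * frameLaplacian (leviCivita g e) e f y) • g y := bilin_ext fun i j => by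
      have h := heq y hy i j
      have := hGg.contr hy he (((fderiv ℝ f y)).smulRight (T y (ε i) (ε j)))
      simp only [hHe, grad_eq, hc y hy, hGg y hy, hlap] at h
      simp only [Matrix.cons_val_zero, Matrix.cons_val_one, Matrix.cons_val] at h
      rw [hHs, h]
      simp only [ContinuousLinearMap.smulRight_apply, smul_apply, smul_eq_mul] at this
      simp only [add_apply, ContinuousLinearMap.comp_apply, ContinuousLinearMap.compL_apply,
        smul_apply, smul_eq_mul, sharp_apply, map_sum, map_smul]
      rw [Finset.sum_congr rfl fun p _ => mul_comm _ _, ← this]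
      congr 1
      · exact Finset.sum_congr rfl fun a _ => Finset.sum_congr rfl fun b _ => by ring
      · ring
    intro u v
    have h := congrArg (fun B => B u v) key
    simp only [hH, sub_apply, add_apply, ContinuousLinearMap.comp_apply,
      ContinuousLinearMap.compL_apply, smul_apply, smul_eq_mul] at h
    rw [h]
    ring

end TensorComponents

end SuperInt
end

noncomputable section
set_option maxSynthPendingDepth 3

namespace SuperInt

/-! ### Change of coordinates -/

section CoordinateChange

variable {n : ℕ}

/-- A change of coordinates that is compatible with metrics and frames. -/
structure CoordinateChange (D' D : Set (Coord n)) (F : Coord n → Coord n)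
    (g' g : Coord n → Coord n →L[ℝ] Coord n →L[ℝ] ℝ) (e' e : Coord n → Fin n → Coord n) : Prop where
  isOpen : IsOpen D'
  mapsTo : ∀ y ∈ D', F y ∈ D
  smooth : ContDiffOn ℝ ∞ F D'
  metric : ∀ y ∈ D', ∀ u v, g' y u v = g (F y) (fderiv ℝ F y u) (fderiv ℝ F y v)
  frame : ∀ y ∈ D', ∀ i, fderiv ℝ F y (e' y i) = e (F y) i

namespace CoordinateChange

variable {D' D : Set (Coord n)} {F : Coord n → Coord n}
  {g' g : Coord n → Coord n →L[ℝ] Coord n →L[ℝ] ℝ} {e' e : Coord n → Fin n → Coord n}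
  {y : Coord n}

theorem fderiv_two (hF : CoordinateChange D' D F g' g e' e)
    {A' A : Coord n → Coord n →L[ℝ] Coord n →L[ℝ] ℝ} (hy : y ∈ D')
    (hA' : DifferentiableAt ℝ A' y) (hA : DifferentiableAt ℝ A (F y))
    (h : ∀ y ∈ D', ∀ u v, A' y u v = A (F y) (fderiv ℝ F y u) (fderiv ℝ F y v)) (w u v : Coord n) :
    fderiv ℝ A' y w u v =
      fderiv ℝ A (F y) (fderiv ℝ F y w) (fderiv ℝ F y u) (fderiv ℝ F y v) +
      A (F y) (fderiv ℝ (fderiv ℝ F) y w u) (fderiv ℝ F y v) +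
      A (F y) (fderiv ℝ F y u) (fderiv ℝ (fderiv ℝ F) y w v) := by
  have dF := ContDiffOn.differentiableAt_of_mem hF.smooth hF.isOpen hy
  have dJ := ContDiffOn.differentiableAt_of_mem (ContDiffOn.fderiv_infty hF.smooth hF.isOpen)
    hF.isOpen hy
  have dJu : ∀ u, DifferentiableAt ℝ (fun z => fderiv ℝ F z u) y := fun u =>
    dJ.clm_apply (differentiableAt_const u)
  have dAF : DifferentiableAt ℝ (fun z => A (F z)) y := hA.comp y dF
  have dAu : DifferentiableAt ℝ (fun z => A (F z) (fderiv ℝ F z u)) y := dAF.clm_apply (dJu u)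
  rw [← fderiv_clm_apply_const₂ hA', fderiv_eq_of_eqOn hF.isOpen (fun z hz => h z hz u v) hy,
    fderiv_clm_apply dAu (dJu v), fderiv_clm_apply dAF (dJu u)]
  have e1 : fderiv ℝ (fun z => A (F z)) y = (fderiv ℝ A (F y)).comp (fderiv ℝ F y) :=
    fderiv_comp y hA dF
  simp only [e1, add_apply, ContinuousLinearMap.comp_apply, ContinuousLinearMap.flip_apply,
    fderiv_clm_apply_const dJ]
  ring

/-- The transformation law of the Levi-Civita connection. -/
theorem leviCivita_eq (hF : CoordinateChange D' D F g' g e' e)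
    (hG : LocalGeometry D g (leviCivita g e) e) (hG' : LocalGeometry D' g' (leviCivita g' e') e')
    (hy : y ∈ D') (u v : Coord n) : fderiv ℝ F y (leviCivita g' e' y u v) =
      fderiv ℝ (fderiv ℝ F) y u v +
        leviCivita g e (F y) (fderiv ℝ F y u) (fderiv ℝ F y v) := by
  have he := hG.frame _ (hF.mapsTo y hy)
  have he' := hG'.frame y hy
  have hpair : ∀ w, g (F y) (fderiv ℝ F y (leviCivita g' e' y u v)) (fderiv ℝ F y w) =
      g (F y) (fderiv ℝ (fderiv ℝ F) y u v +
        leviCivita g e (F y) (fderiv ℝ F y u) (fderiv ℝ F y v)) (fderiv ℝ F y w) := by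
    intro w
    have d' := ContDiffOn.differentiableAt_of_mem hG'.smooth_g hG'.isOpen hy
    have d := ContDiffOn.differentiableAt_of_mem hG.smooth_g hG.isOpen (hF.mapsTo y hy)
    have hd := hF.fderiv_two hy d' d hF.metric
    have hs := fderiv_fderiv_symm hF.isOpen hF.smooth hy
    rw [← hF.metric y hy, leviCivita_apply, he'.apply_sharp, koszul_apply, map_add, add_apply,
      leviCivita_apply, he.apply_sharp, koszul_apply, hd, hd, hd, hs v u, hs w u, hs w v,
      he.symm (fderiv ℝ F y v)]
    ring
  -- Both vectors are expanded in the frame at F y, which consists of images under the differential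
  -- of F. Pairings with such images therefore suffice.
  rw [← he.sum_smul (fderiv ℝ F y (leviCivita g' e' y u v)), ← he.sum_smul
    (fderiv ℝ (fderiv ℝ F) y u v + leviCivita g e (F y) (fderiv ℝ F y u) (fderiv ℝ F y v))]
  simp only [← hF.frame y hy, hpair]

/-- The Hessian is a tensor. -/
theorem hess_eq (hF : CoordinateChange D' D F g' g e' e)
    (hG : LocalGeometry D g (leviCivita g e) e) (hG' : LocalGeometry D' g' (leviCivita g' e') e')
    {f' f : Coord n → ℝ} {B : Set (Coord n)} (hB : IsOpen B) (hf : ContDiffOn ℝ ∞ f B)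
    (hy : y ∈ D') (hyB : F y ∈ B) (hff : ∀ y ∈ D', F y ∈ B → f' y = f (F y)) (u v : Coord n) :
    fderiv ℝ f' y u = fderiv ℝ f (F y) (fderiv ℝ F y u) ∧
    fderiv ℝ (fderiv ℝ f') y u v - fderiv ℝ f' y (leviCivita g' e' y u v) =
      fderiv ℝ (fderiv ℝ f) (F y) (fderiv ℝ F y u) (fderiv ℝ F y v) -
        fderiv ℝ f (F y) (leviCivita g e (F y) (fderiv ℝ F y u) (fderiv ℝ F y v)) := by
  have hO : IsOpen (D' ∩ F ⁻¹' B) := hF.smooth.continuousOn.isOpen_inter_preimage hF.isOpen hB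
  have h1 : ∀ z ∈ D' ∩ F ⁻¹' B, fderiv ℝ f' z = (fderiv ℝ f (F z)).comp (fderiv ℝ F z) := by
    intro z hz
    rw [fderiv_eq_of_eqOn hO (h := fun z => f (F z)) (fun z hz => hff z hz.1 hz.2) hz]
    exact fderiv_comp z (ContDiffOn.differentiableAt_of_mem hf hB hz.2)
      (ContDiffOn.differentiableAt_of_mem hF.smooth hF.isOpen hz.1)
  have hyO : y ∈ D' ∩ F ⁻¹' B := ⟨hy, hyB⟩
  refine ⟨by rw [h1 y hyO]; rfl, ?_⟩
  have dF := ContDiffOn.differentiableAt_of_mem hF.smooth hF.isOpen hy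
  have dJ := ContDiffOn.differentiableAt_of_mem (ContDiffOn.fderiv_infty hF.smooth hF.isOpen)
    hF.isOpen hy
  have df := ContDiffOn.differentiableAt_of_mem (ContDiffOn.fderiv_infty hf hB) hB hyB
  have e1 : fderiv ℝ (fun z => fderiv ℝ f (F z)) y =
    (fderiv ℝ (fderiv ℝ f) (F y)).comp (fderiv ℝ F y) := fderiv_comp y df dF
  have dfF : DifferentiableAt ℝ (fun z => fderiv ℝ f (F z)) y := df.comp y dF
  rw [fderiv_eq_of_eqOn hO h1 hyO, h1 y hyO, fderiv_clm_comp dfF dJ, e1]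
  simp only [add_apply, ContinuousLinearMap.comp_apply, ContinuousLinearMap.compL_apply,
    ContinuousLinearMap.flip_apply, hF.leviCivita_eq hG hG' hy, map_add]
  ring

/-- The covariant derivative of a tensor field of rank `2` is a tensor. -/
theorem covB_eq (hF : CoordinateChange D' D F g' g e' e)
    (hG : LocalGeometry D g (leviCivita g e) e) (hG' : LocalGeometry D' g' (leviCivita g' e') e')
    {A' A : Coord n → Coord n →L[ℝ] Coord n →L[ℝ] ℝ} (hy : y ∈ D')
    (hA' : DifferentiableAt ℝ A' y) (hA : DifferentiableAt ℝ A (F y))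
    (h : ∀ y ∈ D', ∀ u v, A' y u v = A (F y) (fderiv ℝ F y u) (fderiv ℝ F y v)) (w u v : Coord n) :
    covB (leviCivita g' e') A' y w u v = covB (leviCivita g e) A (F y) (fderiv ℝ F y w)
      (fderiv ℝ F y u) (fderiv ℝ F y v) := by
  rw [covB, covB, hF.fderiv_two hy hA' hA h, h y hy, h y hy, hF.leviCivita_eq hG hG' hy,
    hF.leviCivita_eq hG hG' hy]
  simp only [map_add, add_apply]
  ring

end CoordinateChange

/-! ### Pointwise invariance of the tensors Z and B under linear maps matching metrics and frames -/

section Invariance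

variable {g' g : Coord n →L[ℝ] Coord n →L[ℝ] ℝ} {J : Coord n →L[ℝ] Coord n}
  {e' e : Fin n → Coord n} {T' T : Coord n →L[ℝ] Coord n →L[ℝ] Coord n →L[ℝ] ℝ} {κ : ℝ}

theorem zForm_comp (hg : ∀ u v, g' u v = g (J u) (J v)) (he : ∀ i, J (e' i) = e i)
    (hT : ∀ u v w, T' u v w = T (J u) (J v) (J w)) (u v : Coord n) :
    zForm κ g' T' e' u v = zForm κ g T e (J u) (J v) := by
  have hsym : ∀ u v w, symForm T' u v w = symForm T (J u) (J v) (J w) := fun u v w => by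
    simp only [symForm, hT]
  have hring : ∀ u v w, ringForm g' T' e' u v w = ringForm g T e (J u) (J v) (J w) :=
    fun u v w => by simp only [ringForm, hsym, hg, he]
  have hbar : ∀ u, barForm T' e' u = barForm T e (J u) := fun u => by
    simp only [barForm, hT, he]
  simp only [zForm, hring, hbar, hg, he]

theorem tauForm_comp (he : ∀ i, J (e' i) = e i)
    (hT : ∀ u v w, T' u v w = T (J u) (J v) (J w)) (w : Coord n) :
    tauForm T' e' w = tauForm T e (J w) := by
  simp only [tauForm, hT, he]

theorem bCLM_comp (hf' : IsFrame g' e') (hf : IsFrame g e) (hg : ∀ u v, g' u v = g (J u) (J v))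
    (he : ∀ i, J (e' i) = e i) (hT : ∀ u v w, T' u v w = T (J u) (J v) (J w))
    {β' β : Coord n →L[ℝ] ℝ} (hβ : ∀ u, β' u = β (J u)) (u v w : Coord n) :
    bCLM g' (sTensor g' T' e') β' u v w = bCLM g (sTensor g T e) β (J u) (J v) (J w) := by
  simp only [bCLM_apply, hf'.sTensor_pair, hf.sTensor_pair, hT, hg, hβ, tauForm_comp he hT]

end Invariance

end CoordinateChange

end SuperInt
end

noncomputable section
set_option maxSynthPendingDepth 3

namespace SuperInt

/-! ### The metric and the structure tensor in a chart -/

section Charts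

variable {n : ℕ} {M : Type*} [TopologicalSpace M]

local notation "ε" i:max => EuclideanSpace.single i (1 : ℝ)

variable {φ φ' : OpenPartialHomeomorph M (Coord n)} {y : Coord n}

/-- The change of coordinates between two charts. -/
def transition (φ' φ : OpenPartialHomeomorph M (Coord n)) (y : Coord n) : Coord n := φ (φ'.symm y)

/-- The domain of the change of coordinates between two charts. -/
def overlap (φ' φ : OpenPartialHomeomorph M (Coord n)) : Set (Coord n) :=
  φ'.target ∩ φ'.symm ⁻¹' φ.source

theorem isOpen_overlap : IsOpen (overlap φ' φ) :=
  φ'.symm.continuousOn.isOpen_inter_preimage φ'.open_target φ.open_source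

theorem transition_mem (hy : y ∈ overlap φ' φ) : transition φ' φ y ∈ φ.target :=
  φ.map_source hy.2

theorem symm_transition (hy : y ∈ overlap φ' φ) : φ.symm (transition φ' φ y) = φ'.symm y :=
  φ.left_inv hy.2

variable [ChartedSpace (Coord n) M]

/-- The derivative of the inverse of a chart. -/
def jac (φ : OpenPartialHomeomorph M (Coord n)) (y : Coord n) : Coord n →L[ℝ] Coord n :=
  mfderiv (𝓡 n) (𝓡 n) φ.symm y

/-- The derivative of a chart. -/
def jacInv (φ : OpenPartialHomeomorph M (Coord n)) (y : Coord n) : Coord n →L[ℝ] Coord n :=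
  mfderiv (𝓡 n) (𝓡 n) φ (φ.symm y)

theorem charts_mdifferentiable (hφ : φ ∈ charts n M) : φ.MDifferentiable (𝓡 n) (𝓡 n) :=
  ⟨(contMDiffOn_of_mem_maximalAtlas hφ).mdifferentiableOn (by simp),
    (contMDiffOn_symm_of_mem_maximalAtlas hφ).mdifferentiableOn (by simp)⟩

theorem jac_jacInv (hφ : φ ∈ charts n M) (hy : y ∈ φ.target) (u : Coord n) :
    jac φ y (jacInv φ y u) = u := by
  have h := (charts_mdifferentiable hφ).symm_comp_deriv (φ.map_target hy)
  rw [φ.right_inv hy] at h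
  exact DFunLike.congr_fun h u

theorem jacInv_jac (hφ : φ ∈ charts n M) (hy : y ∈ φ.target) (u : Coord n) :
    jacInv φ y (jac φ y u) = u :=
  DFunLike.congr_fun ((charts_mdifferentiable hφ).comp_symm_deriv hy) u

theorem contMDiffOn_transition (hφ' : φ' ∈ charts n M) (hφ : φ ∈ charts n M) :
    ContMDiffOn (𝓡 n) (𝓡 n) ∞ (transition φ' φ) (overlap φ' φ) :=
  (contMDiffOn_of_mem_maximalAtlas hφ).comp
    ((contMDiffOn_symm_of_mem_maximalAtlas hφ').mono Set.inter_subset_left) fun _ hy => hy.2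

theorem smooth_transition (hφ' : φ' ∈ charts n M) (hφ : φ ∈ charts n M) :
    ContDiffOn ℝ ∞ (transition φ' φ) (overlap φ' φ) :=
  contMDiffOn_iff_contDiffOn.1 (contMDiffOn_transition hφ' hφ)

theorem jac_transition (hφ' : φ' ∈ charts n M) (hφ : φ ∈ charts n M) (hy : y ∈ overlap φ' φ)
    (u : Coord n) : jac φ (transition φ' φ y) (fderiv ℝ (transition φ' φ) y u) = jac φ' y u := by
  have h1 : MDifferentiableAt (𝓡 n) (𝓡 n) φ.symm (transition φ' φ y) :=
    (charts_mdifferentiable hφ).mdifferentiableAt_symm (transition_mem hy)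
  have h2 : MDifferentiableAt (𝓡 n) (𝓡 n) (transition φ' φ) y :=
    (((contMDiffOn_transition hφ' hφ) y hy).contMDiffAt
      (isOpen_overlap.mem_nhds hy)).mdifferentiableAt (by simp)
  have h3 := mfderiv_comp y h1 h2
  have h4 : φ.symm ∘ transition φ' φ =ᶠ[nhds y] φ'.symm := by
    filter_upwards [isOpen_overlap.mem_nhds hy] with z hz using symm_transition hz
  rw [h4.mfderiv_eq, mfderiv_eq_fderiv] at h3
  exact (DFunLike.congr_fun h3 u).symm

theorem transition_jacInv (hφ' : φ' ∈ charts n M) (hφ : φ ∈ charts n M) (hy : y ∈ overlap φ' φ)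
    (u : Coord n) :
    fderiv ℝ (transition φ' φ) y (jacInv φ' y u) = jacInv φ (transition φ' φ y) u := by
  rw [← jacInv_jac hφ (transition_mem hy) (fderiv ℝ _ _ _), jac_transition hφ' hφ hy,
    jac_jacInv hφ' hy.1]

variable [IsManifold (𝓡 n) ∞ M]

/-- A Riemannian metric as a field of bilinear forms on the model space. -/
def Metric.form (g : Metric n M) (x : M) : Coord n →L[ℝ] Coord n →L[ℝ] ℝ := g.inner x

theorem Metric.exists_frame (g : Metric n M) (x : M) : ∃ e : Fin n → Coord n,
    IsFrame (g.form x) e :=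
  exists_isFrame _ (fun u v => g.symm x u v) fun u hu => g.pos x u hu

/-- An orthonormal frame at every point. -/
def Metric.frame (g : Metric n M) (x : M) : Fin n → Coord n := (Metric.exists_frame g x).choose

/-- The metric in a chart. -/
def Metric.local (g : Metric n M) (φ : OpenPartialHomeomorph M (Coord n)) (y : Coord n) :
    Coord n →L[ℝ] Coord n →L[ℝ] ℝ :=
  (Metric.form g (φ.symm y)).bilinearComp (jac φ y) (jac φ y)

theorem Metric.local_apply (g : Metric n M) (u v : Coord n) :
    Metric.local g φ y u v = Metric.form g (φ.symm y) (jac φ y u) (jac φ y v) := rfl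

/-- The orthonormal frame in a chart. -/
def Metric.localFrame (g : Metric n M) (φ : OpenPartialHomeomorph M (Coord n)) (y : Coord n)
    (i : Fin n) : Coord n :=
  jacInv φ y (Metric.frame g (φ.symm y) i)

variable (g : Metric n M)

theorem Metric.isMetricComp (D : Set (Coord n)) :
    IsMetricComp D (Metric.local g φ) (Metric.comp g φ) := fun _ _ _ _ => rfl

theorem Metric.isFrame (hφ : φ ∈ charts n M) (hy : y ∈ φ.target) :
    IsFrame (Metric.local g φ y) (Metric.localFrame g φ y) := by
  have h : IsFrame (Metric.form g (φ.symm y)) (Metric.frame g (φ.symm y)) :=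
    (Metric.exists_frame g (φ.symm y)).choose_spec
  have hg := Metric.local_apply (φ := φ) (y := y) g
  refine ⟨fun u v => ?_, fun u => ?_, ?_⟩
  · rw [hg, hg, h.symm]
  · simp only [hg, Metric.localFrame, jac_jacInv hφ hy, ← map_smul, ← map_sum, h.sum_smul,
      jacInv_jac hφ hy]
  · simp only [hg, Metric.localFrame, jac_jacInv hφ hy, h.sum_diag]

/-- The coordinate fields are smooth sections of the tangent bundle along the inverse chart, being
its tangent map applied to constant fields; a smooth bundle metric evaluated on smooth sections is
smooth. -/
theorem Metric.smooth_local (hφ : φ ∈ charts n M) :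
    ContDiffOn ℝ ∞ (Metric.local g φ) φ.target := by
  refine contDiffOn_clm_apply₂ fun u v => ?_
  have hsec : ∀ u : Coord n, ContMDiffOn (𝓡 n) (𝓡 n).tangent ∞ (fun y : Coord n =>
      (⟨φ.symm y, jac φ y u⟩ : TangentBundle (𝓡 n) M)) φ.target := by
    intro u
    have h1 := (contMDiffOn_symm_of_mem_maximalAtlas hφ).contMDiffOn_tangentMapWithin (m := ∞)
      (by simp) φ.open_target.uniqueMDiffOn
    have h2 : ContMDiffOn (𝓡 n) (𝓡 n).tangent ∞ (fun y : Coord n =>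
        (⟨y, u⟩ : TangentBundle (𝓡 n) (Coord n))) φ.target :=
      contMDiffOn_vectorSpace_iff_contDiffOn.2 contDiffOn_const
    refine (h1.comp h2 fun y hy => hy).congr fun y hy => ?_
    simp only [Function.comp, tangentMapWithin, mfderivWithin_of_mem_nhds
      (φ.open_target.mem_nhds hy)]
    rfl
  have h := ContMDiffOn.clm_bundle_apply₂ (F₁ := Coord n) (F₂ := Coord n)
    (F₃ := ℝ) (E₃ := Bundle.Trivial M ℝ) (n := ∞) (IB := 𝓡 n)
    (b := φ.symm) (ψ := fun y => g.inner (φ.symm y)) (s := φ.target)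
    (v := fun y => jac φ y u) (w := fun y => jac φ y v)
    (g.contMDiff.comp_contMDiffOn (contMDiffOn_symm_of_mem_maximalAtlas hφ)) (hsec u) (hsec v)
  intro y hy
  have h3 := h y hy
  simp only [Bundle.contMDiffWithinAt_totalSpace] at h3
  exact contMDiffWithinAt_iff_contDiffWithinAt.1 h3.2

theorem Metric.localGeometry (hφ : φ ∈ charts n M) {D : Set (Coord n)} (hD : IsOpen D)
    (hs : D ⊆ φ.target) : LocalGeometry D (Metric.local g φ)
      (leviCivita (Metric.local g φ) (Metric.localFrame g φ)) (Metric.localFrame g φ) :=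
  SuperInt.localGeometry hD ((Metric.smooth_local g hφ).mono hs)
    fun _ hy => Metric.isFrame g hφ (hs hy)

theorem Metric.isConstCurv {κ : ℝ} (hκ : HasConstantCurvature g κ) (hφ : φ ∈ charts n M) :
    IsConstCurv φ.target (Metric.local g φ)
      (leviCivita (Metric.local g φ) (Metric.localFrame g φ)) κ :=
  (Metric.isMetricComp g _).isConstCurv
    (Metric.localGeometry g hφ φ.open_target subset_rfl) (hκ φ hφ)

/-- The frames in both charts represent one frame chosen at each point of M, so the differential of
the transition map carries one exactly to the other, without an orthogonal matrix in between. -/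
theorem Metric.coordinateChange (hφ' : φ' ∈ charts n M) (hφ : φ ∈ charts n M) :
    CoordinateChange (overlap φ' φ) φ.target (transition φ' φ) (Metric.local g φ')
      (Metric.local g φ) (Metric.localFrame g φ') (Metric.localFrame g φ) where
  isOpen := isOpen_overlap
  mapsTo _ hy := transition_mem hy
  smooth := smooth_transition hφ' hφ
  metric y hy u v := by
    rw [Metric.local_apply, Metric.local_apply, symm_transition hy, jac_transition hφ' hφ hy, jac_transition hφ' hφ hy]
  frame y hy i := by
    rw [Metric.localFrame, Metric.localFrame, transition_jacInv hφ' hφ hy, symm_transition hy]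

/-- A multilinear form of rank `3` as an iterated linear map. -/
def trilinear (A : MultilinearMap ℝ (fun _ : Fin 3 => Coord n) ℝ) :
    Coord n →L[ℝ] Coord n →L[ℝ] Coord n →L[ℝ] ℝ :=
  (LinearMap.mk₂ ℝ (fun u v : Coord n => LinearMap.toContinuousLinearMap
      (A.toLinearMap ![u, v, 0] 2))
    (fun a b v => by
      ext w
      refine (congrArg A ?_).trans ((A.map_update_add ![0, v, w] 0 a b).trans
        (congrArg₂ _ (congrArg A ?_) (congrArg A ?_))) <;> (ext r; fin_cases r <;> rfl))
    (fun r a v => by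
      ext w
      refine (congrArg A ?_).trans ((A.map_update_smul ![0, v, w] 0 r a).trans
        (congrArg _ (congrArg A ?_))) <;> (ext r; fin_cases r <;> rfl))
    (fun u a b => by
      ext w
      refine (congrArg A ?_).trans ((A.map_update_add ![u, 0, w] 1 a b).trans
        (congrArg₂ _ (congrArg A ?_) (congrArg A ?_))) <;> (ext r; fin_cases r <;> rfl))
    (fun r u a => by
      ext w
      refine (congrArg A ?_).trans ((A.map_update_smul ![u, 0, w] 1 r a).trans
        (congrArg _ (congrArg A ?_))) <;> (ext r; fin_cases r <;> rfl))).toContinuousBilinearMap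

theorem trilinear_apply (A : MultilinearMap ℝ (fun _ : Fin 3 => Coord n) ℝ) (u v w : Coord n) :
    trilinear A u v w = A ![u, v, w] := by
  change A (Function.update ![u, v, 0] 2 w) = _
  congr 1
  ext r
  fin_cases r <;> rfl

/-- The pullback of a trilinear form by a linear map. -/
def pullThree (A : Coord n →L[ℝ] Coord n →L[ℝ] Coord n →L[ℝ] ℝ) (J : Coord n →L[ℝ] Coord n) :
    Coord n →L[ℝ] Coord n →L[ℝ] Coord n →L[ℝ] ℝ :=
  (ContinuousLinearMap.compL ℝ (Coord n) (Coord n →L[ℝ] ℝ) (Coord n →L[ℝ] ℝ)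
    ((ContinuousLinearMap.compL ℝ (Coord n) (Coord n) ℝ).flip J)).comp (A.bilinearComp J J)

/-- A tensor field of rank `3` as a field of trilinear forms on the model space. -/
def TensorField.form (T : TensorField n 3 M) (x : M) :
    Coord n →L[ℝ] Coord n →L[ℝ] Coord n →L[ℝ] ℝ := trilinear (T x)

/-- A tensor field of rank `3` in a chart. -/
def TensorField.local (T : TensorField n 3 M) (φ : OpenPartialHomeomorph M (Coord n))
    (y : Coord n) : Coord n →L[ℝ] Coord n →L[ℝ] Coord n →L[ℝ] ℝ :=
  pullThree (TensorField.form T (φ.symm y)) (jac φ y)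

variable (T : TensorField n 3 M)

theorem TensorField.local_apply (u v w : Coord n) : TensorField.local T φ y u v w =
    TensorField.form T (φ.symm y) (jac φ y u) (jac φ y v) (jac φ y w) := rfl

theorem TensorField.isThreeComp (D : Set (Coord n)) :
    IsThreeComp D (TensorField.local T φ) (TensorField.comp T φ) := by
  intro y _ idx
  rw [TensorField.local_apply, TensorField.form]
  refine Eq.trans ?_ (trilinear_apply _ _ _ _).symm
  rw [TensorField.comp]
  congr 1
  ext r
  fin_cases r <;> rfl

theorem TensorField.smooth_local (hT : TensorField.IsSmooth T) (hφ : φ ∈ charts n M) :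
    ContDiffOn ℝ ∞ (TensorField.local T φ) φ.target := by
  refine contDiffOn_clm_apply₂ fun u v => contDiffOn_clm_apply.2 fun w => ?_
  have h : ∀ y ∈ φ.target, TensorField.local T φ y u v w =
      ∑ a, ∑ b, ∑ c, u a * v b * w c * TensorField.comp T φ y ![a, b, c] := by
    intro y hy
    rw [bilin_eq_sum (TensorField.local T φ y) u v]
    simp only [sum_apply, smul_apply]
    refine Finset.sum_congr rfl fun a _ => Finset.sum_congr rfl fun b _ => ?_
    rw [← sum_coord_mul (TensorField.local T φ y (ε a) (ε b)), smul_eq_mul, Finset.mul_sum]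
    refine Finset.sum_congr rfl fun c _ => ?_
    rw [TensorField.isThreeComp T _ y hy, ← mul_assoc]
    rfl
  refine ContDiffOn.congr ?_ h
  exact ContDiffOn.sum fun a _ => ContDiffOn.sum fun b _ => ContDiffOn.sum fun c _ =>
    contDiffOn_const.mul (hT φ hφ _)

theorem TensorField.local_transition (hφ' : φ' ∈ charts n M) (hφ : φ ∈ charts n M)
    (hy : y ∈ overlap φ' φ) (u v w : Coord n) : TensorField.local T φ' y u v w =
      TensorField.local T φ (transition φ' φ y) (fderiv ℝ (transition φ' φ) y u)
        (fderiv ℝ (transition φ' φ) y v) (fderiv ℝ (transition φ' φ) y w) := by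
  rw [TensorField.local_apply, TensorField.local_apply, symm_transition hy,
    jac_transition hφ' hφ hy, jac_transition hφ' hφ hy, jac_transition hφ' hφ hy]

variable {g T}

theorem IsStructureTensor.localStructure {S : System g} (hT : IsStructureTensor S T)
    (hφ : φ ∈ charts n M) :
    LocalStructure φ.target (TensorField.local T φ) (Metric.localFrame g φ) where
  smooth := TensorField.smooth_local T hT.smooth hφ
  symm y _ u v w := by
    simp only [TensorField.local_apply, TensorField.form]
    exact (trilinear_apply _ _ _ _).trans ((hT.symm _ _ _ _).trans (trilinear_apply _ _ _ _).symm)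
  traceFree y hy w := by
    have h : (∑ i, TensorField.local T φ y (Metric.localFrame g φ y i) (Metric.localFrame g φ y i))
        = 0 := by
      ext1 w
      rw [← sum_coord_mul _ w]
      refine Finset.sum_eq_zero fun k _ => ?_
      rw [sum_apply, ← trace12_eq (Metric.isMetricComp g _) (TensorField.isThreeComp T _) hy
        (Metric.isFrame g hφ hy), hT.traceFree φ hφ y hy, mul_zero]
    rw [← sum_apply, h, zero_apply]

theorem SolvesWilczynski.localPotential {V : M → ℝ} (hV : SolvesWilczynski g T V)
    (hs : ContMDiff (𝓡 n) 𝓘(ℝ, ℝ) ∞ V) (hφ : φ ∈ charts n M) :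
    LocalPotential φ.target (Metric.local g φ)
      (leviCivita (Metric.local g φ) (Metric.localFrame g φ)) (TensorField.local T φ)
      (Metric.localFrame g φ) (V ∘ φ.symm) :=
  localPotential_of_components (Metric.localGeometry g hφ φ.open_target subset_rfl)
    (Metric.isMetricComp g _) (TensorField.isThreeComp T _)
    (contMDiffOn_iff_contDiffOn.1
      (hs.comp_contMDiffOn (contMDiffOn_symm_of_mem_maximalAtlas hφ))) (hV φ hφ)

end Charts

end SuperInt
end

noncomputable section
set_option maxSynthPendingDepth 3

namespace SuperInt

/-! ### Solutions of the equation for the potential are determined by their jets -/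

section Jets

variable {n : ℕ} {D : Set (Coord n)} {g : Coord n → Coord n →L[ℝ] Coord n →L[ℝ] ℝ}
  {Γ : Coord n → Coord n →L[ℝ] Coord n →L[ℝ] Coord n}
  {T : Coord n → Coord n →L[ℝ] Coord n →L[ℝ] Coord n →L[ℝ] ℝ} {e : Coord n → Fin n → Coord n}
  {V W : Coord n → ℝ} {y : Coord n}

/-- The space of jets of solutions. -/
abbrev Jet (n : ℕ) : Type := ℝ × (Coord n →L[ℝ] ℝ) × ℝ

/-- The jet of a solution at a point. -/
def jet (Γ : Coord n → Coord n →L[ℝ] Coord n →L[ℝ] Coord n)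
    (T : Coord n → Coord n →L[ℝ] Coord n →L[ℝ] Coord n →L[ℝ] ℝ) (e : Coord n → Fin n → Coord n)
    (V : Coord n → ℝ) (y : Coord n) : Jet n :=
  (V y, fderiv ℝ V y, auxPotential Γ T e V y)

/-- The connection on jets for which the jets of solutions are parallel. -/
def jetConnection (A : Coord n →L[ℝ] Coord n →L[ℝ] Coord n) (X : Coord n →L[ℝ] Coord n)
    (g : Coord n →L[ℝ] Coord n →L[ℝ] ℝ) : Coord n →L[ℝ] Jet n →L[ℝ] Jet n :=
  (LinearMap.mk₂ ℝ (fun (w : Coord n) (q : Jet n) =>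
      ((q.2.1 w, q.2.1.comp (A w) + q.2.2 • g w, q.2.1 (X w)) : Jet n))
    (fun a b q => by
      ext <;> simp; ring)
    (fun r a q => by
      ext <;> simp; ring)
    (fun a p q => by
      ext <;> simp; ring)
    (fun r a q => by
      ext <;> simp; ring)).toContinuousBilinearMap

theorem jetConnection_apply (A : Coord n →L[ℝ] Coord n →L[ℝ] Coord n) (X : Coord n →L[ℝ] Coord n)
    (g : Coord n →L[ℝ] Coord n →L[ℝ] ℝ) (w : Coord n) (q : Jet n) :
    jetConnection A X g w q = (q.2.1 w, q.2.1.comp (A w) + q.2.2 • g w, q.2.1 (X w)) := rfl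

theorem LocalGeometry.continuousOn_jet (hG : LocalGeometry D g Γ e) (hT : LocalStructure D T e)
    (hV : ContDiffOn ℝ ∞ V D) : ContinuousOn (jet Γ T e V) D :=
  hV.continuousOn.prodMk ((ContDiffOn.fderiv_infty hV hG.isOpen).continuousOn.prodMk
    (hG.smooth_auxPotential hT hV).continuousOn)

/-- The jet is parallel for `jetConnection`, and a parallel section that vanishes at one point of a
ball vanishes on the ball. -/
theorem LocalPotential.eventually_zero (hG : LocalGeometry D g Γ e) (hT : LocalStructure D T e)
    (hn : 2 ≤ n) (hV : LocalPotential D g Γ T e V) (hy : y ∈ D) (h0 : jet Γ T e V y = 0) :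
    ∀ᶠ z in nhds y, V z = 0 := by
  obtain ⟨r, hr, hb⟩ := Metric.isOpen_iff.1 hG.isOpen y hy
  have hθ : ContDiffOn ℝ ∞ (fun z => jetConnection (connField g Γ T e z) (xField g Γ T e z) (g z))
      D := by
    refine contDiffOn_clm_apply.2 fun w => contDiffOn_clm_apply.2 fun q => ?_
    have h1 : ContDiffOn ℝ ∞ (fun z => q.2.1.comp (connField g Γ T e z w) + q.2.2 • g z w) D :=
      (contDiffOn_const.clm_comp ((hG.smooth_conn hT).clm_apply contDiffOn_const)).add
        ((hG.smooth_g.clm_apply contDiffOn_const).const_smul q.2.2)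
    have h2 : ContDiffOn ℝ ∞ (fun z => q.2.1 (xField g Γ T e z w)) D :=
      contDiffOn_const.clm_apply ((hG.smooth_xField hT).clm_apply contDiffOn_const)
    have h3 : ContDiffOn ℝ ∞ (fun _ : Coord n => q.2.1 w) D := contDiffOn_const
    exact h3.prodMk (h1.prodMk h2)
  have h := eq_zero_of_hasFDerivAt (x₀ := y) (r := r) (u := jet Γ T e V) (p := y)
    (hθ.continuousOn.mono hb) (fun z hz => ?_) (Metric.mem_ball_self hr) h0
  · filter_upwards [Metric.ball_mem_nhds y hr] with z hz
    exact congrArg Prod.fst (h z hz)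
  · have hz := hb hz
    have d1 := (ContDiffOn.differentiableAt_of_mem hV.smooth hG.isOpen hz).hasFDerivAt
    have d2 := (ContDiffOn.differentiableAt_of_mem (ContDiffOn.fderiv_infty hV.smooth hG.isOpen)
      hG.isOpen hz).hasFDerivAt
    have d3 := (ContDiffOn.differentiableAt_of_mem (hG.smooth_auxPotential hT hV.smooth) hG.isOpen
      hz).hasFDerivAt
    refine (d1.prodMk (d2.prodMk d3)).congr_fderiv ?_
    ext1 w
    refine Prod.ext rfl (Prod.ext ?_ (hG.fderiv_auxPotential hT hn hV hz w))
    ext1 v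
    exact hV.hess_eq hz w v

theorem jet_add (hD : IsOpen D) (hV : ContDiffOn ℝ ∞ V D) (hW : ContDiffOn ℝ ∞ W D) (hy : y ∈ D) :
    jet Γ T e (V + W) y = jet Γ T e V y + jet Γ T e W y := by
  have h1 : ∀ z ∈ D, fderiv ℝ (V + W) z = fderiv ℝ V z + fderiv ℝ W z := fun z hz =>
    fderiv_add (ContDiffOn.differentiableAt_of_mem hV hD hz)
      (ContDiffOn.differentiableAt_of_mem hW hD hz)
  have h2 := fderiv_eq_of_eqOn hD h1 hy
  rw [fderiv_fun_add (ContDiffOn.differentiableAt_of_mem (ContDiffOn.fderiv_infty hV hD) hD hy)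
    (ContDiffOn.differentiableAt_of_mem (ContDiffOn.fderiv_infty hW hD) hD hy)] at h2
  refine Prod.ext rfl (Prod.ext (h1 y hy) ?_)
  simp only [jet, auxPotential, frameLaplacian, h1 y hy, h2, add_apply, Prod.snd_add,
    add_sub_add_comm, Finset.sum_add_distrib]
  ring

theorem jet_smul (hD : IsOpen D) (c : ℝ) (hV : ContDiffOn ℝ ∞ V D) (hy : y ∈ D) :
    jet Γ T e (c • V) y = c • jet Γ T e V y := by
  have h1 : ∀ z ∈ D, fderiv ℝ (c • V) z = c • fderiv ℝ V z := fun z hz =>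
    fderiv_const_smul (ContDiffOn.differentiableAt_of_mem hV hD hz) c
  have h2 := fderiv_eq_of_eqOn hD h1 hy
  rw [fderiv_fun_const_smul
    (ContDiffOn.differentiableAt_of_mem (ContDiffOn.fderiv_infty hV hD) hD hy)] at h2
  refine Prod.ext rfl (Prod.ext (h1 y hy) ?_)
  simp only [jet, auxPotential, frameLaplacian, h1 y hy, h2, smul_apply, Prod.smul_snd,
    smul_eq_mul, ← mul_sub, ← Finset.mul_sum]
  ring

end Jets

/-! ### Global solutions on a connected manifold realise every jet -/

section Surjective

variable {n : ℕ} {M : Type*} [TopologicalSpace M] [ChartedSpace (Coord n) M]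
  [IsManifold (𝓡 n) ∞ M] {g : Metric n M} {T : TensorField n 3 M} {S : System g}
  {φ : OpenPartialHomeomorph M (Coord n)} {y : Coord n}

/-- The jet in a chart. -/
def chartJet (g : Metric n M) (T : TensorField n 3 M) (φ : OpenPartialHomeomorph M (Coord n))
    (V : M → ℝ) (y : Coord n) : Jet n :=
  jet (leviCivita (Metric.local g φ) (Metric.localFrame g φ)) (TensorField.local T φ)
    (Metric.localFrame g φ) (V ∘ φ.symm) y

theorem eventually_zero_of_chartJet (hn : 2 ≤ n) (hT : IsStructureTensor S T) {V : M → ℝ}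
    (hs : ContMDiff (𝓡 n) 𝓘(ℝ, ℝ) ∞ V) (hV : SolvesWilczynski g T V) (hφ : φ ∈ charts n M)
    (hy : y ∈ φ.target) (h : chartJet g T φ V y = 0) : ∀ᶠ x in nhds (φ.symm y), V x = 0 := by
  have h1 := (hV.localPotential hs hφ).eventually_zero
    (Metric.localGeometry g hφ φ.open_target subset_rfl) (hT.localStructure hφ) hn hy h
  have h2 := (φ.continuousAt (φ.map_target hy)).eventually
    (p := fun z => V (φ.symm z) = 0) (by rwa [φ.right_inv hy])
  filter_upwards [h2, φ.open_source.mem_nhds (φ.map_target hy)] with x hx hxs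
  rwa [φ.left_inv hxs] at hx

/-- A solution whose jet vanishes at one point vanishes. -/
theorem eq_zero_of_chartJet [ConnectedSpace M] (hn : 2 ≤ n) (hT : IsStructureTensor S T)
    {V : M → ℝ} (hs : ContMDiff (𝓡 n) 𝓘(ℝ, ℝ) ∞ V) (hV : SolvesWilczynski g T V)
    (hφ : φ ∈ charts n M) (hy : y ∈ φ.target) (h : chartJet g T φ V y = 0) : V = 0 := by
  set Z : Set M := {x | ∀ᶠ z in nhds x, V z = 0} with hZ
  have hopen : IsOpen Z := isOpen_iff_mem_nhds.2 fun x hx => eventually_eventually_nhds.2 hx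
  -- At a limit point of Z the jet in a chart vanishes by continuity, since it vanishes wherever V
  -- is locally zero; then V is zero near that point too.
  have hclosed : IsClosed Z := by
    refine isClosed_of_closure_subset fun x hx => ?_
    set ψ := chartAt (Coord n) x
    have hψ : ψ ∈ charts n M := IsManifold.chart_mem_maximalAtlas x
    have hxs : x ∈ ψ.source := mem_chart_source _ x
    have hc : ContinuousOn (chartJet g T ψ V) ψ.target :=
      (Metric.localGeometry g hψ ψ.open_target subset_rfl).continuousOn_jet
        (hT.localStructure hψ) (hV.localPotential hs hψ).smooth
    have hc' : ContinuousAt (fun z => chartJet g T ψ V (ψ z)) x :=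
      ContinuousAt.comp (hc.continuousAt (ψ.open_target.mem_nhds (ψ.map_source hxs)))
        (ψ.continuousAt hxs)
    have hzero : chartJet g T ψ V (ψ x) = 0 := by
      have hmem : x ∈ closure (Z ∩ ψ.source) :=
        IsOpen.closure_inter ψ.open_source ⟨hx, hxs⟩
      have h3 : Set.MapsTo (fun z => chartJet g T ψ V (ψ z)) (Z ∩ ψ.source) {0} := by
        rintro z ⟨hz, hzs⟩
        have h4 : V ∘ ψ.symm =ᶠ[nhds (ψ z)] fun _ => 0 := by
          have h5 := (ψ.symm.continuousAt (ψ.map_source hzs)).eventually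
            (p := fun z => V z = 0) (by rw [ψ.left_inv hzs]; exact hz)
          exact h5
        have h6 : fderiv ℝ (V ∘ ψ.symm) =ᶠ[nhds (ψ z)] fun _ => 0 := by
          filter_upwards [h4.fderiv (𝕜 := ℝ)] with w hw
          exact hw.trans (by simp)
        have h7 : fderiv ℝ (fderiv ℝ (V ∘ ψ.symm)) (ψ z) = 0 := by
          exact h6.fderiv_eq.trans (by simp)
        refine Prod.ext h4.eq_of_nhds (Prod.ext h6.eq_of_nhds ?_)
        simp [chartJet, jet, auxPotential, frameLaplacian, h7, h6.eq_of_nhds]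
      simpa using hc'.continuousWithinAt.mem_closure hmem h3
    have := eventually_zero_of_chartJet hn hT hs hV hψ (ψ.map_source hxs) hzero
    rwa [ψ.left_inv hxs] at this
  have huniv : Z = Set.univ := IsClopen.eq_univ ⟨hclosed, hopen⟩
    ⟨_, eventually_zero_of_chartJet hn hT hs hV hφ hy h⟩
  funext x
  have : x ∈ Z := huniv ▸ Set.mem_univ x
  exact this.self_of_nhds

/-- The map from solutions to jets at a point is linear and, on connected M, injective. Both spaces
have dimension n + 2, so it is onto. -/
theorem IsNondegenerate.jetsSurjective [ConnectedSpace M] (hn : 2 ≤ n) (hT : IsNondegenerate S T)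
    (hφ : φ ∈ charts n M) : JetsSurjective φ.target (Metric.local g φ)
      (leviCivita (Metric.local g φ) (Metric.localFrame g φ)) (TensorField.local T φ)
      (Metric.localFrame g φ) := by
  intro y hy β μ
  obtain ⟨L, hL, hLV⟩ := hT.solutions
  have hs := fun V : L => ((hLV V V.2).2.localPotential (hLV V V.2).1 hφ).smooth
  let J : L →ₗ[ℝ] Jet n :=
    { toFun := fun V => chartJet g T φ V y
      map_add' := fun V W => jet_add φ.open_target (hs V) (hs W) hy
      map_smul' := fun c V => jet_smul φ.open_target c (hs V) hy }
  have hJ : Function.Injective J := (injective_iff_map_eq_zero J).2 fun V hV =>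
    Subtype.ext (eq_zero_of_chartJet hn hT.isStructureTensor (hLV V V.2).1 (hLV V V.2).2 hφ hy hV)
  -- `finrank` is 0 on infinite-dimensional spaces, so the value n + 2 forces finite dimension.
  have : FiniteDimensional ℝ L := Module.finite_of_finrank_pos (by omega)
  have hdim : Module.finrank ℝ L = Module.finrank ℝ (Jet n) := by
    rw [hL, Module.finrank_prod, Module.finrank_prod,
      ← (LinearMap.toContinuousLinearMap (𝕜 := ℝ) (E := Coord n) (F' := ℝ)).finrank_eq,
      Module.finrank_linearMap]
    simp
    omega
  obtain ⟨V, hV⟩ := (LinearMap.injective_iff_surjective_of_finrank_eq_finrank hdim).1 hJ (0, β, μ)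
  refine ⟨_, (hLV V V.2).2.localPotential (hLV V V.2).1 hφ, ?_, ?_⟩
  · exact congrArg (fun q : Jet n => q.2.1) hV
  · exact congrArg (fun q : Jet n => q.2.2) hV

end Surjective

end SuperInt
end

noncomputable section
set_option maxSynthPendingDepth 3

namespace SuperInt

/-! ### The structure functions in a chart -/

section LocalSystems

variable {n : ℕ} {D D' : Set (Coord n)} {g : Coord n → Coord n →L[ℝ] Coord n →L[ℝ] ℝ}
  {T : Coord n → Coord n →L[ℝ] Coord n →L[ℝ] Coord n →L[ℝ] ℝ} {e : Coord n → Fin n → Coord n}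
  {G : MetricComp n} {c : Comp n 3} {κ : ℝ} {Φ C : Coord n → ℝ} {y : Coord n}

local notation "ε" i:max => EuclideanSpace.single i (1 : ℝ)

/-- A non-degenerate system on an open set of the model space. -/
structure LocalSystem (D : Set (Coord n)) (g : Coord n → Coord n →L[ℝ] Coord n →L[ℝ] ℝ)
    (T : Coord n → Coord n →L[ℝ] Coord n →L[ℝ] Coord n →L[ℝ] ℝ) (e : Coord n → Fin n → Coord n)
    (κ : ℝ) : Prop where
  geometry : LocalGeometry D g (leviCivita g e) e
  tensor : LocalStructure D T e
  jets : JetsSurjective D g (leviCivita g e) T e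
  curvature : IsConstCurv D g (leviCivita g e) κ

/-- `covB` is a plain function of its arguments. It is repackaged as a linear map, first in the two
arguments to be interchanged and then in the remaining one, in order to pass from basis vectors to
all vectors. -/
theorem covB_codazzi_of_basis {Γ : Coord n → Coord n →L[ℝ] Coord n →L[ℝ] Coord n}
    {A : Coord n → Coord n →L[ℝ] Coord n →L[ℝ] ℝ}
    (h : ∀ i j k, covB Γ A y (ε k) (ε i) (ε j) = covB Γ A y (ε j) (ε i) (ε k)) (u v w : Coord n) :
    covB Γ A y w u v = covB Γ A y v u w := by
  have h1 : ∀ i v w, covB Γ A y w (ε i) v = covB Γ A y v (ε i) w := by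
    intro i v w
    set L : Coord n →L[ℝ] Coord n →L[ℝ] ℝ := (fderiv ℝ A y).flip (ε i) -
      (A y).comp ((Γ y).flip (ε i)) -
      (ContinuousLinearMap.compL ℝ (Coord n) (Coord n) ℝ (A y (ε i))).comp (Γ y) with hL
    have hLe : L = L.flip := bilin_ext fun k j => h i j k
    exact congrArg (fun B => B w v) hLe
  set P : Coord n → Coord n → Coord n →L[ℝ] ℝ := fun w v => (fderiv ℝ A y w).flip v -
    ((A y).flip v).comp (Γ y w) - (A y).flip (Γ y w v) with hP
  have h2 : P w v = P v w := by
    ext1 u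
    rw [← sum_coord_mul _ u, ← sum_coord_mul _ u]
    exact Finset.sum_congr rfl fun i _ => congrArg _ (h1 i v w)
  exact DFunLike.congr_fun h2 u

theorem LocalPotential.mono {Γ : Coord n → Coord n →L[ℝ] Coord n →L[ℝ] Coord n}
    {V : Coord n → ℝ} (hV : LocalPotential D g Γ T e V) (h : D' ⊆ D) :
    LocalPotential D' g Γ T e V :=
  ⟨hV.smooth.mono h, fun y hy => hV.eq y (h hy)⟩

/-- The tensor `C` in a chart. -/
def cField (g : Coord n → Coord n →L[ℝ] Coord n →L[ℝ] ℝ)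
    (T : Coord n → Coord n →L[ℝ] Coord n →L[ℝ] Coord n →L[ℝ] ℝ) (e : Coord n → Fin n → Coord n)
    (κ : ℝ) (Φ : Coord n → ℝ) : Coord n → Coord n →L[ℝ] Coord n →L[ℝ] ℝ :=
  qField g (xHat g (leviCivita g e) T e κ) (((n : ℝ) - 2) / 2)
    fun y => zPhi g (leviCivita g e) T e κ y + Φ y

/-- The differential of a function `Φ` for which `C` is a Codazzi tensor. -/
def phiForm (g : Coord n → Coord n →L[ℝ] Coord n →L[ℝ] ℝ)
    (T : Coord n → Coord n →L[ℝ] Coord n →L[ℝ] Coord n →L[ℝ] ℝ) (e : Coord n → Fin n → Coord n)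
    (κ : ℝ) (y : Coord n) : Coord n →L[ℝ] ℝ :=
  -((((n : ℝ) - 2) / 2) • devField g (leviCivita g e) T e κ y) -
    fderiv ℝ (zPhi g (leviCivita g e) T e κ) y

namespace LocalSystem

theorem mono (hS : LocalSystem D g T e κ) (hD' : IsOpen D') (h : D' ⊆ D) :
    LocalSystem D' g T e κ where
  geometry := localGeometry hD' (hS.geometry.smooth_g.mono h) fun y hy => hS.geometry.frame y (h hy)
  tensor := ⟨hS.tensor.smooth.mono h, fun y hy => hS.tensor.symm y (h hy),
    fun y hy => hS.tensor.traceFree y (h hy)⟩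
  jets y hy β μ := by
    obtain ⟨V, hV, h1⟩ := hS.jets y (h hy) β μ
    exact ⟨V, hV.mono h, h1⟩
  curvature y hy := hS.curvature y (h hy)

variable (hS : LocalSystem D g T e κ)
include hS

theorem smooth_zPhi : ContDiffOn ℝ ∞ (zPhi g (leviCivita g e) T e κ) D :=
  hS.geometry.smooth_zPhi hS.tensor

theorem smooth_cField (hΦ : ContDiffOn ℝ ∞ Φ D) : ContDiffOn ℝ ∞ (cField g T e κ Φ) D :=
  ((hS.geometry.smooth_g.clm_comp (hS.geometry.smooth_xHat hS.tensor)).const_smul _).add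
    ((hS.smooth_zPhi.add hΦ).smul hS.geometry.smooth_g)

theorem cField_apply (hn : 2 ≤ n) (hy : y ∈ D) (u v : Coord n) : cField g T e κ Φ y u v =
    zForm κ (g y) (T y) (e y) u v + Φ y * g y u v :=
  (hS.geometry.zForm_eq_qField hS.tensor hn hS.jets hS.curvature Φ hy u v).symm

theorem cField_symm (hn : 2 ≤ n) (hy : y ∈ D) (u v : Coord n) :
    cField g T e κ Φ y u v = cField g T e κ Φ y v u := by
  have hs := (hS.geometry.frame y hy).symm
  have hX := (hS.geometry.curvatureEq hS.tensor hn hS.jets hS.curvature hy).X_symm u v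
  simp only [cField, qField, add_apply, smul_apply, ContinuousLinearMap.comp_apply, hX, hs u v]

theorem isTwoComp_cTensor (hn : 2 ≤ n) (hGg : IsMetricComp D g G) (hc : IsThreeComp D T c) :
    IsTwoComp D (cField g T e κ Φ) (cTensor G c Φ) := by
  intro y hy idx
  rw [cTensor, zTensor_eq hGg hc hy (hS.geometry.frame y hy) hS.geometry hS.curvature,
    hS.cField_apply hn hy, hGg y hy]

/-- The criterion for a X + ψ g with a = (n-2)/2 and ψ the sum of Φ and the trace coefficient of Z,
solved for dΦ. -/
theorem cField_codazzi_iff (hn : 2 ≤ n) (hΦ : ContDiffOn ℝ ∞ Φ D) (hy : y ∈ D) :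
    (∀ u v w, covB (leviCivita g e) (cField g T e κ Φ) y w u v =
      covB (leviCivita g e) (cField g T e κ Φ) y v u w) ↔ fderiv ℝ Φ y = phiForm g T e κ y := by
  have hD := hS.geometry.isOpen
  rw [cField, hS.geometry.qField_codazzi_iff hS.tensor hn hS.jets hS.curvature
    (hS.smooth_zPhi.add hΦ) _ hy, fderiv_fun_add
    (ContDiffOn.differentiableAt_of_mem hS.smooth_zPhi hD hy)
    (ContDiffOn.differentiableAt_of_mem hΦ hD hy), phiForm, eq_sub_iff_add_eq', DFunLike.ext_iff]
  rfl

theorem isCodazziTwo_iff (hn : 2 ≤ n) (hGg : IsMetricComp D g G) (hc : IsThreeComp D T c)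
    (hΦ : ContDiffOn ℝ ∞ Φ D) : IsCodazziTwo G (cTensor G c Φ) D ↔
      ∀ y ∈ D, fderiv ℝ Φ y = phiForm g T e κ y := by
  have h2 := hS.isTwoComp_cTensor hn hGg hc (Φ := Φ)
  have hcov : ∀ y ∈ D, ∀ i j k, covD G (cTensor G c Φ) y ![i, j, k] =
      covB (leviCivita g e) (cField g T e κ Φ) y (ε k) (ε i) (ε j) := fun y hy i j k =>
    hS.geometry.covD_two hGg hy h2
      (ContDiffOn.differentiableAt_of_mem (hS.smooth_cField hΦ) hS.geometry.isOpen hy) _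
  refine forall₂_congr fun y hy => ?_
  rw [← hS.cField_codazzi_iff hn hΦ hy]
  refine ⟨fun h => covB_codazzi_of_basis fun i j k => ?_, fun h => ⟨fun i j => ?_, fun i j k => ?_⟩⟩
  · rw [← hcov y hy, ← hcov y hy]
    exact sub_eq_zero.1 (h.2 i j k)
  · rw [h2 y hy, h2 y hy]
    exact hS.cField_symm hn hy _ _
  · rw [hcov y hy, hcov y hy, h, sub_self]

theorem smooth_phiForm : ContDiffOn ℝ ∞ (phiForm g T e κ) D :=
  ((hS.geometry.smooth_devField hS.tensor).const_smul (((n : ℝ) - 2) / 2)).neg.sub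
    (ContDiffOn.fderiv_infty hS.smooth_zPhi hS.geometry.isOpen)

/-- A multiple of the closed deviation form plus an exact form. -/
theorem closed_phiForm (hn : 3 ≤ n) (hy : y ∈ D) (v w : Coord n) :
    fderiv ℝ (phiForm g T e κ) y v w = fderiv ℝ (phiForm g T e κ) y w v := by
  have hD := hS.geometry.isOpen
  have d1 := ContDiffOn.differentiableAt_of_mem
    (hS.geometry.smooth_devField hS.tensor (κ := κ)) hD hy
  have d2 := ContDiffOn.differentiableAt_of_mem
    (ContDiffOn.fderiv_infty hS.smooth_zPhi hD) hD hy
  have h := ((d1.hasFDerivAt.const_smul (((n : ℝ) - 2) / 2)).neg.sub d2.hasFDerivAt).fderiv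
  have h' : fderiv ℝ (phiForm g T e κ) y = _ := h
  rw [h']
  simp only [sub_apply, neg_apply, smul_apply]
  rw [hS.geometry.closed_devField hS.tensor hn hS.jets hS.curvature hy v w,
    fderiv_fderiv_symm hD hS.smooth_zPhi hy v w]

theorem hasPotentialTwo_iff (hn : 2 ≤ n) (hGg : IsMetricComp D g G) (hc : IsThreeComp D T c)
    (hC : ContDiffOn ℝ ∞ C D) : HasPotentialTwo G κ (cTensor G c Φ) C D ↔ ∀ y ∈ D, ∀ u v,
      fderiv ℝ (fderiv ℝ C) y u v - fderiv ℝ C y (leviCivita g e y u v) =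
        cField g T e κ Φ y u v - κ * C y * g y u v := by
  refine forall₂_congr fun y hy => ?_
  have hs := (hS.geometry.frame y hy).symm
  have h1 : ∀ i j, cTensor G c Φ y ![i, j] = cField g T e κ Φ y (ε j) (ε i) := fun i j => by
    rw [hS.isTwoComp_cTensor hn hGg hc y hy]
    exact hS.cField_symm hn hy _ _
  have h2 : ∀ i j, hess G C y ![i, j] = fderiv ℝ (fderiv ℝ C) y (ε j) (ε i) -
      fderiv ℝ C y (leviCivita g e y (ε j) (ε i)) := fun i j =>
    hS.geometry.hess_eq hGg hy (ContDiffOn.differentiableAt_of_mem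
      (ContDiffOn.fderiv_infty hC hS.geometry.isOpen) hS.geometry.isOpen hy) _
  simp only [h1, h2, hGg y hy]
  refine ⟨fun h u v => ?_, fun h i j => ?_⟩
  · have : fderiv ℝ (fderiv ℝ C) y - (ContinuousLinearMap.compL ℝ (Coord n) (Coord n) ℝ
        (fderiv ℝ C y)).comp (leviCivita g e y) = cField g T e κ Φ y - (κ * C y) • g y :=
      bilin_ext fun j i => by
        have := h i j
        rw [hs] at this
        simp only [sub_apply, smul_apply, smul_eq_mul, ContinuousLinearMap.comp_apply,
          ContinuousLinearMap.compL_apply]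
        linear_combination -this
    exact congrArg (fun B => B u v) this
  · rw [h, hs (ε i)]
    ring

/-- The tensor `B` in a chart. -/
theorem isThreeComp_bTensor (hn : 3 ≤ n) (hGg : IsMetricComp D g G) (hc : IsThreeComp D T c) :
    IsThreeComp D (fun y => bCLM (g y) (sField g T e y) (fderiv ℝ C y)) (bTensor G c C) :=
  fun _ hy idx => bTensor_eq hGg hc hy (hS.geometry.frame _ hy) hn idx

/-- The equation for C says that its Hessian is (n-2)/2 (X + κ) plus a multiple of g; this is all
that `bCLM_codazzi` uses about C. -/
theorem bField_codazzi (hn : 3 ≤ n) (hC : ContDiffOn ℝ ∞ C D)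
    (hp : ∀ y ∈ D, ∀ u v, fderiv ℝ (fderiv ℝ C) y u v - fderiv ℝ C y (leviCivita g e y u v) =
        cField g T e κ Φ y u v - κ * C y * g y u v) (hy : y ∈ D) (u v w z : Coord n) :
    covT (leviCivita g e) (fun y => bCLM (g y) (sField g T e y) (fderiv ℝ C y)) y z u v w =
      covT (leviCivita g e) (fun y => bCLM (g y) (sField g T e y) (fderiv ℝ C y)) y w u v z := by
  refine hS.geometry.bCLM_codazzi hS.tensor hn hS.jets hS.curvature
    (ContDiffOn.fderiv_infty hC hS.geometry.isOpen)
    (ψ := fun y => zPhi g (leviCivita g e) T e κ y + Φ y - κ * C y) hy (fun z w => ?_) u v w z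
  rw [hp y hy]
  simp only [cField, qField, add_apply, smul_apply, smul_eq_mul, ContinuousLinearMap.comp_apply]
  ring

theorem isCodazziThree (hn : 3 ≤ n) (hGg : IsMetricComp D g G) (hc : IsThreeComp D T c)
    (hC : ContDiffOn ℝ ∞ C D)
    (hp : ∀ y ∈ D, ∀ u v, fderiv ℝ (fderiv ℝ C) y u v - fderiv ℝ C y (leviCivita g e y u v) =
        cField g T e κ Φ y u v - κ * C y * g y u v) : IsCodazziThree G (bTensor G c C) D := by
  intro y hy
  have hb := hS.isThreeComp_bTensor hn hGg hc (C := C)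
  have db := ContDiffOn.differentiableAt_of_mem (hS.geometry.smooth_bCLM hS.tensor
    (ContDiffOn.fderiv_infty hC hS.geometry.isOpen)) hS.geometry.isOpen hy
  have hs := hS.geometry.bCLM_symm hS.tensor (by omega) hS.jets hy (fderiv ℝ C y)
  refine ⟨perm_invariant (fun i j k => ?_) fun i j k => ?_, fun i j k l => ?_⟩
  · rw [hb y hy, hb y hy]
    exact (hs _ _ _).1
  · rw [hb y hy, hb y hy]
    exact (hs _ _ _).2
  · rw [hS.geometry.covD_three hGg hy hb db, hS.geometry.covD_three hGg hy hb db, sub_eq_zero]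
    exact hS.bField_codazzi hn hC hp hy _ _ _ _

/-- Differentiating 4 κ g f adds 4 κ df ⊗ g. Under symmetrisation it cancels the κ-terms of weights
2, 1, 1, and only the symmetric tensor b remains. -/
theorem hasPotentialThree (hn : 3 ≤ n) (hGg : IsMetricComp D g G) (hc : IsThreeComp D T c)
    {f : Coord n → ℝ} (hf : ContDiffOn ℝ ∞ f D) {H : Coord n → Coord n →L[ℝ] Coord n →L[ℝ] ℝ}
    (hH : ContDiffOn ℝ ∞ H D)
    (hfH : ∀ y ∈ D, ∀ u v, fderiv ℝ (fderiv ℝ f) y u v - fderiv ℝ f y (leviCivita g e y u v) =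
      H y u v)
    (hcov : ∀ y ∈ D, ∀ u v w, covB (leviCivita g e) H y w u v =
      bCLM (g y) (sField g T e y) (fderiv ℝ C y) u v w - κ * (2 * fderiv ℝ f y w * g y u v +
        fderiv ℝ f y u * g y w v + g y w u * fderiv ℝ f y v)) :
    HasPotentialThree G κ (bTensor G c C) f D := by
  have hD := hS.geometry.isOpen
  have hA : IsTwoComp D (fun z => H z + (4 * κ * f z) • g z) (fun z (r : Fin 2 → Fin n) =>
      hess G f z r + 4 * κ * G z (r 0) (r 1) * f z) := by
    intro z hz r
    change hess G f z r + 4 * κ * G z (r 0) (r 1) * f z =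
      H z (ε (r 0)) (ε (r 1)) + (4 * κ * f z) * g z (ε (r 0)) (ε (r 1))
    rw [hS.geometry.hess_eq hGg hz (ContDiffOn.differentiableAt_of_mem
      (ContDiffOn.fderiv_infty hf hD) hD hz), hGg z hz, ← hfH z hz,
      fderiv_fderiv_symm hD hf hz, hS.geometry.Γ_comm z hz]
    ring
  intro y hy i j k
  have dg := ContDiffOn.differentiableAt_of_mem hS.geometry.smooth_g hD hy
  have df := ContDiffOn.differentiableAt_of_mem hf hD hy
  have dH := ContDiffOn.differentiableAt_of_mem hH hD hy
  have d4 := df.const_mul (4 * κ)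
  have dA : DifferentiableAt ℝ (fun z => H z + (4 * κ * f z) • g z) y := dH.add (d4.smul dg)
  have hcA : ∀ u v w, covB (leviCivita g e) (fun z => H z + (4 * κ * f z) • g z) y w u v =
      covB (leviCivita g e) H y w u v + 4 * κ * fderiv ℝ f y w * g y u v := by
    intro u v w
    have hd : fderiv ℝ (fun z => H z + (4 * κ * f z) • g z) y w u v = fderiv ℝ H y w u v +
        (4 * κ * f y * fderiv ℝ g y w u v + 4 * κ * fderiv ℝ f y w * g y u v) := by
      rw [fderiv_fun_add dH (d4.fun_smul dg), fderiv_fun_smul d4 dg, fderiv_const_mul df]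
      simp only [add_apply, smul_apply, smul_eq_mul, ContinuousLinearMap.smulRight_apply]
    rw [covB, covB, hd, hS.geometry.compat y hy]
    simp only [add_apply, smul_apply, smul_eq_mul]
    ring
  have hs := hS.geometry.bCLM_symm hS.tensor (by omega) hS.jets hy (fderiv ℝ C y)
  have hgs := (hS.geometry.frame y hy).symm
  rw [hS.isThreeComp_bTensor hn hGg hc y hy, young_three]
  simp only [hS.geometry.covD_two hGg hy hA dA, hcA, hcov y hy]
  simp only [Matrix.cons_val_zero, Matrix.cons_val_one, Matrix.cons_val]
  set b := bCLM (g y) (sField g T e y) (fderiv ℝ C y)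
  have s1 : b (ε j) (ε i) (ε k) = b (ε i) (ε j) (ε k) := (hs _ _ _).1.symm
  have s2 : b (ε i) (ε k) (ε j) = b (ε i) (ε j) (ε k) := (hs _ _ _).2.symm
  have s3 : b (ε k) (ε i) (ε j) = b (ε i) (ε j) (ε k) := (hs _ _ _).1.trans s2
  have s4 : b (ε j) (ε k) (ε i) = b (ε i) (ε j) (ε k) := (hs _ _ _).2.trans s1
  have s5 : b (ε k) (ε j) (ε i) = b (ε i) (ε j) (ε k) := (hs _ _ _).2.trans s3
  rw [s1, s2, s3, s4, s5, hgs (ε j) (ε i), hgs (ε k) (ε i), hgs (ε k) (ε j)]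
  ring

end LocalSystem

end LocalSystems

end SuperInt
end

noncomputable section
set_option maxSynthPendingDepth 3

namespace SuperInt

/-! ### Functions with a prescribed differential -/

section Primitives

variable {n : ℕ} {M : Type*} [TopologicalSpace M]
  {φ φ' : OpenPartialHomeomorph M (Coord n)} {y : Coord n} {U : Set M} {B : Set (Coord n)}
  {f : M → ℝ} {h : Coord n → ℝ}

theorem isOpen_chartDomain (hU : IsOpen U) : IsOpen (chartDomain φ U) :=
  φ.symm.continuousOn.isOpen_inter_preimage φ.open_target hU

theorem mem_chartDomain {x : M} (hx : x ∈ U) (hxs : x ∈ φ.source) : φ x ∈ chartDomain φ U :=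
  ⟨φ.map_source hxs, by rwa [φ.left_inv hxs]⟩

/-- The points of `M` with coordinates in `B`. -/
def region (φ : OpenPartialHomeomorph M (Coord n)) (B : Set (Coord n)) : Set M :=
  φ.source ∩ φ ⁻¹' B

theorem isOpen_region (hB : IsOpen B) : IsOpen (region φ B) :=
  φ.continuousOn.isOpen_inter_preimage φ.open_source hB

theorem region_subset (hB : B ⊆ chartDomain φ U) : region φ B ⊆ U := by
  rintro x ⟨hx, hxB⟩
  have h := (hB hxB).2
  rwa [φ.left_inv hx] at h

theorem chartDomain_region_overlap (hy : y ∈ chartDomain φ' (region φ B)) : y ∈ overlap φ' φ :=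
  ⟨hy.1, hy.2.1⟩

theorem eventually_comp_symm {p : M → Prop} (hy : y ∈ φ.target)
    (hp : ∀ᶠ x in nhds (φ.symm y), p x) : ∀ᶠ z in nhds y, p (φ.symm z) :=
  (φ.symm.continuousAt (x := y) hy).eventually hp

variable [ChartedSpace (Coord n) M]

theorem SmoothOn.chart (hf : SmoothOn n f U) (hφ : φ ∈ charts n M) :
    ContDiffOn ℝ ∞ (f ∘ φ.symm) (chartDomain φ U) :=
  contMDiffOn_iff_contDiffOn.1 (ContMDiffOn.comp hf
    ((contMDiffOn_symm_of_mem_maximalAtlas hφ).mono fun _ hy => hy.1) fun _ hy => hy.2)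

theorem smoothOn_region (hh : ContDiffOn ℝ ∞ h B) (hφ : φ ∈ charts n M) :
    SmoothOn n (h ∘ φ) (region φ B) :=
  (contMDiffOn_iff_contDiffOn.2 hh).comp
    ((contMDiffOn_of_mem_maximalAtlas hφ).mono Set.inter_subset_left) fun _ hx => hx.2

/-- `f` has the differential `η φ` in every chart `φ`. -/
def IsPrimitive (η : OpenPartialHomeomorph M (Coord n) → Coord n → Coord n →L[ℝ] ℝ) (f : M → ℝ)
    (U : Set M) : Prop :=
  ∀ φ ∈ charts n M, ∀ y ∈ chartDomain φ U, fderiv ℝ (f ∘ φ.symm) y = η φ y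

variable {η : OpenPartialHomeomorph M (Coord n) → Coord n → Coord n →L[ℝ] ℝ}

variable [IsManifold (𝓡 n) ∞ M]

/-- In a chart the difference has zero derivative on a ball, so it is constant there. -/
theorem IsPrimitive.eventually_sub_eq {f₁ f₂ : M → ℝ} {W : Set M} (hW : IsOpen W)
    (h₁ : SmoothOn n f₁ W) (h₂ : SmoothOn n f₂ W) (p₁ : IsPrimitive η f₁ W)
    (p₂ : IsPrimitive η f₂ W) {x : M} (hx : x ∈ W) :
    ∀ᶠ z in nhds x, f₁ z - f₂ z = f₁ x - f₂ x := by
  set φ := chartAt (Coord n) x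
  have hφ : φ ∈ charts n M := IsManifold.chart_mem_maximalAtlas x
  have hxs : x ∈ φ.source := mem_chart_source _ x
  have hD : IsOpen (chartDomain φ W) := isOpen_chartDomain hW
  obtain ⟨r, hr, hb⟩ := Metric.isOpen_iff.1 hD (φ x) (mem_chartDomain hx hxs)
  have hd : ∀ y ∈ _root_.Metric.ball (φ x) r,
      HasFDerivWithinAt (f₁ ∘ φ.symm - f₂ ∘ φ.symm) (0 : Coord n →L[ℝ] ℝ)
        (_root_.Metric.ball (φ x) r) y := by
    intro y hy
    have d₁ := (ContDiffOn.differentiableAt_of_mem (h₁.chart hφ) hD (hb hy)).hasFDerivAt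
    have d₂ := (ContDiffOn.differentiableAt_of_mem (h₂.chart hφ) hD (hb hy)).hasFDerivAt
    have d := (d₁.sub d₂).hasFDerivWithinAt (s := _root_.Metric.ball (φ x) r)
    rwa [p₁ φ hφ y (hb hy), p₂ φ hφ y (hb hy), sub_self] at d
  have hc : ∀ y ∈ _root_.Metric.ball (φ x) r, f₁ (φ.symm y) - f₂ (φ.symm y) = f₁ x - f₂ x := by
    intro y hy
    have := (convex_ball (φ x) r).is_const_of_fderivWithin_eq_zero (𝕜 := ℝ)
      (fun y hy => (hd y hy).differentiableWithinAt)
      (fun y hy => (hd y hy).fderivWithin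
        (_root_.Metric.isOpen_ball.uniqueDiffWithinAt hy)) hy (_root_.Metric.mem_ball_self hr)
    simpa [φ.left_inv hxs] using this
  filter_upwards [(φ.continuousAt hxs).eventually (_root_.Metric.ball_mem_nhds (φ x) hr),
    φ.open_source.mem_nhds hxs] with z hz hzs
  have := hc _ hz
  rwa [φ.left_inv hzs] at this

/-- On a simply connected open set, a covector field with local primitives has a primitive. -/
theorem exists_global_primitive (hU : IsOpen U) (hsc : SimplyConnectedSpace U)
    (hloc : ∀ x ∈ U, ∃ W : Set M, IsOpen W ∧ x ∈ W ∧ W ⊆ U ∧ ∃ f : M → ℝ, SmoothOn n f W ∧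
      IsPrimitive η f W) : ∃ f : M → ℝ, SmoothOn n f U ∧ IsPrimitive η f U := by
  classical
  have : LocallyPathConnectedSpace M := ChartedSpace.locallyPathConnectedSpace (Coord n) M
  have : LocallyPathConnectedSpace U := hU.locallyPathConnectedSpace
  choose W hW hxW hWU f hf hp using fun x : U => hloc x x.2
  obtain ⟨F, hF⟩ := exists_global_of_local (fun x : U => Subtype.val ⁻¹' W x)
    (fun x => (hW x).preimage continuous_subtype_val) (fun x => ⟨x, hxW x⟩)
    (fun x z => f x z) fun i j x hx =>
      (continuous_subtype_val.tendsto x).eventually (IsPrimitive.eventually_sub_eq (η := η)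
        ((hW i).inter (hW j)) ((hf i).mono Set.inter_subset_left)
        ((hf j).mono Set.inter_subset_right)
        (fun φ hφ y hy => hp i φ hφ y ⟨hy.1, hy.2.1⟩)
        (fun φ hφ y hy => hp j φ hφ y ⟨hy.1, hy.2.2⟩) hx)
  -- The value 0 outside U is immaterial: U is open and only germs at points of U are used.
  set t : M → ℝ := fun x => if hx : x ∈ U then F ⟨x, hx⟩ else 0 with ht
  have hloc' : ∀ x : U, ∃ c : ℝ, ∀ᶠ z in nhds (x : M), t z = f x z + c := by
    intro x
    refine ⟨F x - f x x, ?_⟩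
    have h1 : ∀ᶠ z : U in nhds x, t z = f x z + (F x - f x x) := by
      filter_upwards [hF x x (hxW x)] with z hz
      rw [ht]
      simp only [z.2, dite_true]
      linear_combination hz
    rw [← map_nhds_subtype_coe_eq_nhds x.2 (hU.mem_nhds x.2)]
    exact h1
  refine ⟨t, fun x hx => ?_, fun φ hφ y hy => ?_⟩
  · obtain ⟨c, hc⟩ := hloc' ⟨x, hx⟩
    have h1 : ContMDiffAt (𝓡 n) 𝓘(ℝ, ℝ) ∞ (f ⟨x, hx⟩) x :=
      (hf ⟨x, hx⟩).contMDiffAt ((hW _).mem_nhds (hxW _))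
    exact ((h1.add contMDiffAt_const).congr_of_eventuallyEq hc).contMDiffWithinAt
  · obtain ⟨c, hc⟩ := hloc' ⟨φ.symm y, hy.2⟩
    have h1 : t ∘ φ.symm =ᶠ[nhds y] fun z => (f ⟨φ.symm y, hy.2⟩ ∘ φ.symm) z + c :=
      eventually_comp_symm hy.1 hc
    rw [h1.fderiv_eq, fderiv_add_const]
    exact hp _ φ hφ y ⟨hy.1, hxW _⟩

end Primitives

/-! ### The structure functions on the manifold: passage from one chart to all charts -/

section Manifold

variable {n : ℕ} {M : Type*} [TopologicalSpace M] [ChartedSpace (Coord n) M]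
  [IsManifold (𝓡 n) ∞ M] {g : Metric n M} {T : TensorField n 3 M} {S : System g} {κ : ℝ}
  {φ φ' : OpenPartialHomeomorph M (Coord n)} {y : Coord n} {U : Set M} {B : Set (Coord n)}
  {Φ C : M → ℝ}

/-- The Levi-Civita connection in a chart. -/
abbrev Metric.conn (g : Metric n M) (φ : OpenPartialHomeomorph M (Coord n)) :
    Coord n → Coord n →L[ℝ] Coord n →L[ℝ] Coord n :=
  leviCivita (Metric.local g φ) (Metric.localFrame g φ)

/-- The tensor `C` of a system in a chart. -/
abbrev chartC (g : Metric n M) (T : TensorField n 3 M) (κ : ℝ) (Φ : M → ℝ)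
    (φ : OpenPartialHomeomorph M (Coord n)) : Coord n → Coord n →L[ℝ] Coord n →L[ℝ] ℝ :=
  cField (Metric.local g φ) (TensorField.local T φ) (Metric.localFrame g φ) κ (Φ ∘ φ.symm)

theorem CoordinateChange.mono {D' D E' E : Set (Coord n)} {F : Coord n → Coord n}
    {g' g : Coord n → Coord n →L[ℝ] Coord n →L[ℝ] ℝ} {e' e : Coord n → Fin n → Coord n}
    (hF : CoordinateChange D' D F g' g e' e) (hE' : IsOpen E') (h : E' ⊆ D')
    (hm : ∀ y ∈ E', F y ∈ E) : CoordinateChange E' E F g' g e' e where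
  isOpen := hE'
  mapsTo := hm
  smooth := hF.smooth.mono h
  metric y hy := hF.metric y (h hy)
  frame y hy := hF.frame y (h hy)

theorem coordinateChange_region (g : Metric n M) (hφ' : φ' ∈ charts n M) (hφ : φ ∈ charts n M)
    (hB : IsOpen B) : CoordinateChange (chartDomain φ' (region φ B)) B (transition φ' φ)
      (Metric.local g φ') (Metric.local g φ) (Metric.localFrame g φ') (Metric.localFrame g φ) :=
  (Metric.coordinateChange g hφ' hφ).mono (isOpen_chartDomain (isOpen_region hB))
    (fun _ hy => chartDomain_region_overlap hy) fun _ hy => hy.2.2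

theorem isTracePotential_iff {t : M → ℝ} : IsTracePotential g T t U ↔
    IsPrimitive (fun φ y => tauCLM (TensorField.local T φ y) (Metric.localFrame g φ y)) t U := by
  refine forall₂_congr fun φ hφ => forall₂_congr fun y hy => ?_
  have h1 := traceForm_eq (Metric.isMetricComp (φ := φ) g _) (TensorField.isThreeComp (φ := φ) T _)
    hy.1 (Metric.isFrame g hφ hy.1)
  simp only [h1, grad_eq]
  refine ⟨fun h => ?_, fun h k => ?_⟩
  · ext1 u
    rw [← sum_coord_mul _ u, ← sum_coord_mul _ u]
    refine Finset.sum_congr rfl fun k _ => ?_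
    rw [tauCLM_apply]
    exact congrArg _ (h k)
  · rw [h, tauCLM_apply]
    rfl

variable [ConnectedSpace M] (hn : 3 ≤ n) (hκ : HasConstantCurvature g κ)
  (hT : IsNondegenerate S T)
include hn hκ hT

theorem IsNondegenerate.localSystem (hφ : φ ∈ charts n M) (hB : IsOpen B) (hs : B ⊆ φ.target) :
    LocalSystem B (Metric.local g φ) (TensorField.local T φ) (Metric.localFrame g φ) κ :=
  LocalSystem.mono ⟨Metric.localGeometry g hφ φ.open_target subset_rfl,
    hT.isStructureTensor.localStructure hφ, hT.jetsSurjective (by omega) hφ,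
    Metric.isConstCurv g hκ hφ⟩ hB hs

theorem IsNondegenerate.localSystem_chartDomain (hφ : φ ∈ charts n M) (hU : IsOpen U) :
    LocalSystem (chartDomain φ U) (Metric.local g φ) (TensorField.local T φ)
      (Metric.localFrame g φ) κ :=
  hT.localSystem hn hκ hφ (isOpen_chartDomain hU) fun _ hy => hy.1

/-- A local primitive found in one chart is a primitive in every chart because t is a contraction of
T over frames that correspond under the transition map. -/
theorem IsNondegenerate.exists_tracePotential (hU : IsOpen U) (hsc : SimplyConnectedSpace U) :
    ∃ t : M → ℝ, SmoothOn n t U ∧ IsTracePotential g T t U := by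
  simp only [isTracePotential_iff]
  refine exists_global_primitive hU hsc fun x hx => ?_
  set φ := chartAt (Coord n) x
  have hφ : φ ∈ charts n M := IsManifold.chart_mem_maximalAtlas x
  have hxs : x ∈ φ.source := mem_chart_source _ x
  have hS := hT.localSystem_chartDomain hn hκ hφ hU
  obtain ⟨B, hB, hxB, hBD, f, hf, hf'⟩ := exists_primitive hS.geometry.isOpen
    (hS.geometry.smooth_tau hS.tensor.smooth) (fun y hy v w => hS.geometry.closed_tau hS.tensor
      (by omega) hS.jets hS.curvature hy v w) (mem_chartDomain hx hxs)
  refine ⟨region φ B, isOpen_region hB, ⟨hxs, hxB⟩, region_subset hBD, f ∘ φ,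
    smoothOn_region hf hφ, fun φ' hφ' y hy => ?_⟩
  have hF := coordinateChange_region g hφ' hφ hB
  have hyo := chartDomain_region_overlap hy
  have hd := (hF.hess_eq (hS.mono hB hBD).geometry
    (hT.localSystem_chartDomain hn hκ hφ' (isOpen_region hB)).geometry hB hf hy hy.2.2
    (f' := (f ∘ φ) ∘ φ'.symm) (fun _ _ _ => rfl))
  ext1 u
  rw [(hd u 0).1, (hf' (transition φ' φ y) hy.2.2).fderiv, tauCLM_apply, tauCLM_apply]
  exact (tauForm_comp (hF.frame y hy)
    (TensorField.local_transition T hφ' hφ hyo) u).symm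

/-- `cField` is defined by X, which contains derivatives of Γ + S. Its expression through `zForm` is
algebraic in the metric, T and the frame, and therefore transforms pointwise. -/
theorem IsNondegenerate.chartC_transition (hφ' : φ' ∈ charts n M) (hφ : φ ∈ charts n M)
    (hy : y ∈ overlap φ' φ) (u v : Coord n) : chartC g T κ Φ φ' y u v =
      chartC g T κ Φ φ (transition φ' φ y) (fderiv ℝ (transition φ' φ) y u)
        (fderiv ℝ (transition φ' φ) y v) := by
  have hF := Metric.coordinateChange g hφ' hφ
  rw [chartC, chartC, (hT.localSystem hn hκ hφ' φ'.open_target subset_rfl).cField_apply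
    (by omega) hy.1, (hT.localSystem hn hκ hφ φ.open_target subset_rfl).cField_apply
    (by omega) (transition_mem hy), zForm_comp (hF.metric y hy) (hF.frame y hy)
    (TensorField.local_transition T hφ' hφ hy), hF.metric y hy, Function.comp, Function.comp,
    symm_transition hy]

theorem IsNondegenerate.cIsCodazzi_iff (hU : IsOpen U) (hΦ : SmoothOn n Φ U) :
    CIsCodazzi g T Φ U ↔ IsPrimitive (fun φ => phiForm (Metric.local g φ) (TensorField.local T φ)
      (Metric.localFrame g φ) κ) Φ U :=
  forall₂_congr fun _ hφ => (hT.localSystem_chartDomain hn hκ hφ hU).isCodazziTwo_iff (by omega)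
    (Metric.isMetricComp g _) (TensorField.isThreeComp T _) (hΦ.chart hφ)

/-- The form prescribed for dΦ is not transformed directly between charts. The Codazzi property
characterises it in each chart, and that property is tensorial. -/
theorem IsNondegenerate.exists_codazzi (hU : IsOpen U) (hsc : SimplyConnectedSpace U) :
    ∃ Φ : M → ℝ, SmoothOn n Φ U ∧ CIsCodazzi g T Φ U := by
  suffices h : ∃ Φ : M → ℝ, SmoothOn n Φ U ∧ IsPrimitive (fun φ => phiForm (Metric.local g φ)
      (TensorField.local T φ) (Metric.localFrame g φ) κ) Φ U by
    obtain ⟨Φ, hΦ, hp⟩ := h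
    exact ⟨Φ, hΦ, (hT.cIsCodazzi_iff hn hκ hU hΦ).2 hp⟩
  refine exists_global_primitive hU hsc fun x hx => ?_
  set φ := chartAt (Coord n) x
  have hφ : φ ∈ charts n M := IsManifold.chart_mem_maximalAtlas x
  have hxs : x ∈ φ.source := mem_chart_source _ x
  have hS := hT.localSystem_chartDomain hn hκ hφ hU
  obtain ⟨B, hB, hxB, hBD, f, hf, hf'⟩ := exists_primitive hS.geometry.isOpen
    hS.smooth_phiForm (fun y hy v w => hS.closed_phiForm hn hy v w) (mem_chartDomain hx hxs)
  have hfs := smoothOn_region hf hφ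
  refine ⟨region φ B, isOpen_region hB, ⟨hxs, hxB⟩, region_subset hBD, f ∘ φ,
    hfs, fun φ' hφ' y hy => ?_⟩
  have hF := coordinateChange_region g hφ' hφ hB
  have hSB := hS.mono hB hBD
  have hS' := hT.localSystem_chartDomain hn hκ hφ' (isOpen_region (φ := φ) hB)
  have heq : ∀ z ∈ B, ((f ∘ φ) ∘ φ.symm) z = f z := fun z hz => by
    rw [Function.comp, Function.comp, φ.right_inv (hBD hz).1]
  have hfB : ContDiffOn ℝ ∞ ((f ∘ φ) ∘ φ.symm) B := hf.congr heq
  have hcod := (hSB.cField_codazzi_iff (by omega) hfB hy.2.2).2 (by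
    rw [fderiv_eq_of_eqOn hB heq hy.2.2]
    exact (hf' (transition φ' φ y) hy.2.2).fderiv)
  -- In the second chart the equation for dΦ is replaced by the Codazzi property, which is pulled
  -- back from the first chart.
  refine (hS'.cField_codazzi_iff (by omega) (hfs.chart hφ') hy).1 fun u v w => ?_
  have hcov := hF.covB_eq hSB.geometry hS'.geometry hy
    (ContDiffOn.differentiableAt_of_mem (hS'.smooth_cField (hfs.chart hφ')) hF.isOpen hy)
    (ContDiffOn.differentiableAt_of_mem (hSB.smooth_cField hfB) hB hy.2.2)
    (fun z hz => hT.chartC_transition hn hκ hφ' hφ (chartDomain_region_overlap hz))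
  rw [hcov, hcov]
  exact hcod _ _ _

theorem IsNondegenerate.isCPotential_iff (hU : IsOpen U) (hC : SmoothOn n C U) :
    IsCPotential g κ T Φ C U ↔ ∀ φ ∈ charts n M, ∀ y ∈ chartDomain φ U, ∀ u v,
      fderiv ℝ (fderiv ℝ (C ∘ φ.symm)) y u v -
          fderiv ℝ (C ∘ φ.symm) y (Metric.conn g φ y u v) =
        chartC g T κ Φ φ y u v - κ * (C ∘ φ.symm) y * Metric.local g φ y u v :=
  forall₂_congr fun _ hφ => (hT.localSystem_chartDomain hn hκ hφ hU).hasPotentialTwo_iff (by omega)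
    (Metric.isMetricComp g _) (TensorField.isThreeComp T _) (hC.chart hφ)

theorem IsNondegenerate.exists_isCPotential (hU : IsOpen U) (hΦ : SmoothOn n Φ U)
    (hcod : CIsCodazzi g T Φ U) {x : M} (hx : x ∈ U) : ∃ U' : Set M, IsOpen U' ∧ x ∈ U' ∧
      U' ⊆ U ∧ ∃ C : M → ℝ, SmoothOn n C U' ∧ IsCPotential g κ T Φ C U' := by
  set φ := chartAt (Coord n) x
  have hφ : φ ∈ charts n M := IsManifold.chart_mem_maximalAtlas x
  have hxs : x ∈ φ.source := mem_chart_source _ x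
  have hS := hT.localSystem_chartDomain hn hκ hφ hU
  have hp := (hT.cIsCodazzi_iff hn hκ hU hΦ).1 hcod φ hφ
  obtain ⟨B, hB, hxB, hBD, f, hf, hf'⟩ := hS.geometry.exists_potentialTwo hS.curvature
    (hS.smooth_cField (hΦ.chart hφ)) (fun y hy => hS.cField_symm (by omega) hy)
    (fun y hy => (hS.cField_codazzi_iff (by omega) (hΦ.chart hφ) hy).2 (hp y hy))
    (mem_chartDomain hx hxs)
  have hfs := smoothOn_region hf hφ
  refine ⟨region φ B, isOpen_region hB, ⟨hxs, hxB⟩, region_subset hBD, f ∘ φ, hfs,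
    (hT.isCPotential_iff hn hκ (isOpen_region hB) hfs).2 fun φ' hφ' y hy u v => ?_⟩
  have hF := coordinateChange_region g hφ' hφ hB
  have hSB := hS.mono hB hBD
  have hS' := hT.localSystem_chartDomain hn hκ hφ' (isOpen_region (φ := φ) hB)
  rw [(hF.hess_eq hSB.geometry hS'.geometry hB hf hy hy.2.2
    (f' := (f ∘ φ) ∘ φ'.symm) (fun _ _ _ => rfl) u v).2,
    hf' (transition φ' φ y) hy.2.2, hT.chartC_transition hn hκ hφ' hφ (chartDomain_region_overlap hy),
    hF.metric y hy]
  rfl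

theorem IsNondegenerate.bIsCodazzi (hU : IsOpen U) (hC : SmoothOn n C U)
    (hp : IsCPotential g κ T Φ C U) : BIsCodazzi g T C U := fun φ hφ =>
  (hT.localSystem_chartDomain hn hκ hφ hU).isCodazziThree hn (Metric.isMetricComp g _)
    (TensorField.isThreeComp T _) (hC.chart hφ)
    ((hT.isCPotential_iff hn hκ hU hC).1 hp φ hφ)

theorem IsNondegenerate.exists_isBPotential (hU : IsOpen U) (hC : SmoothOn n C U)
    (hp : IsCPotential g κ T Φ C U) {x : M} (hx : x ∈ U) : ∃ U' : Set M, IsOpen U' ∧ x ∈ U' ∧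
      U' ⊆ U ∧ ∃ B : M → ℝ, SmoothOn n B U' ∧ IsBPotential g κ T C B U' := by
  set φ := chartAt (Coord n) x
  have hφ : φ ∈ charts n M := IsManifold.chart_mem_maximalAtlas x
  have hxs : x ∈ φ.source := mem_chart_source _ x
  have hS := hT.localSystem_chartDomain hn hκ hφ hU
  have hn' : 2 ≤ n := by omega
  have hCφ := hC.chart hφ
  obtain ⟨B, hB, hxB, hBD, f, hf, H, hH, hfH, hcov⟩ := hS.geometry.exists_potentialThree
    hS.curvature (hS.geometry.smooth_bCLM hS.tensor
      (ContDiffOn.fderiv_infty hCφ hS.geometry.isOpen))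
    (fun y hy u v w => (hS.geometry.bCLM_symm hS.tensor hn' hS.jets hy _ u v w).1)
    (fun y hy u v w => (hS.geometry.bCLM_symm hS.tensor hn' hS.jets hy _ u v w).2)
    (fun y hy u v w z => hS.bField_codazzi hn hCφ
      ((hT.isCPotential_iff hn hκ hU hC).1 hp φ hφ) hy u v w z) (mem_chartDomain hx hxs)
  have hfs := smoothOn_region hf hφ
  refine ⟨region φ B, isOpen_region hB, ⟨hxs, hxB⟩, region_subset hBD, f ∘ φ, hfs,
    fun φ' hφ' => ?_⟩
  have hF := coordinateChange_region g hφ' hφ hB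
  have hSB := hS.mono hB hBD
  have hS' := hT.localSystem_chartDomain hn hκ hφ' (isOpen_region (φ := φ) hB)
  have sJ : ContDiffOn ℝ ∞ (fderiv ℝ (transition φ' φ)) (chartDomain φ' (region φ B)) :=
    ContDiffOn.fderiv_infty hF.smooth hF.isOpen
  have sHF : ContDiffOn ℝ ∞ (fun y => H (transition φ' φ y)) (chartDomain φ' (region φ B)) :=
    hH.comp hF.smooth hF.mapsTo
  -- The Hessian H is known only in the first chart; in any other chart its pullback by the
  -- transition map takes its place.
  have sH' : ContDiffOn ℝ ∞ (fun y => (H (transition φ' φ y)).bilinearComp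
      (fderiv ℝ (transition φ' φ) y) (fderiv ℝ (transition φ' φ) y))
      (chartDomain φ' (region φ B)) :=
    contDiffOn_clm_apply₂ fun u v => (sHF.clm_apply (sJ.clm_apply contDiffOn_const)).clm_apply
      (sJ.clm_apply contDiffOn_const)
  have hfd := fun y (hy : y ∈ chartDomain φ' (region φ B)) =>
    hF.hess_eq hSB.geometry hS'.geometry hB hf hy hy.2.2 (f' := (f ∘ φ) ∘ φ'.symm)
      (fun _ _ _ => rfl)
  refine hS'.hasPotentialThree hn (Metric.isMetricComp g _) (TensorField.isThreeComp T _)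
    (hfs.chart hφ') sH' (fun y hy u v => ?_) fun y hy u v w => ?_
  · rw [(hfd y hy u v).2, hfH (transition φ' φ y) hy.2.2]
    rfl
  · have hyo := chartDomain_region_overlap hy
    have hCd := fun u => (hF.hess_eq hSB.geometry hS'.geometry hB (hCφ.mono hBD) hy hy.2.2
      (f' := C ∘ φ'.symm) (fun z hz _ => by
        rw [Function.comp, Function.comp, symm_transition (chartDomain_region_overlap hz)]) u 0).1
    have hb := bCLM_comp (hS'.geometry.frame y hy)
      (hSB.geometry.frame _ hy.2.2) (hF.metric y hy) (hF.frame y hy)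
      (TensorField.local_transition T hφ' hφ hyo) hCd u v w
    rw [hF.covB_eq hSB.geometry hS'.geometry hy
      (ContDiffOn.differentiableAt_of_mem sH' hF.isOpen hy)
      (ContDiffOn.differentiableAt_of_mem hH hB hy.2.2) (fun _ _ _ _ => rfl), hcov (transition φ' φ y) hy.2.2,
      (hfd y hy w 0).1, (hfd y hy u 0).1, (hfd y hy v 0).1, hF.metric y hy, hF.metric y hy,
      hF.metric y hy]
    exact congrArg (· - _) hb.symm

end Manifold

end SuperInt
end

theorem mainTheorem11 (n : ℕ) (hn : 3 ≤ n) (M : Type*) [TopologicalSpace M]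
    [ChartedSpace (SuperInt.Coord n) M] [IsManifold (𝓡 n) ∞ M] [T2Space M]
    [SecondCountableTopology M] [ConnectedSpace M]
    (g : SuperInt.Metric n M) (κ : ℝ) (hκ : SuperInt.HasConstantCurvature g κ)
    (S : SuperInt.System g) (T : SuperInt.TensorField n 3 M)
    (hT : SuperInt.IsNondegenerate S T) :
    -- existence of `t` and of `Φ` with `C_{ij} = Z_{ij} + Φ g_{ij}` a Codazzi tensor
    (∀ U : Set M, IsOpen U → SimplyConnectedSpace U →
      (∃ t : M → ℝ, SuperInt.SmoothOn n t U ∧ SuperInt.IsTracePotential g T t U) ∧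
      ∃ Φ : M → ℝ, SuperInt.SmoothOn n Φ U ∧ SuperInt.CIsCodazzi g T Φ U) ∧
    -- the structure function `C`, locally
    (∀ (U : Set M) (Φ : M → ℝ), IsOpen U → SuperInt.SmoothOn n Φ U →
      SuperInt.CIsCodazzi g T Φ U → ∀ x ∈ U, ∃ U' : Set M, IsOpen U' ∧ x ∈ U' ∧ U' ⊆ U ∧
        ∃ C : M → ℝ, SuperInt.SmoothOn n C U' ∧ SuperInt.IsCPotential g κ T Φ C U') ∧
    -- `B_{ijk}` is a Codazzi tensor, and the structure function `B`, locally
    (∀ (U : Set M) (Φ C : M → ℝ), IsOpen U → SuperInt.SmoothOn n Φ U →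
      SuperInt.SmoothOn n C U → SuperInt.CIsCodazzi g T Φ U →
      SuperInt.IsCPotential g κ T Φ C U →
      SuperInt.BIsCodazzi g T C U ∧
      ∀ x ∈ U, ∃ U' : Set M, IsOpen U' ∧ x ∈ U' ∧ U' ⊆ U ∧
        ∃ B : M → ℝ, SuperInt.SmoothOn n B U' ∧ SuperInt.IsBPotential g κ T C B U') := by
  refine ⟨fun U hU hsc => ⟨hT.exists_tracePotential hn hκ hU hsc, hT.exists_codazzi hn hκ hU hsc⟩,
    fun U Φ hU hΦ hcod x hx => hT.exists_isCPotential hn hκ hU hΦ hcod hx,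
    fun U Φ C hU _ hC _ hp => ⟨hT.bIsCodazzi hn hκ hU hC hp, fun x hx =>
      hT.exists_isBPotential hn hκ hU hC hp hx⟩⟩
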